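/- **Setting.** Let $\mathcal S,\mathcal U,\mathcal V$ be topological spaces with their Borel $\sigma$-algebras, and let $P$, $P_U$, $P_V$ be Borel probability measures on $\mathcal S$, $\mathcal U$, $\mathcal V$. Let $k:\mathcal S\times\mathcal S\to\mathbb R$ be a bounded, measurable, symmetric, positive definite kernel that is characteristic, i.e. $\rho\mapsto\int k(\cdot,x)\,\rho(dx)$ is injective on Borel probability measures. Put $$\mathrm{MMD}^2(P_1,P_2)=\mathbb E\big[k(X,X')-2k(X,Y)+k(Y,Y')\big],\qquad X,X'\sim P_1,\ Y,Y'\sim P_2\ \text{independent}.$$ **Kernels and estimators.** Let $$h\big((x_1,y_1),(x_2,y_2)\big)=k(x_1,x_2)-k(x_1,y_2)-k(x_2,y_1)+k(y_1,y_2),$$ $$q\big((x_1,y_1,x_2,y_2),(x_3,y_3,x_4,y_4)\big)=k(x_1,x_3)-k(x_4,y_2)-k(x_2,y_4)+k(y_1,y_3).$$ For a function $\eta$ of two arguments and $c\in\mathbb R$ write $[\eta]_c(a_1,a_2,a_3)=\tfrac c3\{\eta(a_1,a_2)\eta(a_1,a_3)+\eta(a_2,a_1)\eta(a_2,a_3)+\eta(a_3,a_2)\eta(a_3,a_1)\}$.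 The sample size is even, $n=2m$. For $x,y\in\mathcal S^n$ put $$\widehat{\mathrm{MMD}}{}^2(x,y)=\tfrac1{n(n-1)}\sum_{i\ne j\le n}h\big((x_i,y_i),(x_j,y_j)\big),$$ $$\widehat{\mathrm{MMD}}{}^2_q(x,y)=\tfrac1{m(m-1)}\sum_{i\ne j\le m}q\big((x_{2i-1},y_{2i-1},x_{2i},y_{2i}),(x_{2j-1},y_{2j-1},x_{2j},y_{2j})\big),$$ and $\widehat{\mathrm{MMD}}{}^2_{\varepsilon}=\widehat{\mathrm{MMD}}{}^2+\varepsilon\,\widehat{\mathrm{MMD}}{}^2_q$. For $x,y,z\in\mathcal S^n$ let $t_i=(x_i,y_i,z_i)$, let $\bar h(t_1,t_2)=h((x_1,y_1),(x_2,y_2))-h((x_1,z_1),(x_2,z_2))$, and let $\bar q\big((t_1,t_2),(t_3,t_4)\big)$ be the difference of $q$ at the $(x,y)$'s and $q$ at the $(x,z)$'s. Let $$\hat\sigma^2=\tfrac1{n(n-1)(n-2)}\sum_{i,j,l\le n\text{ distinct}}[\bar h]_4(t_i,t_j,t_l)-4D^2,\qquad \hat\sigma_q^2=\tfrac1{m(m-1)(m-2)}\sum_{i,j,l\le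 m\text{ distinct}}[\bar q]_8(s_i,s_j,s_l)-8D^2,$$ where $s_i=(t_{2i-1},t_{2i})$ and $D=\widehat{\mathrm{MMD}}{}^2(x,y)-\widehat{\mathrm{MMD}}{}^2(x,z)$; the square root $\hat\sigma$ (resp. $\hat\sigma_q$) of a negative estimate is read as $0$. **Models.** Let $\Theta_\alpha\subset\mathbb R^{p_\alpha}$ be compact, let $F:\mathcal U\times\Theta_\alpha\to\mathcal S$ be measurable, let $P_\alpha$ be the law of $F(U;\alpha)$ for $U\sim P_U$, and let $\alpha_\star$ be an interior point of $\Theta_\alpha$ that minimizes $\alpha\mapsto\mathrm{MMD}^2(P_\alpha,P)$ over $\Theta_\alpha$. Assume: 1. $\alpha\mapsto\mathrm{MMD}^2(P_\alpha,P)$ is twice continuously differentiable near $\alpha_\star$, and $\int k(X,F(u;\alpha_\star))\,P_U(du)$, $X\sim P$, is not almost surely constant. 2. $\alpha\mapsto k(x,F(u;\alpha))$ and $\alpha\mapsto k(F(u;\alpha),F(u';\alpha))$ are twice differentiable in the interior of $\Theta_\alpha$, for all $x\in\mathcal S$, $u,u'\in\mathcal U$. 3. Let $(X_i,U_i)\sim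 P\otimes P_U$ be i.i.d. and let $\kappa_\alpha$ be any of the random variables $h\big((X_1,F(U_1;\alpha)),(X_2,F(U_2;\alpha))\big)$, $q\big((X_i,F(U_i;\alpha))_{i\le4}\big)$, $[h]_4\big((X_i,F(U_i;\alpha))_{i\le3}\big)$. Then $\mathbb E\sup_{\|\alpha-\alpha_\star\|<\delta}\|\nabla^2_\alpha\kappa_\alpha\|<\infty$ for some $\delta>0$ (with the ball contained in $\Theta_\alpha$), and $\mathbb E\nabla_\alpha\kappa_{\alpha_\star}=\nabla_\alpha\mathbb E\kappa_\alpha|_{\alpha=\alpha_\star}$. Let a second model $\{Q_\beta:\beta\in\Theta_\beta\}$, $Q_\beta=\mathrm{Law}(G(V;\beta))$, $V\sim P_V$, $\Theta_\beta\subset\mathbb R^{p_\beta}$, with minimizer $\beta_\star$, satisfy the same conditions (with $G,V,\beta$ for $F,U,\alpha$). **Non-degeneracy.** Let $X\sim P$, $U,\tilde U\sim P_U$, $V,\tilde V\sim P_V$ be independent. Assume that at least one of the following five random variables is not almost surely constant: $\mathbb E[k(X,F(U;\alpha_\star))\,|\,U]$, $\ \mathbb E[k(F(U;\alpha_\star),F(\tilde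 U;\alpha_\star))\,|\,U]$, $\ \mathbb E[k(X,G(V;\beta_\star))\,|\,V]$, $\ \mathbb E[k(G(V;\beta_\star),G(\tilde V;\beta_\star))\,|\,V]$, $\ \mathbb E[k(X,F(U;\alpha_\star))-k(X,G(V;\beta_\star))\,|\,X]$. (By condition 1 this holds automatically if $P=P_{\alpha_\star}$ or $P=Q_{\beta_\star}$.) **Sampling.** On a probability space let $(X_i,U_i,V_i)_{i\ge1}$ be i.i.d. with $X_i\sim P$, $U_i\sim P_U$, $V_i\sim P_V$, such that the sequences $(X_i)$, $(U_i)$, $(V_i)$ are pairwise independent. Let $\alpha_n$, $\beta_n$ be random variables in $\Theta_\alpha$, $\Theta_\beta$ (possibly depending on the samples) with $\sqrt n(\alpha_n-\alpha_\star)=O_{\mathbb P}(1)$ and $\sqrt n(\beta_n-\beta_\star)=O_{\mathbb P}(1)$. Let $\varepsilon_n>0$ be (possibly random, data-dependent) weights with $\varepsilon_n\to0$ and $\varepsilon_n\sqrt n\to\infty$ in probability. **Theorem.** Let $x=(X_i)_{i\le n}$, $y=(F(U_i;\alpha_n))_{i\le n}$, $z=(G(V_i;\beta_n))_{i\le n}$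 and $$\mathcal T_n=\sqrt n\;\frac{\widehat{\mathrm{MMD}}{}^2_{\varepsilon_n}(x,y)-\widehat{\mathrm{MMD}}{}^2_{\varepsilon_n}(x,z)}{\hat\sigma(x,y,z)+\varepsilon_n\,\hat\sigma_q(x,y,z)}.$$ As $n\to\infty$ along even integers: 1. If $\mathrm{MMD}(P_{\alpha_\star},P)=\mathrm{MMD}(Q_{\beta_\star},P)$ (in particular if $P=P_{\alpha_\star}=Q_{\beta_\star}$), then $\mathcal T_n\to\mathcal N(0,1)$ in law. 2. If $\mathrm{MMD}(P_{\alpha_\star},P)>\mathrm{MMD}(Q_{\beta_\star},P)$, then $\mathcal T_n\to+\infty$ in probability. 3. If $\mathrm{MMD}(P_{\alpha_\star},P)<\mathrm{MMD}(Q_{\beta_\star},P)$, then $\mathcal T_n\to-\infty$ in probability. -/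

import Mathlib

open MeasureTheory ProbabilityTheory Filter Topology

noncomputable section

namespace MMDTest

section Kernel

variable {S : Type*} [MeasurableSpace S]

/-- A bounded, measurable, symmetric, positive definite and characteristic kernel.
Elements of the reproducing kernel Hilbert space of `k` are functions on `S`; the mean embedding
of `ρ` is the function `y ↦ ∫ k(y, x) ρ(dx)`, and `characteristic` says that `ρ ↦` (mean
embedding) is injective on probability measures. -/
structure IsCharacteristicKernel (k : S → S → ℝ) : Prop where
  measurable : Measurable (fun z : S × S => k z.1 z.2)
  symm : ∀ x y, k x y = k y x
  posDef : ∀ (s : Finset S) (c : S → ℝ), 0 ≤ ∑ x ∈ s, ∑ y ∈ s, c x * c y * k x y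
  bounded : ∃ C : ℝ, ∀ x y, |k x y| ≤ C
  characteristic : ∀ ρ₁ ρ₂ : Measure S, IsProbabilityMeasure ρ₁ → IsProbabilityMeasure ρ₂ →
    (fun y => ∫ x, k y x ∂ρ₁) = (fun y => ∫ x, k y x ∂ρ₂) → ρ₁ = ρ₂

/-- `MMD²(P₁, P₂) = E[k(X, X') - 2 k(X, Y) + k(Y, Y')]`, with `X, X' ∼ P₁` and `Y, Y' ∼ P₂`
independent. -/
def mmdSq (k : S → S → ℝ) (P₁ P₂ : Measure S) : ℝ :=
  (∫ x, ∫ x', k x x' ∂P₁ ∂P₁) - 2 * (∫ x, ∫ y, k x y ∂P₂ ∂P₁) + ∫ y, ∫ y', k y y' ∂P₂ ∂P₂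

/-- The maximum mean discrepancy. -/
def mmd (k : S → S → ℝ) (P₁ P₂ : Measure S) : ℝ := √(mmdSq k P₁ P₂)

end Kernel

section UStatistics

variable {S : Type*}

/-- `h((x₁, y₁), (x₂, y₂))`. -/
def hKer (k : S → S → ℝ) (a b : S × S) : ℝ :=
  k a.1 b.1 - k a.1 b.2 - k b.1 a.2 + k a.2 b.2

/-- `q((x₁, y₁, x₂, y₂), (x₃, y₃, x₄, y₄))`, with `a = ((x₁, y₁), (x₂, y₂))` and
`b = ((x₃, y₃), (x₄, y₄))`. -/
def qKer (k : S → S → ℝ) (a b : (S × S) × (S × S)) : ℝ :=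
  k a.1.1 b.1.1 - k b.2.1 a.2.2 - k a.2.1 b.2.2 + k a.1.2 b.1.2

/-- The symmetrized product kernel of three arguments that is used for variance estimation. -/
def prodKer {T : Type*} (c : ℝ) (η : T → T → ℝ) (a₁ a₂ a₃ : T) : ℝ :=
  c / 3 * (η a₁ a₂ * η a₁ a₃ + η a₂ a₁ * η a₂ a₃ + η a₃ a₂ * η a₃ a₁)

/-- The comparison kernel `h`: the difference of the kernels `h` of the two models, at points
`(x, y, z)` where `x` is an observation, `y` and `z` are draws from the first and second model. -/
def hCmp (k : S → S → ℝ) (a b : S × S × S) : ℝ :=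
  hKer k (a.1, a.2.1) (b.1, b.2.1) - hKer k (a.1, a.2.2) (b.1, b.2.2)

/-- The comparison kernel `q`: the difference of the kernels `q` of the two models. -/
def qCmp (k : S → S → ℝ) (a b : (S × S × S) × (S × S × S)) : ℝ :=
  qKer k ((a.1.1, a.1.2.1), (a.2.1, a.2.2.1)) ((b.1.1, b.1.2.1), (b.2.1, b.2.2.1)) -
    qKer k ((a.1.1, a.1.2.2), (a.2.1, a.2.2.2)) ((b.1.1, b.1.2.2), (b.2.1, b.2.2.2))

/-- U-statistic of order two of `η` over the sample `t 0, …, t (n - 1)`. -/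
def uStat2 {T : Type*} (n : ℕ) (η : T → T → ℝ) (t : ℕ → T) : ℝ :=
  1 / ((n : ℝ) * ((n : ℝ) - 1)) *
    ∑ i ∈ Finset.range n, ∑ j ∈ Finset.range n, if i ≠ j then η (t i) (t j) else 0

/-- U-statistic of order three of `η` over the sample `t 0, …, t (n - 1)`. -/
def uStat3 {T : Type*} (n : ℕ) (η : T → T → T → ℝ) (t : ℕ → T) : ℝ :=
  1 / ((n : ℝ) * ((n : ℝ) - 1) * ((n : ℝ) - 2)) *
    ∑ i ∈ Finset.range n, ∑ j ∈ Finset.range n, ∑ l ∈ Finset.range n,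
      if i ≠ j ∧ i ≠ l ∧ l ≠ j then η (t i) (t j) (t l) else 0

/-- Consecutive observations grouped in pairs: `(t₀, t₁), (t₂, t₃), …`. -/
def pairs {T : Type*} (t : ℕ → T) (i : ℕ) : T × T := (t (2 * i), t (2 * i + 1))

/-- The unbiased estimator of `MMD²` from two samples `x`, `y` of size `n`. -/
def mmdSqHat (k : S → S → ℝ) (n : ℕ) (x y : ℕ → S) : ℝ :=
  uStat2 n (hKer k) (fun i => (x i, y i))

/-- The estimator of `MMD²` with kernel `q`, from two samples of (even) size `2 m`. -/
def mmdSqHatQ (k : S → S → ℝ) (m : ℕ) (x y : ℕ → S) : ℝ :=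
  uStat2 m (qKer k) (pairs fun i => (x i, y i))

/-- The weighted estimator with weight `ε`, from two samples of size `2 m`. -/
def mmdSqHatEps (k : S → S → ℝ) (m : ℕ) (ε : ℝ) (x y : ℕ → S) : ℝ :=
  mmdSqHat k (2 * m) x y + ε * mmdSqHatQ k m x y

/-- The variance estimator `σ̂²` for model comparison, sample size `n`. -/
def sigmaSqHat (k : S → S → ℝ) (n : ℕ) (x y z : ℕ → S) : ℝ :=
  uStat3 n (prodKer 4 (hCmp k)) (fun i => (x i, y i, z i)) -
    4 * (mmdSqHat k n x y - mmdSqHat k n x z) ^ 2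

/-- The variance estimator `σ̂²_q` for model comparison, sample size `2 m`. -/
def sigmaSqHatQ (k : S → S → ℝ) (m : ℕ) (x y z : ℕ → S) : ℝ :=
  uStat3 m (prodKer 8 (qCmp k)) (pairs fun i => (x i, y i, z i)) -
    8 * (mmdSqHat k (2 * m) x y - mmdSqHat k (2 * m) x z) ^ 2

/-- The model comparison statistic for sample size `n = 2 m`, data `x`, and draws `y`, `z` from
the two models. The square root of a negative variance estimate is `0`. -/
def testStat (k : S → S → ℝ) (m : ℕ) (ε : ℝ) (x y z : ℕ → S) : ℝ :=
  √((2 * m : ℕ) : ℝ) * (mmdSqHatEps k m ε x y - mmdSqHatEps k m ε x z) /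
    (√(sigmaSqHat k (2 * m) x y z) + ε * √(sigmaSqHatQ k m x y z))

end UStatistics

section Models

variable {S : Type*} [MeasurableSpace S] {𝒰 : Type*} [MeasurableSpace 𝒰]
  {E : Type*} [NormedAddCommGroup E] [NormedSpace ℝ E]

/-- The law of `F(U; α)` for `U ∼ P_U`. -/
def modelLaw (F : 𝒰 → E → S) (PU : Measure 𝒰) (α : E) : Measure S := PU.map (fun u => F u α)

/-- `f` is almost surely constant. -/
def AEConst {T : Type*} [MeasurableSpace T] (ρ : Measure T) (f : T → ℝ) : Prop :=
  ∃ c : ℝ, ∀ᵐ t ∂ρ, f t = c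

/-- The point `(x, F(u; α))`. -/
def genPoint (F : 𝒰 → E → S) (α : E) (z : S × 𝒰) : S × S := (z.1, F z.2 α)

/-- `h(x₁, u₁, x₂, u₂; α)`. -/
def hModel (k : S → S → ℝ) (F : 𝒰 → E → S) (z : Fin 2 → S × 𝒰) (α : E) : ℝ :=
  hKer k (genPoint F α (z 0)) (genPoint F α (z 1))

/-- `q(x₁, u₁, …, x₄, u₄; α)`. -/
def qModel (k : S → S → ℝ) (F : 𝒰 → E → S) (z : Fin 4 → S × 𝒰) (α : E) : ℝ :=
  qKer k (genPoint F α (z 0), genPoint F α (z 1)) (genPoint F α (z 2), genPoint F α (z 3))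

/-- `g_α(x₁, u₁, x₂, u₂, x₃, u₃)`. -/
def gModel (k : S → S → ℝ) (F : 𝒰 → E → S) (z : Fin 3 → S × 𝒰) (α : E) : ℝ :=
  prodKer 4 (hKer k) (genPoint F α (z 0)) (genPoint F α (z 1)) (genPoint F α (z 2))

/-- Twice differentiability on a set (used for open sets only). -/
def TwiceDifferentiableOn (f : E → ℝ) (s : Set E) : Prop :=
  DifferentiableOn ℝ f s ∧ DifferentiableOn ℝ (fderiv ℝ f) s

/-- Moment conditions on the derivatives of a parametrized kernel `κ` at arguments with law `ρ`:
the supremum over the ball of the norm of the Hessian has finite (outer) expectation, i.e. an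
integrable upper bound, and gradient and expectation can be exchanged at `αs`. -/
structure MomentConditions {T : Type*} [MeasurableSpace T] (ρ : Measure T) (κ : T → E → ℝ)
    (αs : E) (δ : ℝ) : Prop where
  hessian : ∃ H : T → ℝ, Integrable H ρ ∧
    ∀ᵐ z ∂ρ, ∀ α ∈ Metric.ball αs δ, ‖fderiv ℝ (fderiv ℝ (κ z)) α‖ ≤ H z
  gradient_integrable : Integrable (fun z => fderiv ℝ (κ z) αs) ρ
  gradient_exchange :
    HasFDerivAt (fun α => ∫ z, κ z α ∂ρ) (∫ z, fderiv ℝ (κ z) αs ∂ρ) αs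

/-- Regularity of the model `{law of F(U; α) : α ∈ Θ}`, `U ∼ P_U`, around the parameter `αs`,
when the data have law `P`. Only the values of `F` at parameters in `Θ` matter. -/
structure RegularModel [MeasurableSpace E] (k : S → S → ℝ) (P : Measure S) (F : 𝒰 → E → S) (PU : Measure 𝒰)
    (Θ : Set E) (αs : E) : Prop where
  compact : IsCompact Θ
  measurable_gen : Measurable (fun z : 𝒰 × Θ => F z.1 (z.2 : E))
  mem_interior : αs ∈ interior Θ
  contDiffAt_mmdSq : ContDiffAt ℝ 2 (fun α => mmdSq k (modelLaw F PU α) P) αs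
  not_const : ¬ AEConst P (fun x => ∫ u, k x (F u αs) ∂PU)
  twice_diff₁ : ∀ x u, TwiceDifferentiableOn (fun α => k x (F u α)) (interior Θ)
  twice_diff₂ : ∀ u u', TwiceDifferentiableOn (fun α => k (F u α) (F u' α)) (interior Θ)
  moments : ∃ δ > 0, Metric.ball αs δ ⊆ Θ ∧
    MomentConditions (Measure.pi fun _ : Fin 2 => P.prod PU) (hModel k F) αs δ ∧
    MomentConditions (Measure.pi fun _ : Fin 4 => P.prod PU) (qModel k F) αs δ ∧
    MomentConditions (Measure.pi fun _ : Fin 3 => P.prod PU) (gModel k F) αs δ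

/-- Five functions, depending on `U`, on `U`, on `V`, on `V` and on `X` respectively, are all
almost surely constant. -/
def AllConst {𝒱 E' : Type*} [MeasurableSpace 𝒱] (k : S → S → ℝ) (P : Measure S)
    (F : 𝒰 → E → S) (PU : Measure 𝒰) (αs : E) (G : 𝒱 → E' → S) (PV : Measure 𝒱) (βs : E') :
    Prop :=
  AEConst PU (fun u => ∫ x, k x (F u αs) ∂P) ∧
  AEConst PU (fun u => ∫ u', k (F u αs) (F u' αs) ∂PU) ∧
  AEConst PV (fun v => ∫ x, k x (G v βs) ∂P) ∧
  AEConst PV (fun v => ∫ v', k (G v βs) (G v' βs) ∂PV) ∧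
  AEConst P (fun x => (∫ u, k x (F u αs) ∂PU) - ∫ v, k x (G v βs) ∂PV)

end Models

section Sampling

variable {Ω : Type*} [MeasurableSpace Ω]

/-- The sampling scheme: the triples `(X_i, U_i, V_i)` are i.i.d., the margins have laws
`P`, `P_U`, `P_V`, and the three sequences are pairwise independent. -/
structure IsSample {S 𝒰 𝒱 : Type*} [MeasurableSpace S] [MeasurableSpace 𝒰] [MeasurableSpace 𝒱]
    (μ : Measure Ω) (P : Measure S) (PU : Measure 𝒰) (PV : Measure 𝒱)
    (X : ℕ → Ω → S) (U : ℕ → Ω → 𝒰) (V : ℕ → Ω → 𝒱) : Prop where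
  measurable_X : ∀ i, Measurable (X i)
  measurable_U : ∀ i, Measurable (U i)
  measurable_V : ∀ i, Measurable (V i)
  law_X : ∀ i, μ.map (X i) = P
  law_U : ∀ i, μ.map (U i) = PU
  law_V : ∀ i, μ.map (V i) = PV
  iIndep : iIndepFun (fun i ω => (X i ω, U i ω, V i ω)) μ
  ident : ∀ i, IdentDistrib (fun ω => (X i ω, U i ω, V i ω)) (fun ω => (X 0 ω, U 0 ω, V 0 ω)) μ μ
  indep_XU : IndepFun (fun ω i => X i ω) (fun ω i => U i ω) μ
  indep_XV : IndepFun (fun ω i => X i ω) (fun ω i => V i ω) μ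
  indep_UV : IndepFun (fun ω i => U i ω) (fun ω i => V i ω) μ

/-- `Z_m = O_P(1)`. -/
def BoundedInProb {E : Type*} [Norm E] (μ : Measure Ω) (Z : ℕ → Ω → E) : Prop :=
  ∀ η : ENNReal, 0 < η → ∃ M : ℝ, ∀ᶠ m in atTop, μ {ω | M < ‖Z m ω‖} ≤ η

/-- `Z_m → +∞` in probability. -/
def TendstoInProbAtTop (μ : Measure Ω) (Z : ℕ → Ω → ℝ) : Prop :=
  ∀ M : ℝ, Tendsto (fun m => μ {ω | Z m ω ≤ M}) atTop (𝓝 0)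

/-- `Z_m → -∞` in probability. -/
def TendstoInProbAtBot (μ : Measure Ω) (Z : ℕ → Ω → ℝ) : Prop :=
  ∀ M : ℝ, Tendsto (fun m => μ {ω | M ≤ Z m ω}) atTop (𝓝 0)

end Sampling

end MMDTest

end

noncomputable section

set_option linter.unusedSectionVars false

namespace MMDTest

/-! ### Convergence in probability as convergence along a filter; stochastic boundedness. -/

section HighProbability

variable {Ω : Type*} [MeasurableSpace Ω]

/-! The numerator of the statistic is √n (D + ε Q), where D and Q are U-statistics of order two. The
kernel of D is the comparison kernel of h, evaluated on the triples (X, U, V). The kernel of Q is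
that of q, evaluated on consecutive pairs of triples. At the minimizing parameters both kernels have
mean θ, the difference of the two squared discrepancies (`integral_projKer_cmpKerH`,
`integral_projKer_cmpKerQ`).

Estimating the parameters costs only O_P(1/n). Each minimizer is interior, so the mean gradient of
the kernel vanishes there (`gradient_eq_zero`). In the Taylor expansion of the U-statistic the
linear term is therefore a product of two factors of order n^(-1/2), the parameter error and a
centered U-statistic, and the quadratic term is of order 1/n (`stochBdd_uStat2_sub`). The centered
U-statistic has this order if the gradient is square integrable, whereas the Hessian is only assumed
to have an integrable bound H. Since the kernels are bounded, an interpolation inequality bounds the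
gradient by a multiple of √(1 + H), which is square integrable (`norm_fderiv_le_of_hessian`).

At fixed parameters, the Hájek projection reduces a U-statistic to twice the mean of the first order
projection, again up to O_P(1/n) (`uStat2_expansion`). The variance estimators are, up to O_P(1/n),
multiples of means of squared row averages, minus a multiple of D². The sum of squared deviations of
the row averages from the projection is O_P(1), so the estimators converge to 4 and 8 times the
variances of the two projections. If the projection for h vanishes, then σ̂² is itself O_P(1/n).

For θ = 0 there are two regimes. If the projection for h has positive variance, then D has exact
order n^(-1/2), and since ε → 0 the terms with ε are negligible in numerator and denominator
(`tendsto_statistic_sub_of_pos`). If its variance is zero, as for two correct models, then D =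
O_P(1/n) and σ̂ = O_P(n^(-1/2)). Both are negligible after division by ε because ε√n → ∞, and what
remains is the studentized Q (`tendsto_statistic_sub_of_degenerate`). In both regimes the limit is
that of a standardized sum of i.i.d. variables, so it is standard normal.

The second regime needs Q to be non-degenerate. The design of q ensures this: its terms pair the
observations with draws at other positions, so the projection onto a pair is a sum of five pairwise
independent functions of U₁, V₁, U₂, V₂, X₂. Its variance is the sum of the five variances, and it
vanishes only if all five functions are almost surely constant (`variance_cmpKerQ_pos`).

For θ ≠ 0 the numerator is √n times a quantity with nonzero limit, and the denominator is positive
and bounded with high probability, so the statistic diverges with the sign of θ. Since `mmdSq` is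
nonnegative, the sign of θ is that of the difference of the values of `mmd`. -/

/-- The filter of events that hold with probability tending to one. -/
def whp (μ : Measure Ω) : Filter (ℕ × Ω) where
  sets := {A | Tendsto (fun m => μ {ω | (m, ω) ∉ A}) atTop (𝓝 0)}
  univ_sets := by simp
  sets_of_superset := by
    intro A B hA hAB
    exact tendsto_of_tendsto_of_tendsto_of_le_of_le tendsto_const_nhds hA (fun _ => zero_le)
      (fun m => measure_mono fun ω hω h => hω (hAB h))
  inter_sets := by
    intro A B hA hB
    have h := Tendsto.add hA hB
    rw [add_zero] at h
    refine tendsto_of_tendsto_of_tendsto_of_le_of_le tendsto_const_nhds h (fun _ => zero_le)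
      (fun m => (measure_mono ?_).trans (measure_union_le _ _))
    intro ω hω
    simp only [Set.mem_inter_iff, Set.mem_ofPred_eq, not_and_or] at hω
    exact hω

variable {μ : Measure Ω}

lemma eventually_whp {p : ℕ × Ω → Prop} :
    (∀ᶠ x in whp μ, p x) ↔ Tendsto (fun m => μ {ω | ¬ p (m, ω)}) atTop (𝓝 0) := Iff.rfl

lemma eventually_whp_of_ae {p : ℕ × Ω → Prop} (h : ∀ m, ∀ᵐ ω ∂μ, p (m, ω)) :
    ∀ᶠ x in whp μ, p x := by
  rw [eventually_whp]
  have : (fun m => μ {ω | ¬ p (m, ω)}) = fun _ => 0 := funext fun m => h m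
  rw [this]
  exact tendsto_const_nhds

lemma tendsto_fst_whp : Tendsto Prod.fst (whp μ) atTop := by
  rw [tendsto_atTop]
  intro N
  rw [eventually_whp]
  refine tendsto_const_nhds.congr' ?_
  filter_upwards [eventually_ge_atTop N] with m hm
  simp [hm]

lemma tendsto_whp_zero_iff {Z : ℕ → Ω → ℝ} :
    Tendsto (fun x : ℕ × Ω => Z x.1 x.2) (whp μ) (𝓝 0) ↔
      TendstoInMeasure μ Z atTop (fun _ => 0) := by
  rw [tendstoInMeasure_iff_norm, Metric.tendsto_nhds]
  refine forall₂_congr fun c _ => ?_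
  rw [eventually_whp]
  simp

lemma tendsto_whp_atTop_iff {Z : ℕ → Ω → ℝ} :
    Tendsto (fun x : ℕ × Ω => Z x.1 x.2) (whp μ) atTop ↔ TendstoInProbAtTop μ Z := by
  constructor
  · intro h M
    have := h.eventually_gt_atTop M
    rw [eventually_whp] at this
    simpa using this
  · intro h
    rw [tendsto_atTop]
    intro M
    have : ∀ᶠ x in whp μ, M < Z x.1 x.2 := by
      rw [eventually_whp]
      simpa using h M
    exact this.mono fun x => le_of_lt

lemma tendsto_whp_atBot_iff {Z : ℕ → Ω → ℝ} :
    Tendsto (fun x : ℕ × Ω => Z x.1 x.2) (whp μ) atBot ↔ TendstoInProbAtBot μ Z := by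
  constructor
  · intro h M
    have := h.eventually_lt_atBot M
    rw [eventually_whp] at this
    simpa using this
  · intro h
    rw [tendsto_atBot]
    intro M
    have : ∀ᶠ x in whp μ, Z x.1 x.2 < M := by
      rw [eventually_whp]
      simpa using h M
    exact this.mono fun x => le_of_lt

/-- Stochastic boundedness: products with sequences that tend to zero in probability tend to zero
in probability. -/
def StochBdd (μ : Measure Ω) (Z : ℕ × Ω → ℝ) : Prop :=
  ∀ W : ℕ × Ω → ℝ, Tendsto W (whp μ) (𝓝 0) → Tendsto (fun x => W x * Z x) (whp μ) (𝓝 0)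

/-- On the event ‖Z‖ ≤ M, which has nearly full probability, a factor W tending to zero is
eventually small enough to absorb M. -/
lemma BoundedInProb.stochBdd {E : Type*} [SeminormedAddCommGroup E] {Z : ℕ → Ω → E}
    (h : BoundedInProb μ Z) : StochBdd μ (fun x => ‖Z x.1 x.2‖) := by
  intro W hW
  rw [Metric.tendsto_nhds]
  intro c hc
  rw [eventually_whp, ENNReal.tendsto_nhds_zero]
  intro η hη
  obtain ⟨M, hM⟩ := h (η / 2) (ENNReal.half_pos hη.ne')
  -- The tightness bound M may be negative or zero, so |M| + 1 serves as the positive divisor.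
  have hK : 0 < |M| + 1 := by positivity
  have h1 : ∀ᶠ x in whp μ, |W x| < c / (|M| + 1) := by
    have := (Metric.tendsto_nhds.1 hW) (c / (|M| + 1)) (by positivity)
    simpa [Real.dist_eq] using this
  rw [eventually_whp, ENNReal.tendsto_nhds_zero] at h1
  filter_upwards [hM, h1 (η / 2) (ENNReal.half_pos hη.ne')] with m hm1 hm2
  calc _ ≤ μ ({ω | M < ‖Z m ω‖} ∪ {ω | ¬ |W (m, ω)| < c / (|M| + 1)}) := by
        refine measure_mono fun ω hω => ?_
        by_contra hcon
        simp only [Set.mem_union, Set.mem_ofPred_eq, not_or, not_lt] at hcon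
        apply hω
        rw [Real.dist_eq, sub_zero, abs_mul, abs_norm]
        have h2 : ‖Z m ω‖ ≤ |M| + 1 := by linarith [hcon.1, le_abs_self M]
        have h3 := hcon.2
        rw [not_le, lt_div_iff₀ hK] at h3
        refine lt_of_le_of_lt ?_ h3
        gcongr
    _ ≤ η / 2 + η / 2 := (measure_union_le _ _).trans (add_le_add hm1 hm2)
    _ = η := ENNReal.add_halves η

lemma StochBdd.of_integral_le [IsFiniteMeasure μ] {Z : ℕ → Ω → ℝ} {C : ℝ}
    (h : ∀ᶠ m in atTop, Integrable (Z m) μ ∧ ∫ ω, |Z m ω| ∂μ ≤ C) :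
    StochBdd μ (fun x => Z x.1 x.2) := by
  have hb : BoundedInProb μ Z := by
    intro η hη
    by_cases hT : η = ⊤
    · exact ⟨0, by simp [hT]⟩
    have hη' : 0 < η.toReal := ENNReal.toReal_pos hη.ne' hT
    -- The threshold for Markov's inequality; |C| + 1 instead of C makes it positive.
    set M : ℝ := (|C| + 1) / η.toReal with hMdef
    have hM0 : 0 < M := by positivity
    refine ⟨M, ?_⟩
    filter_upwards [h] with m hm
    have h1 := mul_meas_ge_le_integral_of_nonneg (μ := μ) (f := fun ω => |Z m ω|)
      (ae_of_all _ fun ω => abs_nonneg _) hm.1.abs M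
    have h2 : μ.real {ω | M ≤ |Z m ω|} ≤ η.toReal := by
      have h3 : M * μ.real {ω | M ≤ |Z m ω|} ≤ |C| + 1 := by
        linarith [hm.2, le_abs_self C]
      rw [hMdef, div_mul_eq_mul_div, div_le_iff₀ hη'] at h3
      have : 0 < |C| + 1 := by positivity
      exact le_of_mul_le_mul_left h3 this
    calc μ {ω | M < ‖Z m ω‖} ≤ μ {ω | M ≤ |Z m ω|} :=
          measure_mono fun ω hω => by
            simp only [Set.mem_ofPred_eq, Real.norm_eq_abs] at hω ⊢
            exact hω.le
      _ ≤ η := by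
          rw [← ENNReal.ofReal_toReal hT, ← ENNReal.ofReal_toReal (measure_ne_top μ _)]
          exact ENNReal.ofReal_le_ofReal h2
  intro W hW
  have h1 : Tendsto (fun x => |W x|) (whp μ) (𝓝 0) := by simpa using hW.abs
  have h2 := hb.stochBdd _ h1
  rw [tendsto_zero_iff_abs_tendsto_zero]
  refine h2.congr fun x => ?_
  simp [abs_mul]

namespace StochBdd

variable {Z Z' W : ℕ × Ω → ℝ}

lemma of_tendsto {c : ℝ} (h : Tendsto Z (whp μ) (𝓝 c)) : StochBdd μ Z := fun W hW => by
  simpa using hW.mul h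

lemma mono (h : StochBdd μ Z) (hle : ∀ᶠ x in whp μ, |Z' x| ≤ |Z x|) : StochBdd μ Z' := by
  intro W hW
  refine squeeze_zero_norm' ?_ ((h W hW).norm.trans (by simp))
  filter_upwards [hle] with x hx
  rw [norm_mul, norm_mul]
  gcongr
  exact hx

lemma congr (h : StochBdd μ Z) (he : ∀ᶠ x in whp μ, Z' x = Z x) : StochBdd μ Z' :=
  h.mono (he.mono fun x hx => by rw [hx])

lemma add (h : StochBdd μ Z) (h' : StochBdd μ Z') : StochBdd μ (fun x => Z x + Z' x) := by
  intro W hW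
  simpa [mul_add] using (h W hW).add (h' W hW)

lemma mul (h : StochBdd μ Z) (h' : StochBdd μ Z') : StochBdd μ (fun x => Z x * Z' x) := by
  intro W hW
  simpa [mul_assoc] using h' _ (h W hW)

lemma const (c : ℝ) : StochBdd μ (fun _ => c) := of_tendsto tendsto_const_nhds

lemma const_mul (c : ℝ) (h : StochBdd μ Z) : StochBdd μ (fun x => c * Z x) := (const c).mul h

lemma neg (h : StochBdd μ Z) : StochBdd μ (fun x => - Z x) := by
  simpa using h.const_mul (-1)

lemma sub (h : StochBdd μ Z) (h' : StochBdd μ Z') : StochBdd μ (fun x => Z x - Z' x) := by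
  simpa [sub_eq_add_neg] using h.add h'.neg

lemma abs (h : StochBdd μ Z) : StochBdd μ (fun x => |Z x|) :=
  h.mono (Eventually.of_forall fun x => by simp)

lemma sum {ι : Type*} (s : Finset ι) {Y : ι → ℕ × Ω → ℝ} (h : ∀ l ∈ s, StochBdd μ (Y l)) :
    StochBdd μ (fun x => ∑ l ∈ s, Y l x) := by
  classical
  induction s using Finset.induction_on with
  | empty => simpa using const 0
  | insert a s ha ih =>
    simp only [Finset.sum_insert ha]
    exact (h a (by simp)).add (ih fun l hl => h l (by simp [hl]))

lemma sqrt (h : StochBdd μ Z) : StochBdd μ (fun x => √(Z x)) := by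
  refine ((const 1).add h.abs).mono (Eventually.of_forall fun x => ?_)
  rw [abs_of_nonneg (Real.sqrt_nonneg _), abs_of_nonneg (by positivity)]
  rw [Real.sqrt_le_left (by positivity)]
  nlinarith [abs_nonneg (Z x), le_abs_self (Z x)]

end StochBdd

end HighProbability

/-! ### Second moments of single and double sums over an i.i.d. sample. -/

section Moments

variable {Ω : Type*} [MeasurableSpace Ω] {T : Type*} [MeasurableSpace T]

/-- A sequence of independent random variables with common law `ν`. -/
structure IsIID (μ : Measure Ω) (ν : Measure T) (t : ℕ → Ω → T) : Prop where
  measurable : ∀ i, Measurable (t i)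
  law : ∀ i, μ.map (t i) = ν
  indep : iIndepFun t μ

variable {μ : Measure Ω} [IsProbabilityMeasure μ] {ν : Measure T} {t : ℕ → Ω → T}

lemma IsIID.isProbabilityMeasure (h : IsIID μ ν t) : IsProbabilityMeasure ν := by
  rw [← h.law 0]
  exact Measure.isProbabilityMeasure_map (h.measurable 0).aemeasurable

lemma IsIID.measurePreserving (h : IsIID μ ν t) (i : ℕ) : MeasurePreserving (t i) μ ν :=
  ⟨h.measurable i, h.law i⟩

lemma measurePreserving_prodMk {A B : Type*} [MeasurableSpace A] [MeasurableSpace B]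
    {f : Ω → A} {g : Ω → B} {ν₁ : Measure A} {ν₂ : Measure B} (hf : MeasurePreserving f μ ν₁)
    (hg : MeasurePreserving g μ ν₂) (hfg : IndepFun f g μ) :
    MeasurePreserving (fun ω => (f ω, g ω)) μ (ν₁.prod ν₂) := by
  refine ⟨hf.measurable.prodMk hg.measurable, ?_⟩
  rw [(indepFun_iff_map_prod_eq_prod_map_map hf.measurable.aemeasurable
    hg.measurable.aemeasurable).1 hfg, hf.map_eq, hg.map_eq]

lemma IsIID.measurePreserving_pair (h : IsIID μ ν t) {i j : ℕ} (hij : i ≠ j) :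
    MeasurePreserving (fun ω => (t i ω, t j ω)) μ (ν.prod ν) :=
  measurePreserving_prodMk (h.measurePreserving i) (h.measurePreserving j)
    (h.indep.indepFun hij)

lemma integral_comp_of_measurePreserving {A B : Type*} [MeasurableSpace A] [MeasurableSpace B]
    {ρ : Measure A} {ρ' : Measure B} {φ : A → B}
    (hφ : MeasurePreserving φ ρ ρ') {g : B → ℝ} (hg : Measurable g) :
    ∫ a, g (φ a) ∂ρ = ∫ b, g b ∂ρ' := by
  rw [← hφ.map_eq, integral_map hφ.measurable.aemeasurable hg.aestronglyMeasurable]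

/-- The variable `t j` is independent of the triple `(t i, t k, t l)` if `j ∉ {i, k, l}`. -/
lemma IsIID.indepFun_triple (h : IsIID μ ν t) {i j k l : ℕ} (hi : j ≠ i) (hk : j ≠ k)
    (hl : j ≠ l) : IndepFun (fun ω => (t i ω, t k ω, t l ω)) (t j) μ := by
  classical
  have h1 := h.indep.indepFun_finset {i, k, l} {j} (by simp [hi, hk, hl]) h.measurable
  exact h1.comp (φ := fun v : (({i, k, l} : Finset ℕ) → T) =>
      (v ⟨i, by simp⟩, v ⟨k, by simp⟩, v ⟨l, by simp⟩))
    (ψ := fun v : (({j} : Finset ℕ) → T) => v ⟨j, by simp⟩) (by fun_prop) (by fun_prop)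

/-- The index j occurs once only, so `t j` can be integrated out first with the other variables
fixed, and this integral is zero. The indices i, k, l may coincide among themselves. -/
lemma integral_mul_eq_zero_of_degenerate (h : IsIID μ ν t) {g : T × T → ℝ} {M : ℝ}
    (hg : Measurable g) (hM : ∀ z, |g z| ≤ M) (h0 : ∀ a, ∫ b, g (a, b) ∂ν = 0)
    {i j k l : ℕ} (hi : j ≠ i) (hk : j ≠ k) (hl : j ≠ l) :
    ∫ ω, g (t i ω, t j ω) * g (t k ω, t l ω) ∂μ = 0 := by
  have := h.isProbabilityMeasure
  have hm : Measurable fun ω => (t i ω, t k ω, t l ω) :=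
    (h.measurable i).prodMk ((h.measurable k).prodMk (h.measurable l))
  have hp := measurePreserving_prodMk (hm.measurePreserving μ) (h.measurePreserving j)
    (h.indepFun_triple hi hk hl)
  have hG : Measurable fun z : (T × T × T) × T => g (z.1.1, z.2) * g z.1.2 := by fun_prop
  have hprob : IsProbabilityMeasure (μ.map fun ω => (t i ω, t k ω, t l ω)) :=
    Measure.isProbabilityMeasure_map hm.aemeasurable
  rw [integral_comp_of_measurePreserving hp hG, integral_prod]
  · simp [integral_mul_const, h0]
  · refine Integrable.of_bound hG.aestronglyMeasurable (M * M) (ae_of_all _ fun z => ?_)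
    rw [norm_mul]
    exact mul_le_mul (hM _) (hM _) (norm_nonneg _) ((abs_nonneg _).trans (hM (z.1.1, z.2)))

lemma integral_sq_sum {ι : Type*} (s : Finset ι) {Y : ι → Ω → ℝ} (hY : ∀ p ∈ s, MemLp (Y p) 2 μ) :
    ∫ ω, (∑ p ∈ s, Y p ω) ^ 2 ∂μ = ∑ p ∈ s, ∑ q ∈ s, ∫ ω, Y p ω * Y q ω ∂μ := by
  simp_rw [pow_two, Finset.sum_mul_sum]
  rw [integral_finsetSum]
  · refine Finset.sum_congr rfl fun p hp => ?_
    rw [integral_finsetSum]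
    exact fun q hq => (hY p hp).integrable_mul (hY q hq)
  · exact fun p hp => integrable_finsetSum _ fun q hq => (hY p hp).integrable_mul (hY q hq)

lemma offDiag_eq_filter_product (s : Finset ℕ) :
    s.offDiag = (s ×ˢ s).filter fun p => p.1 ≠ p.2 := by
  ext p
  simp [Finset.mem_offDiag, and_assoc]

lemma uStat2_eq_offDiag (n : ℕ) (η : T → T → ℝ) (t : ℕ → T) :
    uStat2 n η t = 1 / ((n : ℝ) * ((n : ℝ) - 1)) *
      ∑ p ∈ (Finset.range n).offDiag, η (t p.1) (t p.2) := by
  rw [uStat2, offDiag_eq_filter_product, Finset.sum_filter, Finset.sum_product]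

lemma sum_offDiag_eq (n : ℕ) (f : ℕ → ℕ → ℝ) :
    ∑ p ∈ (Finset.range n).offDiag, f p.1 p.2 =
      ∑ i ∈ Finset.range n, ∑ j ∈ (Finset.range n).erase i, f i j := by
  rw [offDiag_eq_filter_product, Finset.sum_filter, Finset.sum_product]
  refine Finset.sum_congr rfl fun i _ => ?_
  rw [← Finset.sum_filter]
  refine Finset.sum_congr ?_ fun _ _ => rfl
  ext j
  simp [eq_comm, and_comm]

lemma memLp_pair (h : IsIID μ ν t) {g : T × T → ℝ} (hg : MemLp g 2 (ν.prod ν)) {i j : ℕ}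
    (hij : i ≠ j) : MemLp (fun ω => g (t i ω, t j ω)) 2 μ :=
  hg.comp_measurePreserving (h.measurePreserving_pair hij)

/-- Second moment of an order two sum with a centered square integrable kernel. -/
lemma integral_sq_sum_offDiag_le (h : IsIID μ ν t) {g : T × T → ℝ} (hgm : Measurable g)
    (hg : MemLp g 2 (ν.prod ν)) (h0 : ∫ z, g z ∂(ν.prod ν) = 0) (n : ℕ) :
    ∫ ω, (∑ p ∈ (Finset.range n).offDiag, g (t p.1 ω, t p.2 ω)) ^ 2 ∂μ ≤
      4 * (n : ℝ) ^ 3 * ∫ z, g z ^ 2 ∂(ν.prod ν) := by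
  set K := ∫ z, g z ^ 2 ∂(ν.prod ν)
  have hK : 0 ≤ K := integral_nonneg fun z => sq_nonneg _
  rw [integral_sq_sum _ fun p hp => memLp_pair h hg (by simpa using (Finset.mem_offDiag.1 hp).2.2)]
  -- Index pairs without a common index give independent centered factors and contribute zero. The
  -- others contribute at most K because 2ab ≤ a² + b². Each of the four possible coincidences
  -- leaves n³ choices, whence 4n³K.
  have hterm : ∀ p ∈ (Finset.range n).offDiag, ∀ q ∈ (Finset.range n).offDiag,
      ∫ ω, g (t p.1 ω, t p.2 ω) * g (t q.1 ω, t q.2 ω) ∂μ ≤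
        K * ((if p.1 = q.1 then 1 else 0) + (if p.1 = q.2 then 1 else 0)
          + (if p.2 = q.1 then 1 else 0) + (if p.2 = q.2 then 1 else 0)) := by
    intro p hp q hq
    have hp' := (Finset.mem_offDiag.1 hp).2.2
    have hq' := (Finset.mem_offDiag.1 hq).2.2
    by_cases hd : p.1 = q.1 ∨ p.1 = q.2 ∨ p.2 = q.1 ∨ p.2 = q.2
    · have h1 : (1 : ℝ) ≤ ((if p.1 = q.1 then 1 else 0) + (if p.1 = q.2 then 1 else 0)
          + (if p.2 = q.1 then 1 else 0) + (if p.2 = q.2 then 1 else 0)) := by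
        rcases hd with hd | hd | hd | hd <;> simp only [hd, if_true] <;> split_ifs <;> norm_num
      have h2 : ∫ ω, g (t p.1 ω, t p.2 ω) * g (t q.1 ω, t q.2 ω) ∂μ ≤
          ∫ ω, (g (t p.1 ω, t p.2 ω) ^ 2 + g (t q.1 ω, t q.2 ω) ^ 2) / 2 ∂μ := by
        refine integral_mono ((memLp_pair h hg hp').integrable_mul (memLp_pair h hg hq'))
          (((memLp_pair h hg hp').integrable_sq.add (memLp_pair h hg hq').integrable_sq).div_const 2)
          fun ω => ?_
        simp only
        nlinarith [sq_nonneg (g (t p.1 ω, t p.2 ω) - g (t q.1 ω, t q.2 ω))]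
      rw [integral_div, integral_add (memLp_pair h hg hp').integrable_sq
        (memLp_pair h hg hq').integrable_sq,
        integral_comp_of_measurePreserving (h.measurePreserving_pair hp') (hgm.pow_const 2),
        integral_comp_of_measurePreserving (h.measurePreserving_pair hq') (hgm.pow_const 2)] at h2
      nlinarith
    · push Not at hd
      have hi := (h.indep.indepFun_prodMk_prodMk h.measurable p.1 p.2 q.1 q.2 hd.1 hd.2.1
        hd.2.2.1 hd.2.2.2).comp hgm hgm
      have := hi.integral_mul_eq_mul_integral (memLp_pair h hg hp').aestronglyMeasurable
        (memLp_pair h hg hq').aestronglyMeasurable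
      simp only [Pi.mul_apply, Function.comp_apply] at this
      erw [this, integral_comp_of_measurePreserving (h.measurePreserving_pair hp') hgm, h0]
      simp [hd]
  calc _ ≤ ∑ p ∈ (Finset.range n).offDiag, ∑ q ∈ (Finset.range n).offDiag,
        K * ((if p.1 = q.1 then 1 else 0) + (if p.1 = q.2 then 1 else 0)
          + (if p.2 = q.1 then 1 else 0) + (if p.2 = q.2 then 1 else 0)) :=
        Finset.sum_le_sum fun p hp => Finset.sum_le_sum fun q hq => hterm p hp q hq
    _ ≤ ∑ p ∈ Finset.range n ×ˢ Finset.range n, ∑ q ∈ Finset.range n ×ˢ Finset.range n,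
        K * ((if p.1 = q.1 then 1 else 0) + (if p.1 = q.2 then 1 else 0)
          + (if p.2 = q.1 then 1 else 0) + (if p.2 = q.2 then 1 else 0)) := by
        have hsub : (Finset.range n).offDiag ⊆ Finset.range n ×ˢ Finset.range n := by
          rw [offDiag_eq_filter_product]; exact Finset.filter_subset _ _
        refine (Finset.sum_le_sum fun p hp => Finset.sum_le_sum_of_subset_of_nonneg hsub
          fun q _ _ => by positivity).trans
          (Finset.sum_le_sum_of_subset_of_nonneg hsub fun p _ _ => Finset.sum_nonneg
            fun q _ => by positivity)
    _ = 4 * (n : ℝ) ^ 3 * K := by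
        have h1 : ∀ x ∈ Finset.range n, ∑ q ∈ Finset.range n ×ˢ Finset.range n,
            (if x = q.1 then (1 : ℝ) else 0) = n := fun x hx => by
          rw [Finset.sum_product_right]
          simp only [Finset.sum_ite_eq, hx, if_true]
          simp
        have h2 : ∀ x ∈ Finset.range n, ∑ q ∈ Finset.range n ×ˢ Finset.range n,
            (if x = q.2 then (1 : ℝ) else 0) = n := fun x hx => by
          rw [Finset.sum_product]
          simp only [Finset.sum_ite_eq, hx, if_true]
          simp
        have h3 : ∀ p ∈ Finset.range n ×ˢ Finset.range n,
            ∑ q ∈ Finset.range n ×ˢ Finset.range n,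
            K * (((if p.1 = q.1 then (1 : ℝ) else 0) + (if p.1 = q.2 then 1 else 0))
          + (if p.2 = q.1 then 1 else 0) + (if p.2 = q.2 then 1 else 0)) = K * (4 * n) := by
          intro p hp
          rw [Finset.mem_product] at hp
          rw [← Finset.mul_sum, Finset.sum_add_distrib, Finset.sum_add_distrib,
            Finset.sum_add_distrib, h1 _ hp.1, h2 _ hp.1, h1 _ hp.2, h2 _ hp.2]
          ring
        rw [Finset.sum_congr rfl h3, Finset.sum_const, Finset.card_product, Finset.card_range,
          nsmul_eq_mul]
        push_cast
        ring

/-- Second moment of an order two sum with a degenerate symmetric kernel. -/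
lemma integral_sq_sum_offDiag_degenerate_le (h : IsIID μ ν t) {g : T × T → ℝ} {M : ℝ}
    (hg : Measurable g) (hM : ∀ z, |g z| ≤ M) (h0 : ∀ a, ∫ b, g (a, b) ∂ν = 0)
    (hs : ∀ a b, g (a, b) = g (b, a)) (n : ℕ) :
    ∫ ω, (∑ p ∈ (Finset.range n).offDiag, g (t p.1 ω, t p.2 ω)) ^ 2 ∂μ ≤
      2 * (n : ℝ) ^ 2 * M ^ 2 := by
  have := h.isProbabilityMeasure
  have hmem : MemLp g 2 (ν.prod ν) :=
    MemLp.of_bound hg.aestronglyMeasurable M (ae_of_all _ hM)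
  rw [integral_sq_sum _ fun p hp => memLp_pair h hmem (Finset.mem_offDiag.1 hp).2.2]
  -- Unless q equals p or its swap, some index of p does not occur in q, and the mixed moment
  -- vanishes by degeneracy. Hence at most two q remain for each p, and the sum is of order n²
  -- instead of n³.
  have hterm : ∀ p ∈ (Finset.range n).offDiag, ∀ q ∈ (Finset.range n).offDiag,
      ∫ ω, g (t p.1 ω, t p.2 ω) * g (t q.1 ω, t q.2 ω) ∂μ ≤
        M ^ 2 * ((if p = q then 1 else 0) + (if p.swap = q then 1 else 0)) := by
    intro p hp q hq
    have hp' := (Finset.mem_offDiag.1 hp).2.2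
    have hq' := (Finset.mem_offDiag.1 hq).2.2
    by_cases hd : p = q ∨ p.swap = q
    · have h1 : (1 : ℝ) ≤ ((if p = q then 1 else 0) + (if p.swap = q then 1 else 0)) := by
        rcases hd with hd | hd <;> simp only [hd, if_true] <;> split_ifs <;> norm_num
      have h2 : ∫ ω, g (t p.1 ω, t p.2 ω) * g (t q.1 ω, t q.2 ω) ∂μ ≤ ∫ ω, M ^ 2 ∂μ := by
        refine integral_mono ((memLp_pair h hmem hp').integrable_mul (memLp_pair h hmem hq'))
          (integrable_const _) fun ω => ?_
        refine (le_abs_self _).trans ?_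
        rw [abs_mul, pow_two]
        exact mul_le_mul (hM _) (hM _) (abs_nonneg _) ((abs_nonneg _).trans (hM (t 0 ω, t 0 ω)))
      simp only [integral_const, probReal_univ, one_smul] at h2
      nlinarith [sq_nonneg M]
    · rw [not_or] at hd
      have hz : ∫ ω, g (t p.1 ω, t p.2 ω) * g (t q.1 ω, t q.2 ω) ∂μ = 0 := by
        by_cases hj : p.2 = q.1 ∨ p.2 = q.2
        · have hi : p.1 ≠ q.1 ∧ p.1 ≠ q.2 := by
            constructor
            · intro h1
              rcases hj with h2 | h2
              · exact hp' (h1.trans h2.symm)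
              · exact hd.1 (Prod.ext h1 h2)
            · intro h1
              rcases hj with h2 | h2
              · exact hd.2 (Prod.ext h2 h1)
              · exact hp' (h1.trans h2.symm)
          -- Here p.1 is the index that occurs once. Symmetry moves it to the second slot, in which
          -- g integrates to zero.
          simp_rw [hs (t p.1 _)]
          exact integral_mul_eq_zero_of_degenerate h hg hM h0 hp' hi.1 hi.2
        · rw [not_or] at hj
          exact integral_mul_eq_zero_of_degenerate h hg hM h0 hp'.symm hj.1 hj.2
      rw [hz]
      positivity
  calc _ ≤ ∑ p ∈ (Finset.range n).offDiag, ∑ q ∈ (Finset.range n).offDiag,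
        M ^ 2 * ((if p = q then 1 else 0) + (if p.swap = q then 1 else 0)) :=
        Finset.sum_le_sum fun p hp => Finset.sum_le_sum fun q hq => hterm p hp q hq
    _ ≤ ∑ p ∈ (Finset.range n).offDiag, M ^ 2 * 2 := by
        refine Finset.sum_le_sum fun p hp => ?_
        rw [← Finset.mul_sum, Finset.sum_add_distrib, Finset.sum_ite_eq, Finset.sum_ite_eq]
        gcongr
        split_ifs <;> norm_num
    _ ≤ 2 * (n : ℝ) ^ 2 * M ^ 2 := by
        rw [Finset.sum_const, Finset.offDiag_card, Finset.card_range, nsmul_eq_mul]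
        have : ((n * n - n : ℕ) : ℝ) ≤ (n : ℝ) ^ 2 := by
          rw [pow_two]; exact_mod_cast Nat.sub_le _ _
        nlinarith [sq_nonneg M]

/-- Second moment of a row sum with a kernel that is conditionally centered. -/
lemma integral_sq_sum_row_le (h : IsIID μ ν t) {g : T × T → ℝ} {M : ℝ}
    (hg : Measurable g) (hM : ∀ z, |g z| ≤ M) (h0 : ∀ a, ∫ b, g (a, b) ∂ν = 0) (n i : ℕ) :
    ∫ ω, (∑ j ∈ (Finset.range n).erase i, g (t i ω, t j ω)) ^ 2 ∂μ ≤ n * M ^ 2 := by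
  have := h.isProbabilityMeasure
  have hmem : MemLp g 2 (ν.prod ν) :=
    MemLp.of_bound hg.aestronglyMeasurable M (ae_of_all _ hM)
  rw [integral_sq_sum _ fun j hj => memLp_pair h hmem (Finset.ne_of_mem_erase hj).symm]
  have hterm : ∀ j ∈ (Finset.range n).erase i, ∀ l ∈ (Finset.range n).erase i,
      ∫ ω, g (t i ω, t j ω) * g (t i ω, t l ω) ∂μ ≤ if j = l then M ^ 2 else 0 := by
    intro j hj l hl
    have hj' := (Finset.ne_of_mem_erase hj).symm
    have hl' := (Finset.ne_of_mem_erase hl).symm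
    split_ifs with hjl
    · have h2 : ∫ ω, g (t i ω, t j ω) * g (t i ω, t l ω) ∂μ ≤ ∫ ω, M ^ 2 ∂μ := by
        refine integral_mono ((memLp_pair h hmem hj').integrable_mul (memLp_pair h hmem hl'))
          (integrable_const _) fun ω => ?_
        refine (le_abs_self _).trans ?_
        rw [abs_mul, pow_two]
        exact mul_le_mul (hM _) (hM _) (abs_nonneg _) ((abs_nonneg _).trans (hM (t 0 ω, t 0 ω)))
      simpa using h2
    · exact (integral_mul_eq_zero_of_degenerate h hg hM h0 hj'.symm hj'.symm hjl).le
  calc _ ≤ ∑ j ∈ (Finset.range n).erase i, ∑ l ∈ (Finset.range n).erase i,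
        if j = l then M ^ 2 else 0 :=
        Finset.sum_le_sum fun p hp => Finset.sum_le_sum fun q hq => hterm p hp q hq
    _ ≤ ∑ j ∈ (Finset.range n).erase i, M ^ 2 := by
        refine Finset.sum_le_sum fun p hp => ?_
        rw [Finset.sum_ite_eq]
        split_ifs; simp
    _ ≤ n * M ^ 2 := by
        rw [Finset.sum_const, nsmul_eq_mul]
        gcongr
        exact (Finset.card_erase_le).trans (by simp)

/-- Second moment of a sum of centered bounded independent variables. -/
lemma integral_sq_sum_range_le (h : IsIID μ ν t) {f : T → ℝ} {M : ℝ}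
    (hf : Measurable f) (hM : ∀ z, |f z| ≤ M) (h0 : ∫ b, f b ∂ν = 0) (n : ℕ) :
    ∫ ω, (∑ j ∈ Finset.range n, f (t j ω)) ^ 2 ∂μ ≤ n * M ^ 2 := by
  -- The row bound for a kernel that ignores its first argument, in row n: since n lies outside
  -- `range n`, no summand is erased.
  have hfree := integral_sq_sum_row_le h (g := fun z => f z.2) (hf.comp measurable_snd)
    (fun z => hM z.2) (fun _ => h0) n n
  rwa [Finset.erase_eq_of_notMem (by simp)] at hfree

end Moments

/-! ### Stochastic order of U-statistics, Hájek projection and row averages. -/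

section UStatBounds

variable {Ω : Type*} [MeasurableSpace Ω] {T : Type*} [MeasurableSpace T]
  {μ : Measure Ω} [IsProbabilityMeasure μ] {ν : Measure T} {t : ℕ → Ω → T}

/-- The inequality |z| ≤ 1 + z² reduces this to a bound for first moments. -/
lemma StochBdd.of_integral_sq_le {Z : ℕ → Ω → ℝ} {C : ℝ}
    (h : ∀ᶠ m in atTop, MemLp (Z m) 2 μ ∧ ∫ ω, Z m ω ^ 2 ∂μ ≤ C) :
    StochBdd μ (fun x => Z x.1 x.2) := by
  refine StochBdd.of_integral_le (C := 1 + C) ?_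
  filter_upwards [h] with m hm
  have hi : Integrable (Z m) μ := hm.1.integrable (by norm_num)
  refine ⟨hi, ?_⟩
  calc ∫ ω, |Z m ω| ∂μ ≤ ∫ ω, (1 + Z m ω ^ 2) ∂μ := by
        refine integral_mono hi.abs ((integrable_const _).add hm.1.integrable_sq) fun ω => ?_
        simp only
        nlinarith [sq_abs (Z m ω), sq_nonneg (|Z m ω| - 1), abs_nonneg (Z m ω)]
    _ ≤ 1 + C := by
        rw [integral_add (integrable_const _) hm.1.integrable_sq]
        simpa using hm.2

lemma uStat2_coeff_nonneg (n : ℕ) : (0 : ℝ) ≤ 1 / ((n : ℝ) * ((n : ℝ) - 1)) := by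
  -- For n = 0 and n = 1 the denominator is zero, and the coefficient is 0 by the convention for
  -- division.
  rcases n with _ | n
  · simp
  · push_cast
    have : (0 : ℝ) ≤ n := n.cast_nonneg
    simp only [add_sub_cancel_right]
    positivity

lemma abs_uStat2_le {η η' : T → T → ℝ} {n : ℕ} {s : ℕ → T}
    (h : ∀ i j, i ≠ j → |η (s i) (s j)| ≤ η' (s i) (s j)) :
    |uStat2 n η s| ≤ uStat2 n η' s := by
  rw [uStat2_eq_offDiag, uStat2_eq_offDiag, abs_mul, abs_of_nonneg (uStat2_coeff_nonneg n)]
  refine mul_le_mul_of_nonneg_left ?_ (uStat2_coeff_nonneg n)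
  exact (Finset.abs_sum_le_sum_abs _ _).trans
    (Finset.sum_le_sum fun p hp => h _ _ (Finset.mem_offDiag.1 hp).2.2)

lemma uStat2_sub (n : ℕ) (η η' : T → T → ℝ) (s : ℕ → T) :
    uStat2 n (fun a b => η a b - η' a b) s = uStat2 n η s - uStat2 n η' s := by
  simp only [uStat2_eq_offDiag, Finset.sum_sub_distrib, mul_sub]

lemma uStat2_sum {ι : Type*} [Fintype ι] (n : ℕ) (c : ι → ℝ) (η : ι → T → T → ℝ) (s : ℕ → T) :
    uStat2 n (fun a b => ∑ l, c l * η l a b) s = ∑ l, c l * uStat2 n (η l) s := by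
  simp only [uStat2_eq_offDiag]
  rw [Finset.sum_comm, Finset.mul_sum]
  refine Finset.sum_congr rfl fun l _ => ?_
  rw [← Finset.mul_sum]
  ring

lemma sum_offDiag_const (n : ℕ) (c : ℝ) :
    ∑ _p ∈ (Finset.range n).offDiag, c = n * ((n : ℝ) - 1) * c := by
  rw [Finset.sum_const, Finset.offDiag_card, Finset.card_range, nsmul_eq_mul,
    Nat.cast_sub (Nat.le_mul_self n)]
  push_cast
  ring

variable {N : ℕ → ℕ}

lemma eventually_le_of_tendsto (hN : Tendsto N atTop atTop) (K : ℕ) :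
    ∀ᶠ x in whp μ, K ≤ N x.1 :=
  (hN.comp tendsto_fst_whp).eventually_ge_atTop K

lemma tendsto_inv_natCast (hN : Tendsto N atTop atTop) :
    Tendsto (fun x : ℕ × Ω => ((N x.1 : ℕ) : ℝ)⁻¹) (whp μ) (𝓝 0) :=
  tendsto_inv_atTop_zero.comp (tendsto_natCast_atTop_atTop.comp (hN.comp tendsto_fst_whp))

lemma tendsto_inv_sqrt_natCast (hN : Tendsto N atTop atTop) :
    Tendsto (fun x : ℕ × Ω => (√((N x.1 : ℕ) : ℝ))⁻¹) (whp μ) (𝓝 0) :=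
  tendsto_inv_atTop_zero.comp (Real.tendsto_sqrt_atTop.comp
    (tendsto_natCast_atTop_atTop.comp (hN.comp tendsto_fst_whp)))

/-- The expectation of a U-statistic is that of its kernel, so integrability of H is enough. This
controls the Hessian remainder, for which no higher moment is available. -/
lemma stochBdd_uStat2_abs (h : IsIID μ ν t) (hN : Tendsto N atTop atTop) {H : T × T → ℝ}
    (hHm : Measurable H) (hH : Integrable H (ν.prod ν)) :
    StochBdd μ (fun x => uStat2 (N x.1) (fun a b => |H (a, b)|) (fun i => t i x.2)) := by
  refine StochBdd.of_integral_le (Z := fun m ω =>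
    uStat2 (N m) (fun a b => |H (a, b)|) (fun i => t i ω)) (C := ∫ z, |H z| ∂(ν.prod ν)) ?_
  filter_upwards [hN.eventually_ge_atTop 2] with m hm
  have hi : ∀ p ∈ (Finset.range (N m)).offDiag,
      Integrable (fun ω => |H (t p.1 ω, t p.2 ω)|) μ := fun p hp =>
    ((h.measurePreserving_pair (Finset.mem_offDiag.1 hp).2.2).integrable_comp
      hH.abs.aestronglyMeasurable).2 hH.abs
  have hpos : ∀ ω, 0 ≤ uStat2 (N m) (fun a b => |H (a, b)|) (fun i => t i ω) := fun ω =>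
    (abs_nonneg _).trans (abs_uStat2_le (η := fun a b => |H (a, b)|) fun i j _ => by simp)
  simp_rw [fun ω => abs_of_nonneg (hpos ω), uStat2_eq_offDiag]
  refine ⟨(integrable_finsetSum _ hi).const_mul _, ?_⟩
  rw [integral_const_mul, integral_finsetSum _ hi, Finset.sum_congr rfl fun p hp =>
    integral_comp_of_measurePreserving (h.measurePreserving_pair (Finset.mem_offDiag.1 hp).2.2)
      hHm.abs, sum_offDiag_const]
  have : (2 : ℝ) ≤ N m := by exact_mod_cast hm
  have h1 : (0 : ℝ) < (N m : ℝ) * ((N m : ℝ) - 1) := mul_pos (by linarith) (by linarith)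
  rw [one_div, inv_mul_cancel_left₀ h1.ne']

/-- The kernel need not be symmetric, bounded or degenerate. This is the form needed for the
gradient term of the parameter expansion. -/
lemma stochBdd_sqrt_mul_uStat2 (h : IsIID μ ν t) (hN : Tendsto N atTop atTop) {g : T × T → ℝ}
    (hgm : Measurable g) (hg : MemLp g 2 (ν.prod ν)) (h0 : ∫ z, g z ∂(ν.prod ν) = 0) :
    StochBdd μ (fun x => √((N x.1 : ℕ) : ℝ) *
      uStat2 (N x.1) (fun a b => g (a, b)) (fun i => t i x.2)) := by
  -- The constant is 16 = 4 · 2²: the double sum has second moment at most 4n³ times that of the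
  -- kernel, and n / (n - 1) ≤ 2 for n ≥ 2.
  refine StochBdd.of_integral_sq_le (Z := fun m ω => √((N m : ℕ) : ℝ) *
    uStat2 (N m) (fun a b => g (a, b)) (fun i => t i ω)) (C := 16 * ∫ z, g z ^ 2 ∂(ν.prod ν)) ?_
  filter_upwards [hN.eventually_ge_atTop 2] with m hm
  have hi : ∀ p ∈ (Finset.range (N m)).offDiag,
      MemLp (fun ω => g (t p.1 ω, t p.2 ω)) 2 μ := fun p hp =>
    memLp_pair h hg (Finset.mem_offDiag.1 hp).2.2
  simp_rw [uStat2_eq_offDiag]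
  refine ⟨((memLp_finsetSum _ hi).const_mul _).const_mul _, ?_⟩
  simp_rw [mul_pow]
  rw [integral_const_mul, integral_const_mul, Real.sq_sqrt (Nat.cast_nonneg _)]
  have h2 : (2 : ℝ) ≤ N m := by exact_mod_cast hm
  have hle := integral_sq_sum_offDiag_le h hgm hg h0 (N m)
  set n : ℝ := (N m : ℝ)
  have hK : 0 ≤ ∫ z, g z ^ 2 ∂(ν.prod ν) := integral_nonneg fun z => sq_nonneg _
  have h1 : (0 : ℝ) < n * (n - 1) := mul_pos (by linarith) (by linarith)
  rw [div_pow, one_pow]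
  calc _ ≤ n * (1 / (n * (n - 1)) ^ 2 * (4 * n ^ 3 * ∫ z, g z ^ 2 ∂(ν.prod ν))) := by gcongr
    _ = 4 * (n / (n - 1)) ^ 2 * ∫ z, g z ^ 2 ∂(ν.prod ν) := by
        have : n - 1 ≠ 0 := by linarith
        have : n ≠ 0 := by linarith
        field_simp
    _ ≤ 4 * 2 ^ 2 * ∫ z, g z ^ 2 ∂(ν.prod ν) := by
        have : 0 ≤ n / (n - 1) := div_nonneg (by linarith) (by linarith)
        have : n / (n - 1) ≤ 2 := by rw [div_le_iff₀ (by linarith)]; linarith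
        gcongr
    _ = _ := by ring

/-- The row averages of a kernel. -/
def rowMean (n : ℕ) (η : T → T → ℝ) (s : ℕ → T) (i : ℕ) : ℝ :=
  ((n : ℝ) - 1)⁻¹ * ∑ j ∈ (Finset.range n).erase i, η (s i) (s j)

/-- First order projection of a kernel. -/
def projKer (ν : Measure T) (η : T → T → ℝ) (a : T) : ℝ := ∫ b, η a b ∂ν

lemma abs_integral_le_of_abs_le {A : Type*} [MeasurableSpace A] {ρ : Measure A}
    [IsProbabilityMeasure ρ] {f : A → ℝ} {M : ℝ} (hM : ∀ a, |f a| ≤ M) : |∫ a, f a ∂ρ| ≤ M := by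
  have := norm_integral_le_of_norm_le_const (μ := ρ) (f := f) (C := M) (ae_of_all _ hM)
  simpa using this

section Bounded

variable {η : T → T → ℝ} {M : ℝ}

lemma measurable_projKer [SFinite ν] (hη : Measurable fun z : T × T => η z.1 z.2) :
    Measurable (projKer ν η) :=
  (hη.stronglyMeasurable.integral_prod_right (ν := ν)).measurable

lemma abs_projKer_le [IsProbabilityMeasure ν] (hM : ∀ a b, |η a b| ≤ M) (a : T) :
    |projKer ν η a| ≤ M := abs_integral_le_of_abs_le (hM a)

lemma integrable_of_abs_le {A : Type*} [MeasurableSpace A] {ρ : Measure A} [IsFiniteMeasure ρ]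
    {f : A → ℝ} (hf : Measurable f) (hM : ∀ a, |f a| ≤ M) : Integrable f ρ :=
  Integrable.of_bound hf.aestronglyMeasurable M (ae_of_all _ hM)

lemma stochBdd_sqrt_mul_mean (h : IsIID μ ν t) (hN : Tendsto N atTop atTop) {f : T → ℝ}
    (hf : Measurable f) (hM : ∀ z, |f z| ≤ M) (h0 : ∫ b, f b ∂ν = 0) :
    StochBdd μ (fun x => (√((N x.1 : ℕ) : ℝ))⁻¹ * ∑ i ∈ Finset.range (N x.1), f (t i x.2)) := by
  refine StochBdd.of_integral_sq_le (Z := fun m ω =>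
    (√((N m : ℕ) : ℝ))⁻¹ * ∑ i ∈ Finset.range (N m), f (t i ω)) (C := M ^ 2) ?_
  filter_upwards [hN.eventually_ge_atTop 1] with m hm
  have hi : ∀ i ∈ Finset.range (N m), MemLp (fun ω => f (t i ω)) 2 μ := fun i _ =>
    MemLp.of_bound (hf.comp (h.measurable i)).aestronglyMeasurable M
      (ae_of_all _ fun ω => hM (t i ω))
  refine ⟨(memLp_finsetSum _ hi).const_mul _, ?_⟩
  simp_rw [mul_pow]
  rw [integral_const_mul, inv_pow, Real.sq_sqrt (Nat.cast_nonneg _)]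
  have hm' : (0 : ℝ) < N m := by exact_mod_cast hm
  rw [inv_mul_le_iff₀ hm']
  exact integral_sq_sum_range_le h hf hM h0 _

/-- A weak law of large numbers: the mean of the centered variables is n^(-1/2) times a
stochastically bounded term. -/
lemma tendsto_mean (h : IsIID μ ν t) (hN : Tendsto N atTop atTop) {f : T → ℝ}
    (hf : Measurable f) (hM : ∀ z, |f z| ≤ M) :
    Tendsto (fun x => ((N x.1 : ℕ) : ℝ)⁻¹ * ∑ i ∈ Finset.range (N x.1), f (t i x.2)) (whp μ)
      (𝓝 (∫ b, f b ∂ν)) := by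
  have := h.isProbabilityMeasure
  have hb : |∫ b, f b ∂ν| ≤ M := abs_integral_le_of_abs_le hM
  have h1 := stochBdd_sqrt_mul_mean h hN (f := fun a => f a - ∫ b, f b ∂ν)
    (M := M + M) (hf.sub_const _) (fun z => (abs_sub _ _).trans (add_le_add (hM z) hb))
    (by rw [integral_sub (integrable_of_abs_le hf hM) (integrable_const _)]; simp)
  have h2 := (h1 _ (tendsto_inv_sqrt_natCast hN)).add_const (∫ b, f b ∂ν)
  rw [zero_add] at h2
  refine h2.congr' ?_
  filter_upwards [eventually_le_of_tendsto hN 1] with x hx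
  have hx' : (0 : ℝ) < N x.1 := by exact_mod_cast hx
  rw [← mul_assoc, ← mul_inv, Real.mul_self_sqrt hx'.le, Finset.sum_sub_distrib]
  simp only [Finset.sum_const, Finset.card_range, nsmul_eq_mul]
  field_simp
  ring

/-- The Hájek projection of a U-statistic of order two. -/
lemma stochBdd_uStat2_sub_projection (h : IsIID μ ν t) (hN : Tendsto N atTop atTop)
    (hη : Measurable fun z : T × T => η z.1 z.2) (hM : ∀ a b, |η a b| ≤ M)
    (hs : ∀ a b, η a b = η b a) :
    StochBdd μ (fun x => N x.1 * (uStat2 (N x.1) η (fun i => t i x.2)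
      - ∫ a, projKer ν η a ∂ν - 2 * ((N x.1 : ℝ)⁻¹ * ∑ i ∈ Finset.range (N x.1),
        (projKer ν η (t i x.2) - ∫ a, projKer ν η a ∂ν)))) := by
  have := h.isProbabilityMeasure
  set θ := ∫ a, projKer ν η a ∂ν with hθ
  have hp := measurable_projKer (ν := ν) hη
  have hpM := abs_projKer_le (ν := ν) hM
  have hθM : |θ| ≤ M := abs_integral_le_of_abs_le hpM
  -- The second order component of the Hoeffding decomposition. It integrates to zero in each
  -- variable, so its double sum has second moment of order n², which gives the rate 1/n.
  set g : T × T → ℝ := fun z => η z.1 z.2 - projKer ν η z.1 - projKer ν η z.2 + θ with hg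
  have hgm : Measurable g :=
    ((hη.sub (hp.comp measurable_fst)).sub (hp.comp measurable_snd)).add_const _
  have hgM : ∀ z, |g z| ≤ 4 * M := fun z => by
    have h1 := abs_le.1 (hM z.1 z.2)
    have h2 := abs_le.1 (hpM z.1)
    have h3 := abs_le.1 (hpM z.2)
    have h4 := abs_le.1 hθM
    rw [abs_le]
    constructor <;> simp only [hg] <;> linarith
  have hg0 : ∀ a, ∫ b, g (a, b) ∂ν = 0 := fun a => by
    have hi1 : Integrable (fun b => η a b) ν :=
      integrable_of_abs_le (hη.comp measurable_prodMk_left) (hM a)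
    have hi2 : Integrable (projKer ν η) ν := integrable_of_abs_le hp hpM
    have hi3 : Integrable (fun b => η a b - projKer ν η a) ν := hi1.sub (integrable_const _)
    have hi4 : Integrable (fun b => η a b - projKer ν η a - projKer ν η b) ν := hi3.sub hi2
    simp only [hg]
    rw [integral_add hi4 (integrable_const _), integral_sub hi3 hi2,
      integral_sub hi1 (integrable_const _), ← hθ]
    simp [projKer]
  have hgs : ∀ a b, g (a, b) = g (b, a) := fun a b => by
    simp only [hg, hs a b]
    ring
  have key : StochBdd μ (fun x => N x.1 *
      uStat2 (N x.1) (fun a b => g (a, b)) (fun i => t i x.2)) := by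
    refine StochBdd.of_integral_sq_le (Z := fun m ω => (N m : ℝ) *
      uStat2 (N m) (fun a b => g (a, b)) (fun i => t i ω)) (C := 8 * (4 * M) ^ 2) ?_
    filter_upwards [hN.eventually_ge_atTop 2] with m hm
    have hi : ∀ p ∈ (Finset.range (N m)).offDiag,
        MemLp (fun ω => g (t p.1 ω, t p.2 ω)) 2 μ := fun p hp =>
      memLp_pair h (MemLp.of_bound hgm.aestronglyMeasurable _ (ae_of_all _ hgM))
        (Finset.mem_offDiag.1 hp).2.2
    simp_rw [uStat2_eq_offDiag]
    refine ⟨((memLp_finsetSum _ hi).const_mul _).const_mul _, ?_⟩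
    simp_rw [mul_pow]
    rw [integral_const_mul, integral_const_mul]
    have h2 : (2 : ℝ) ≤ N m := by exact_mod_cast hm
    have hle := integral_sq_sum_offDiag_degenerate_le h hgm hgM hg0 hgs (N m)
    set n : ℝ := (N m : ℝ)
    rw [div_pow, one_pow, ← mul_pow 4 M]
    calc _ ≤ n ^ 2 * (1 / (n * (n - 1)) ^ 2 * (2 * n ^ 2 * (4 * M) ^ 2)) := by gcongr
      _ = 2 * (n / (n - 1)) ^ 2 * (4 * M) ^ 2 := by
          have : n - 1 ≠ 0 := by linarith
          have : n ≠ 0 := by linarith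
          field_simp
      _ ≤ 2 * 2 ^ 2 * (4 * M) ^ 2 := by
          have : 0 ≤ n / (n - 1) := div_nonneg (by linarith) (by linarith)
          have : n / (n - 1) ≤ 2 := by rw [div_le_iff₀ (by linarith)]; linarith
          gcongr
      _ = _ := by ring
  -- It remains to identify the U-statistic of g with the remainder in the statement. In the sum
  -- over ordered pairs each index occurs n - 1 times in the first place and, by swapping, n - 1
  -- times in the second.
  refine key.congr ?_
  filter_upwards [eventually_le_of_tendsto hN 2] with x hx
  have h2 : (2 : ℝ) ≤ N x.1 := by exact_mod_cast hx
  congr 1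
  rw [uStat2_eq_offDiag, uStat2_eq_offDiag]
  simp only [hg, Finset.sum_add_distrib, Finset.sum_sub_distrib]
  rw [sum_offDiag_const, sum_offDiag_eq _ fun i _ => projKer ν η (t i x.2)]
  have hswap : ∑ p ∈ (Finset.range (N x.1)).offDiag, projKer ν η (t p.2 x.2) =
      ∑ p ∈ (Finset.range (N x.1)).offDiag, projKer ν η (t p.1 x.2) := by
    refine Finset.sum_nbij' Prod.swap Prod.swap ?_ ?_ ?_ ?_ ?_ <;>
      simp +contextual [Finset.mem_offDiag, eq_comm]
  have hrow : ∑ i ∈ Finset.range (N x.1), ∑ _j ∈ (Finset.range (N x.1)).erase i,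
      projKer ν η (t i x.2) = ((N x.1 : ℝ) - 1) * ∑ i ∈ Finset.range (N x.1),
        projKer ν η (t i x.2) := by
    rw [Finset.mul_sum]
    refine Finset.sum_congr rfl fun i hi => ?_
    rw [Finset.sum_const, Finset.card_erase_of_mem hi, Finset.card_range, nsmul_eq_mul,
      Nat.cast_sub (by omega), Nat.cast_one]
  rw [hswap, sum_offDiag_eq _ fun i _ => projKer ν η (t i x.2), hrow]
  simp only [Finset.sum_const, Finset.card_range, nsmul_eq_mul]
  have : (N x.1 : ℝ) - 1 ≠ 0 := by linarith
  have : (N x.1 : ℝ) ≠ 0 := by linarith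
  field_simp
  ring

/-- The row averages approximate the projection, in mean square. -/
lemma stochBdd_sum_sq_rowMean_sub (h : IsIID μ ν t) (hN : Tendsto N atTop atTop)
    (hη : Measurable fun z : T × T => η z.1 z.2) (hM : ∀ a b, |η a b| ≤ M) :
    StochBdd μ (fun x => ∑ i ∈ Finset.range (N x.1),
      (rowMean (N x.1) η (fun i => t i x.2) i - projKer ν η (t i x.2)) ^ 2) := by
  have := h.isProbabilityMeasure
  have hp := measurable_projKer (ν := ν) hη
  have hpM := abs_projKer_le (ν := ν) hM
  -- Given the first argument, g is centered. Each row sum thus has second moment at most n(2M)²;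
  -- dividing by (n - 1)² and adding n rows gives at most 4(2M)², since n / (n - 1) ≤ 2.
  set g : T × T → ℝ := fun z => η z.1 z.2 - projKer ν η z.1 with hg
  have hgm : Measurable g := hη.sub (hp.comp measurable_fst)
  have hgM : ∀ z, |g z| ≤ 2 * M := fun z => by
    rw [two_mul]
    exact (abs_sub _ _).trans (add_le_add (hM _ _) (hpM _))
  have hg0 : ∀ a, ∫ b, g (a, b) ∂ν = 0 := fun a => by
    have hi1 : Integrable (fun b => η a b) ν :=
      integrable_of_abs_le (hη.comp measurable_prodMk_left) (hM a)
    simp only [hg]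
    rw [integral_sub hi1 (integrable_const _)]
    simp [projKer]
  have key : StochBdd μ (fun x => ∑ i ∈ Finset.range (N x.1), (((N x.1 : ℝ) - 1)⁻¹ *
      ∑ j ∈ (Finset.range (N x.1)).erase i, g (t i x.2, t j x.2)) ^ 2) := by
    refine StochBdd.of_integral_le (Z := fun m ω => ∑ i ∈ Finset.range (N m), (((N m : ℝ) - 1)⁻¹ *
      ∑ j ∈ (Finset.range (N m)).erase i, g (t i ω, t j ω)) ^ 2) (C := 4 * (2 * M) ^ 2) ?_
    filter_upwards [hN.eventually_ge_atTop 2] with m hm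
    have hi : ∀ i ∈ Finset.range (N m), Integrable (fun ω => (((N m : ℝ) - 1)⁻¹ *
        ∑ j ∈ (Finset.range (N m)).erase i, g (t i ω, t j ω)) ^ 2) μ := fun i _ =>
      ((memLp_finsetSum _ fun j hj => memLp_pair h (MemLp.of_bound hgm.aestronglyMeasurable _
        (ae_of_all _ hgM)) (Finset.ne_of_mem_erase hj).symm).const_mul _).integrable_sq
    refine ⟨integrable_finsetSum _ hi, ?_⟩
    simp_rw [fun ω => abs_of_nonneg (Finset.sum_nonneg fun i (_ : i ∈ Finset.range (N m)) =>
      sq_nonneg (((N m : ℝ) - 1)⁻¹ * ∑ j ∈ (Finset.range (N m)).erase i, g (t i ω, t j ω)))]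
    rw [integral_finsetSum _ hi]
    have h2 : (2 : ℝ) ≤ N m := by exact_mod_cast hm
    calc _ ≤ ∑ i ∈ Finset.range (N m), (((N m : ℝ) - 1)⁻¹) ^ 2 * (N m * (2 * M) ^ 2) := by
          refine Finset.sum_le_sum fun i _ => ?_
          simp_rw [mul_pow _ (Finset.sum _ _)]
          rw [integral_const_mul]
          gcongr
          exact integral_sq_sum_row_le h hgm hgM hg0 _ _
      _ = (N m / ((N m : ℝ) - 1)) ^ 2 * (2 * M) ^ 2 := by
          rw [Finset.sum_const, Finset.card_range, nsmul_eq_mul]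
          have : (N m : ℝ) - 1 ≠ 0 := by linarith
          field_simp
      _ ≤ 2 ^ 2 * (2 * M) ^ 2 := by
          have : 0 ≤ N m / ((N m : ℝ) - 1) := div_nonneg (by linarith) (by linarith)
          have : N m / ((N m : ℝ) - 1) ≤ 2 := by rw [div_le_iff₀ (by linarith)]; linarith
          gcongr
      _ = _ := by ring
  refine key.congr ?_
  filter_upwards [eventually_le_of_tendsto hN 2] with x hx
  have h2 : (2 : ℝ) ≤ N x.1 := by exact_mod_cast hx
  refine Finset.sum_congr rfl fun i hi => ?_
  congr 1
  rw [rowMean]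
  simp only [hg, Finset.sum_sub_distrib]
  rw [Finset.sum_const, Finset.card_erase_of_mem hi, Finset.card_range, nsmul_eq_mul,
      Nat.cast_sub (by omega), Nat.cast_one]
  have : (N x.1 : ℝ) - 1 ≠ 0 := by linarith
  field_simp

end Bounded

end UStatBounds

/-! ### Effect of an estimated parameter; reduction of order three U-statistics to row averages. -/

section Expansion

variable {Ω : Type*} [MeasurableSpace Ω] {T : Type*} [MeasurableSpace T]
  {μ : Measure Ω} [IsProbabilityMeasure μ] {ν : Measure T} {t : ℕ → Ω → T} {N : ℕ → ℕ}

/-- Stochastic expansion of a parametrized kernel `κ` around `γs`: a Lipschitz bound with square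
integrable constant and a second order expansion with centered linear part, where `ρ` measures the
distance to `γs`. -/
def KernelExpansion {Γ : Type*} (ν : Measure T) (κ : Γ → T → T → ℝ) (γs : Γ) (B : Set Γ)
    (ρ : Γ → ℝ) : Prop :=
  ∃ (ι : Type) (_ : Fintype ι) (d : ι → Γ → ℝ) (g : ι → T × T → ℝ) (L H : T × T → ℝ),
    (∀ l γ, |d l γ| ≤ ρ γ) ∧ (∀ l, Measurable (g l)) ∧ (∀ l, MemLp (g l) 2 (ν.prod ν)) ∧
    (∀ l, ∫ z, g l z ∂(ν.prod ν) = 0) ∧ Measurable L ∧ MemLp L 2 (ν.prod ν) ∧ Measurable H ∧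
    Integrable H (ν.prod ν) ∧ ∀ᵐ z ∂(ν.prod ν), ∀ γ ∈ B,
      |κ γ z.1 z.2 - κ γs z.1 z.2| ≤ ρ γ * L z ∧
      |κ γ z.1 z.2 - κ γs z.1 z.2 - ∑ l, d l γ * g l z| ≤ ρ γ ^ 2 * H z

/-- Two kernels, each with a parameter of its own, on a common space: the expansion of the
difference. -/
lemma KernelExpansion.sub {Γ₁ Γ₂ : Type*} {κ₁ : Γ₁ → T → T → ℝ} {κ₂ : Γ₂ → T → T → ℝ}
    {γ₁ : Γ₁} {γ₂ : Γ₂} {B₁ : Set Γ₁} {B₂ : Set Γ₂} {ρ₁ : Γ₁ → ℝ} {ρ₂ : Γ₂ → ℝ}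
    (hρ₁ : ∀ γ, 0 ≤ ρ₁ γ) (hρ₂ : ∀ γ, 0 ≤ ρ₂ γ)
    (h₁ : KernelExpansion ν κ₁ γ₁ B₁ ρ₁) (h₂ : KernelExpansion ν κ₂ γ₂ B₂ ρ₂) :
    KernelExpansion ν (fun (γ : Γ₁ × Γ₂) a b => κ₁ γ.1 a b - κ₂ γ.2 a b) (γ₁, γ₂) (B₁ ×ˢ B₂)
      (fun γ => ρ₁ γ.1 + ρ₂ γ.2) := by
  obtain ⟨ι₁, _, d₁, g₁, L₁, H₁, hd₁, hgm₁, hg₁, hg0₁, hLm₁, hL₁, hHm₁, hH₁, hae₁⟩ := h₁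
  obtain ⟨ι₂, _, d₂, g₂, L₂, H₂, hd₂, hgm₂, hg₂, hg0₂, hLm₂, hL₂, hHm₂, hH₂, hae₂⟩ := h₂
  -- The linear parts of the two expansions are placed side by side. The envelopes are replaced by
  -- their absolute values because the mixed products of a distance and an envelope must be
  -- nonnegative.
  refine ⟨ι₁ ⊕ ι₂, inferInstance, Sum.elim (fun l γ => d₁ l γ.1) (fun l γ => d₂ l γ.2),
    Sum.elim g₁ (fun l z => - g₂ l z), fun z => |L₁ z| + |L₂ z|, fun z => |H₁ z| + |H₂ z|,
    ?_, ?_, ?_, ?_, hLm₁.abs.add hLm₂.abs, hL₁.abs.add hL₂.abs, hHm₁.abs.add hHm₂.abs,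
    hH₁.abs.add hH₂.abs, ?_⟩
  · rintro (l | l) γ
    · exact (hd₁ l γ.1).trans (le_add_of_nonneg_right (hρ₂ _))
    · exact (hd₂ l γ.2).trans (le_add_of_nonneg_left (hρ₁ _))
  · rintro (l | l)
    · exact hgm₁ l
    · exact (hgm₂ l).neg
  · rintro (l | l)
    · exact hg₁ l
    · exact (hg₂ l).neg
  · rintro (l | l)
    · exact hg0₁ l
    · simp [integral_neg, hg0₂ l]
  · filter_upwards [hae₁, hae₂] with z hz₁ hz₂ γ hγ
    obtain ⟨a1, a2⟩ := hz₁ γ.1 hγ.1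
    obtain ⟨b1, b2⟩ := hz₂ γ.2 hγ.2
    have r1 := hρ₁ γ.1
    have r2 := hρ₂ γ.2
    have l1 := le_abs_self (L₁ z)
    have l2 := le_abs_self (L₂ z)
    have l3 := le_abs_self (H₁ z)
    have l4 := le_abs_self (H₂ z)
    have p1 := abs_nonneg (L₁ z)
    have p2 := abs_nonneg (L₂ z)
    have p3 := abs_nonneg (H₁ z)
    have p4 := abs_nonneg (H₂ z)
    have c1 : ρ₁ γ.1 * L₁ z ≤ ρ₁ γ.1 * |L₁ z| := by gcongr
    have c2 : ρ₂ γ.2 * L₂ z ≤ ρ₂ γ.2 * |L₂ z| := by gcongr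
    have c3 : ρ₁ γ.1 ^ 2 * H₁ z ≤ ρ₁ γ.1 ^ 2 * |H₁ z| := by gcongr
    have c4 : ρ₂ γ.2 ^ 2 * H₂ z ≤ ρ₂ γ.2 ^ 2 * |H₂ z| := by gcongr
    constructor
    · calc _ = |(κ₁ γ.1 z.1 z.2 - κ₁ γ₁ z.1 z.2) - (κ₂ γ.2 z.1 z.2 - κ₂ γ₂ z.1 z.2)| := by
            congr 1; ring
        _ ≤ ρ₁ γ.1 * |L₁ z| + ρ₂ γ.2 * |L₂ z| :=
            (abs_sub _ _).trans (add_le_add (a1.trans c1) (b1.trans c2))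
        _ ≤ _ := by nlinarith [mul_nonneg r1 p2, mul_nonneg r2 p1]
    · rw [Fintype.sum_sum_type]
      simp only [Sum.elim_inl, Sum.elim_inr, mul_neg, Finset.sum_neg_distrib]
      calc _ = |(κ₁ γ.1 z.1 z.2 - κ₁ γ₁ z.1 z.2 - ∑ l, d₁ l γ.1 * g₁ l z) -
            (κ₂ γ.2 z.1 z.2 - κ₂ γ₂ z.1 z.2 - ∑ l, d₂ l γ.2 * g₂ l z)| := by
            congr 1; ring
        _ ≤ ρ₁ γ.1 ^ 2 * |H₁ z| + ρ₂ γ.2 ^ 2 * |H₂ z| :=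
            (abs_sub _ _).trans (add_le_add (a2.trans c3) (b2.trans c4))
        _ ≤ _ := by
            have e1 : ρ₁ γ.1 ^ 2 ≤ (ρ₁ γ.1 + ρ₂ γ.2) ^ 2 := by gcongr; linarith
            have e2 : ρ₂ γ.2 ^ 2 ≤ (ρ₁ γ.1 + ρ₂ γ.2) ^ 2 := by gcongr; linarith
            rw [mul_add]
            gcongr

/-- Two sample points with different indices have law ν ⊗ ν, and there are countably many pairs of
indices. Coinciding indices are excluded since the diagonal may carry exceptional points. -/
lemma ae_forall_pair (h : IsIID μ ν t) {p : T × T → Prop} (hp : ∀ᵐ z ∂(ν.prod ν), p z) :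
    ∀ᵐ ω ∂μ, ∀ i j, i ≠ j → p (t i ω, t j ω) := by
  rw [ae_all_iff]
  intro i
  rw [ae_all_iff]
  intro j
  by_cases hij : i = j
  · simp [hij]
  · filter_upwards [(h.measurePreserving_pair hij).quasiMeasurePreserving.ae hp] with ω hω _
    exact hω

variable {Γ : Type*} {κ : Γ → T → T → ℝ} {γs : Γ} {B : Set Γ} {ρ : Γ → ℝ}
  {γ : ℕ → Ω → Γ}

/-- Estimating the parameter changes the U-statistic by a term of order `1 / N`. -/
lemma stochBdd_uStat2_sub (h : IsIID μ ν t) (hN : Tendsto N atTop atTop)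
    (hκ : KernelExpansion ν κ γs B ρ) (hB : ∀ᶠ x in whp μ, γ x.1 x.2 ∈ B)
    (hρ : StochBdd μ (fun x => √((N x.1 : ℕ) : ℝ) * ρ (γ x.1 x.2))) :
    StochBdd μ (fun x => N x.1 * (uStat2 (N x.1) (κ (γ x.1 x.2)) (fun i => t i x.2) -
      uStat2 (N x.1) (κ γs) (fun i => t i x.2))) := by
  obtain ⟨ι, _, d, g, L, H, hd, hgm, hg, hg0, hLm, hL, hHm, hH, hae⟩ := hκ
  -- The factor N is split as √N · √N. The linear term becomes the product of √N ρ and √N times a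
  -- centered U-statistic; the remainder becomes (√N ρ)² times the U-statistic of |H|.
  have hU : StochBdd μ (fun x => ∑ l, (√((N x.1 : ℕ) : ℝ) * ρ (γ x.1 x.2)) *
      |√((N x.1 : ℕ) : ℝ) * uStat2 (N x.1) (fun a b => g l (a, b)) (fun i => t i x.2)|) :=
    StochBdd.sum _ fun l _ => hρ.mul (stochBdd_sqrt_mul_uStat2 h hN (hgm l) (hg l) (hg0 l)).abs
  refine (hU.add ((hρ.mul hρ).mul (stochBdd_uStat2_abs h hN hHm hH))).mono ?_
  filter_upwards [hB, eventually_whp_of_ae (p := fun x => ∀ i j, i ≠ j →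
    ∀ γ ∈ B, |κ γ (t i x.2) (t j x.2) - κ γs (t i x.2) (t j x.2)
      - ∑ l, d l γ * g l (t i x.2, t j x.2)| ≤ ρ γ ^ 2 * H (t i x.2, t j x.2))
    fun _ => ae_forall_pair h (hae.mono fun z hz γ hγ => (hz γ hγ).2)] with x hx hz
  set n := N x.1
  set s : ℕ → T := fun i => t i x.2
  set γ' := γ x.1 x.2
  have hn := Real.mul_self_sqrt (Nat.cast_nonneg (α := ℝ) n)
  have h1 : |uStat2 n (κ γ') s - uStat2 n (κ γs) s -
      ∑ l, d l γ' * uStat2 n (fun a b => g l (a, b)) s| ≤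
      ρ γ' ^ 2 * uStat2 n (fun a b => |H (a, b)|) s := by
    rw [← uStat2_sum, ← uStat2_sub, ← uStat2_sub]
    have : ρ γ' ^ 2 * uStat2 n (fun a b => |H (a, b)|) s =
        uStat2 n (fun a b => ρ γ' ^ 2 * |H (a, b)|) s := by
      simp only [uStat2_eq_offDiag, ← Finset.mul_sum]
      ring
    rw [this]
    refine abs_uStat2_le fun i j hij => (hz i j hij γ' hx).trans ?_
    gcongr
    exact le_abs_self _
  have h2 : |∑ l, d l γ' * uStat2 n (fun a b => g l (a, b)) s| ≤
      ∑ l, ρ γ' * |uStat2 n (fun a b => g l (a, b)) s| := by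
    refine (Finset.abs_sum_le_sum_abs _ _).trans (Finset.sum_le_sum fun l _ => ?_)
    rw [abs_mul]
    exact mul_le_mul_of_nonneg_right (hd l γ') (abs_nonneg _)
  refine le_trans ?_ (le_abs_self _)
  rw [abs_mul, Nat.abs_cast]
  calc (n : ℝ) * |uStat2 n (κ γ') s - uStat2 n (κ γs) s| ≤
      n * (∑ l, ρ γ' * |uStat2 n (fun a b => g l (a, b)) s| +
        ρ γ' ^ 2 * uStat2 n (fun a b => |H (a, b)|) s) := by
        refine mul_le_mul_of_nonneg_left ?_ (Nat.cast_nonneg n)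
        have h3 := abs_sub_abs_le_abs_sub (uStat2 n (κ γ') s - uStat2 n (κ γs) s)
          (∑ l, d l γ' * uStat2 n (fun a b => g l (a, b)) s)
        linarith
    _ = _ := by
        simp only [abs_mul, abs_of_nonneg (Real.sqrt_nonneg _)]
        rw [mul_add, Finset.mul_sum]
        congr 1
        · refine Finset.sum_congr rfl fun l _ => ?_
          linear_combination (-(ρ γ' * |uStat2 n (fun a b => g l (a, b)) s|)) * hn
        · linear_combination (-(ρ γ' ^ 2 * uStat2 n (fun a b => |H (a, b)|) s)) * hn

/-- Estimating the parameter changes the row averages by terms with bounded sum of squares. -/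
lemma stochBdd_sum_sq_rowMean_sub_rowMean (h : IsIID μ ν t) (hN : Tendsto N atTop atTop)
    (hκ : KernelExpansion ν κ γs B ρ) (hB : ∀ᶠ x in whp μ, γ x.1 x.2 ∈ B)
    (hρ : StochBdd μ (fun x => √((N x.1 : ℕ) : ℝ) * ρ (γ x.1 x.2))) :
    StochBdd μ (fun x => ∑ i ∈ Finset.range (N x.1),
      (rowMean (N x.1) (κ (γ x.1 x.2)) (fun i => t i x.2) i -
        rowMean (N x.1) (κ γs) (fun i => t i x.2) i) ^ 2) := by
  obtain ⟨ι, _, d, g, L, H, hd, hgm, hg, hg0, hLm, hL, hHm, hH, hae⟩ := hκ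
  -- By Cauchy–Schwarz within each row, the sum of squares is at most N ρ² times the U-statistic of
  -- L². This is where square integrability of the Lipschitz constant is needed.
  refine ((hρ.mul hρ).mul (stochBdd_uStat2_abs h hN (hLm.pow_const 2) hL.integrable_sq)).mono ?_
  filter_upwards [hB, eventually_le_of_tendsto hN 2, eventually_whp_of_ae (p := fun x => ∀ i j,
    i ≠ j → ∀ γ ∈ B, |κ γ (t i x.2) (t j x.2) - κ γs (t i x.2) (t j x.2)| ≤
      ρ γ * L (t i x.2, t j x.2))
    fun _ => ae_forall_pair h (hae.mono fun z hz γ hγ => (hz γ hγ).1)] with x hx hx2 hz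
  set n := N x.1
  set s : ℕ → T := fun i => t i x.2
  set γ' := γ x.1 x.2
  have hn := Real.mul_self_sqrt (Nat.cast_nonneg (α := ℝ) n)
  have h2 : (2 : ℝ) ≤ n := by exact_mod_cast hx2
  have hn1 : (0 : ℝ) < (n : ℝ) - 1 := by linarith
  rw [abs_of_nonneg (Finset.sum_nonneg fun i _ => sq_nonneg _)]
  refine le_trans ?_ (le_abs_self _)
  calc _ ≤ ∑ i ∈ Finset.range n, ((n : ℝ) - 1)⁻¹ *
        ∑ j ∈ (Finset.range n).erase i, ρ γ' ^ 2 * L (s i, s j) ^ 2 := by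
        refine Finset.sum_le_sum fun i hi => ?_
        rw [rowMean, rowMean, ← mul_sub, ← Finset.sum_sub_distrib, mul_pow]
        have hc := sq_sum_le_card_mul_sum_sq (s := (Finset.range n).erase i)
          (f := fun j => κ γ' (s i) (s j) - κ γs (s i) (s j))
        rw [Finset.card_erase_of_mem hi, Finset.card_range, Nat.cast_sub (by omega),
          Nat.cast_one] at hc
        calc _ ≤ (((n : ℝ) - 1)⁻¹) ^ 2 * (((n : ℝ) - 1) *
              ∑ j ∈ (Finset.range n).erase i, (κ γ' (s i) (s j) - κ γs (s i) (s j)) ^ 2) := by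
              gcongr
          _ = ((n : ℝ) - 1)⁻¹ *
              ∑ j ∈ (Finset.range n).erase i, (κ γ' (s i) (s j) - κ γs (s i) (s j)) ^ 2 := by
              field_simp
          _ ≤ _ := by
              gcongr with j hj
              rw [← mul_pow]
              exact sq_le_sq' (by linarith [(abs_le.1 (hz i j (Finset.ne_of_mem_erase hj).symm
                γ' hx)).1]) (abs_le.1 (hz i j (Finset.ne_of_mem_erase hj).symm γ' hx)).2
    _ = _ := by
        simp only [← Finset.mul_sum]
        rw [uStat2_eq_offDiag, sum_offDiag_eq n fun i j => |L (s i, s j) ^ 2|]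
        simp only [abs_pow, sq_abs]
        have : (n : ℝ) ≠ 0 := by linarith
        rw [show √(n : ℝ) * ρ γ' * (√(n : ℝ) * ρ γ') = n * ρ γ' ^ 2 by
          linear_combination (ρ γ' ^ 2) * hn]
        field_simp

/-- The symmetrized U-statistic of order three in terms of the row averages. -/
lemma abs_uStat3_prodKer_sub_le {η : T → T → ℝ} {M c : ℝ} (hc : 0 ≤ c) (hM : ∀ a b, |η a b| ≤ M)
    {n : ℕ} (hn : 3 ≤ n) (s : ℕ → T) :
    |uStat3 n (prodKer c η) s - c * ((n : ℝ)⁻¹ * ∑ i ∈ Finset.range n, rowMean n η s i ^ 2)| ≤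
      2 * c * M ^ 2 * ((n : ℝ) - 2)⁻¹ := by
  set R := Finset.range n with hR
  -- The three products in `prodKer` differ by relabelling the indices and give equal sums, which
  -- cancels the factor 1/3. For fixed i, the sum over distinct j and l is the square of the row sum
  -- minus its diagonal j = l.
  have hsum : ∑ i ∈ R, ∑ j ∈ R, ∑ l ∈ R,
      (if i ≠ j ∧ i ≠ l ∧ l ≠ j then prodKer c η (s i) (s j) (s l) else 0) =
      c * ∑ i ∈ R, ((∑ j ∈ R.erase i, η (s i) (s j)) ^ 2 - ∑ j ∈ R.erase i, η (s i) (s j) ^ 2) := by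
    have e1 : ∀ i ∈ R, ∑ j ∈ R, ∑ l ∈ R, (if i ≠ j ∧ i ≠ l ∧ l ≠ j then
        η (s i) (s j) * η (s i) (s l) else 0) =
        (∑ j ∈ R.erase i, η (s i) (s j)) ^ 2 - ∑ j ∈ R.erase i, η (s i) (s j) ^ 2 := by
      intro i hi
      have f1 : ∀ f : ℕ → ℝ, ∑ j ∈ R.erase i, f j = ∑ j ∈ R, if i ≠ j then f j else 0 := by
        intro f
        rw [← Finset.sum_filter]
        refine Finset.sum_congr ?_ fun _ _ => rfl
        ext j
        simp [eq_comm, and_comm]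
      rw [pow_two, Finset.sum_mul_sum, f1, f1, ← Finset.sum_sub_distrib]
      refine Finset.sum_congr rfl fun j hj => ?_
      by_cases hij : i = j
      · simp [hij]
      · simp only [ne_eq, hij, not_false_eq_true, true_and, if_true]
        rw [f1]
        have : η (s i) (s j) ^ 2 = ∑ l ∈ R, if l = j then η (s i) (s j) * η (s i) (s l) else 0 := by
          rw [Finset.sum_ite_eq' R j]
          simp [hj, pow_two]
        rw [this, ← Finset.sum_sub_distrib]
        refine Finset.sum_congr rfl fun l _ => ?_
        by_cases hl : l = j
        · simp [hl, hij]
        · simp [hl]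
    have e2 : ∑ i ∈ R, ∑ j ∈ R, ∑ l ∈ R, (if i ≠ j ∧ i ≠ l ∧ l ≠ j then
        η (s j) (s i) * η (s j) (s l) else 0) = ∑ i ∈ R, ∑ j ∈ R, ∑ l ∈ R,
        (if i ≠ j ∧ i ≠ l ∧ l ≠ j then η (s i) (s j) * η (s i) (s l) else 0) := by
      rw [Finset.sum_comm]
      refine Finset.sum_congr rfl fun i _ => Finset.sum_congr rfl fun j _ =>
        Finset.sum_congr rfl fun l _ => ?_
      congr 1
      simp only [eq_iff_iff]
      tauto
    have e3 : ∑ i ∈ R, ∑ j ∈ R, ∑ l ∈ R, (if i ≠ j ∧ i ≠ l ∧ l ≠ j then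
        η (s l) (s j) * η (s l) (s i) else 0) = ∑ i ∈ R, ∑ j ∈ R, ∑ l ∈ R,
        (if i ≠ j ∧ i ≠ l ∧ l ≠ j then η (s i) (s j) * η (s i) (s l) else 0) := by
      have : ∀ f : ℕ → ℕ → ℕ → ℝ, ∑ i ∈ R, ∑ j ∈ R, ∑ l ∈ R, f i j l =
          ∑ l ∈ R, ∑ j ∈ R, ∑ i ∈ R, f i j l := fun f => by
        rw [Finset.sum_congr rfl fun i _ => Finset.sum_comm, Finset.sum_comm]
        exact Finset.sum_congr rfl fun i _ => Finset.sum_comm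
      rw [this]
      refine Finset.sum_congr rfl fun i _ => Finset.sum_congr rfl fun j _ =>
        Finset.sum_congr rfl fun l _ => ?_
      congr 1
      simp only [eq_iff_iff]
      tauto
    rw [← Finset.sum_congr rfl e1]
    have e4 : ∀ i j l, (if i ≠ j ∧ i ≠ l ∧ l ≠ j then prodKer c η (s i) (s j) (s l) else 0) =
        c / 3 * ((if i ≠ j ∧ i ≠ l ∧ l ≠ j then η (s i) (s j) * η (s i) (s l) else 0) +
          (if i ≠ j ∧ i ≠ l ∧ l ≠ j then η (s j) (s i) * η (s j) (s l) else 0) +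
          (if i ≠ j ∧ i ≠ l ∧ l ≠ j then η (s l) (s j) * η (s l) (s i) else 0)) := by
      intro i j l
      split_ifs
      · rfl
      · simp
    simp only [e4, ← Finset.mul_sum, Finset.sum_add_distrib]
    rw [e2, e3]
    ring
  have h3 : (3 : ℝ) ≤ n := by exact_mod_cast hn
  have hn0 : (0 : ℝ) < n := by linarith
  have hn1 : (0 : ℝ) < (n : ℝ) - 1 := by linarith
  have hn2 : (0 : ℝ) < (n : ℝ) - 2 := by linarith
  have hMn : 0 ≤ M := (abs_nonneg _).trans (hM (s 0) (s 0))
  have hrow : ∀ i ∈ R, (∑ j ∈ R.erase i, η (s i) (s j)) ^ 2 ≤ (((n : ℝ) - 1) * M) ^ 2 := by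
    intro i hi
    rw [sq_le_sq, abs_of_nonneg (mul_nonneg hn1.le hMn)]
    refine (Finset.abs_sum_le_sum_abs _ _).trans ((Finset.sum_le_sum fun j _ => hM _ _).trans ?_)
    rw [Finset.sum_const, Finset.card_erase_of_mem hi, hR, Finset.card_range, nsmul_eq_mul,
      Nat.cast_sub (by omega), Nat.cast_one]
  have hsq : ∀ i ∈ R, ∑ j ∈ R.erase i, η (s i) (s j) ^ 2 ≤ ((n : ℝ) - 1) * M ^ 2 := by
    intro i hi
    refine (Finset.sum_le_sum fun j _ => sq_le_sq' (abs_le.1 (hM _ _)).1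
      (abs_le.1 (hM _ _)).2).trans ?_
    rw [Finset.sum_const, Finset.card_erase_of_mem hi, hR, Finset.card_range, nsmul_eq_mul,
      Nat.cast_sub (by omega), Nat.cast_one]
  have hA0 : 0 ≤ ∑ i ∈ R, (∑ j ∈ R.erase i, η (s i) (s j)) ^ 2 :=
    Finset.sum_nonneg fun i _ => sq_nonneg _
  have hB0 : 0 ≤ ∑ i ∈ R, ∑ j ∈ R.erase i, η (s i) (s j) ^ 2 :=
    Finset.sum_nonneg fun i _ => Finset.sum_nonneg fun j _ => sq_nonneg _
  have hA := Finset.sum_le_sum hrow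
  have hB := Finset.sum_le_sum hsq
  rw [Finset.sum_const, hR, Finset.card_range, nsmul_eq_mul, ← hR] at hA hB
  rw [uStat3, hsum, Finset.sum_sub_distrib]
  simp only [rowMean, mul_pow]
  rw [← Finset.mul_sum, ← hR]
  set A := ∑ i ∈ R, (∑ j ∈ R.erase i, η (s i) (s j)) ^ 2
  set D := ∑ i ∈ R, ∑ j ∈ R.erase i, η (s i) (s j) ^ 2
  -- Replacing the normalization n(n-1)(n-2) of A by n(n-1)² leaves a relative error 1/(n-2), and
  -- the diagonal D has the same order. The two normalized quantities lie in [0, M²].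
  have heq : 1 / ((n : ℝ) * ((n : ℝ) - 1) * ((n : ℝ) - 2)) * (c * (A - D)) -
      c * ((n : ℝ)⁻¹ * ((((n : ℝ) - 1)⁻¹) ^ 2 * A)) =
      c * ((n : ℝ) - 2)⁻¹ * (A / (n * ((n : ℝ) - 1) ^ 2) - D / (n * ((n : ℝ) - 1))) := by
    field_simp
    ring
  rw [heq, abs_mul, abs_of_nonneg (mul_nonneg hc (inv_nonneg.2 hn2.le))]
  have hA' : A / (n * ((n : ℝ) - 1) ^ 2) ≤ M ^ 2 := by
    rw [div_le_iff₀ (by positivity)]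
    linarith [hA]
  have hD' : D / (n * ((n : ℝ) - 1)) ≤ M ^ 2 := by
    rw [div_le_iff₀ (by positivity)]
    linarith [hB]
  have hA'' : 0 ≤ A / (n * ((n : ℝ) - 1) ^ 2) := by positivity
  have hD'' : 0 ≤ D / (n * ((n : ℝ) - 1)) := by positivity
  have hfin : |A / (n * ((n : ℝ) - 1) ^ 2) - D / (n * ((n : ℝ) - 1))| ≤ 2 * M ^ 2 := by
    rw [abs_le]
    constructor <;> nlinarith [sq_nonneg M]
  calc _ ≤ c * ((n : ℝ) - 2)⁻¹ * (2 * M ^ 2) := by gcongr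
    _ = _ := by ring

end Expansion

/-! ### Limit theorems for U-statistics with estimated parameter. -/

section Consistency

variable {Ω : Type*} [MeasurableSpace Ω] {T : Type*} [MeasurableSpace T]
  {μ : Measure Ω} [IsProbabilityMeasure μ] {ν : Measure T} {t : ℕ → Ω → T} {N : ℕ → ℕ}

/-- The assumptions on a kernel with estimated parameter under which the asymptotic expansions of
its U-statistics hold. -/
structure EstimatedKernel {Γ : Type*} (μ : Measure Ω) (ν : Measure T) (t : ℕ → Ω → T) (N : ℕ → ℕ)
    (κ : Γ → T → T → ℝ) (γs : Γ) (γ : ℕ → Ω → Γ) (M : ℝ) : Prop where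
  iid : IsIID μ ν t
  tendsto_size : Tendsto N atTop atTop
  measurable : Measurable fun z : T × T => κ γs z.1 z.2
  symm : ∀ a b, κ γs a b = κ γs b a
  bound : ∀ γ a b, |κ γ a b| ≤ M
  expansion : ∃ B ρ, KernelExpansion ν κ γs B ρ ∧ (∀ᶠ x in whp μ, γ x.1 x.2 ∈ B) ∧
    StochBdd μ (fun x => √((N x.1 : ℕ) : ℝ) * ρ (γ x.1 x.2))

variable {Γ : Type*} {κ : Γ → T → T → ℝ} {γs : Γ} {γ : ℕ → Ω → Γ} {M : ℝ}

namespace EstimatedKernel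

lemma measurable_proj (h : EstimatedKernel μ ν t N κ γs γ M) :
    Measurable (projKer ν (κ γs)) := by
  have := h.iid.isProbabilityMeasure
  exact measurable_projKer h.measurable

lemma abs_proj_le (h : EstimatedKernel μ ν t N κ γs γ M) (a : T) :
    |projKer ν (κ γs) a| ≤ M := by
  have := h.iid.isProbabilityMeasure
  exact abs_projKer_le (h.bound γs) a

/-- Two errors of order 1/N add up: one from inserting the limiting parameter, one from the Hájek
projection. -/
lemma uStat2_expansion (h : EstimatedKernel μ ν t N κ γs γ M) :
    StochBdd μ (fun x => N x.1 * (uStat2 (N x.1) (κ (γ x.1 x.2)) (fun i => t i x.2)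
      - ∫ a, projKer ν (κ γs) a ∂ν - 2 * ((N x.1 : ℝ)⁻¹ * ∑ i ∈ Finset.range (N x.1),
        (projKer ν (κ γs) (t i x.2) - ∫ a, projKer ν (κ γs) a ∂ν)))) := by
  obtain ⟨B, ρ, hκ, hB, hρ⟩ := h.expansion
  refine ((stochBdd_uStat2_sub h.iid h.tendsto_size hκ hB hρ).add
    (stochBdd_uStat2_sub_projection h.iid h.tendsto_size h.measurable (h.bound γs) h.symm)).congr ?_
  refine Eventually.of_forall fun x => ?_
  ring

lemma stochBdd_sqrt_mul_mean_proj (h : EstimatedKernel μ ν t N κ γs γ M) :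
    StochBdd μ (fun x => (√((N x.1 : ℕ) : ℝ))⁻¹ * ∑ i ∈ Finset.range (N x.1),
      (projKer ν (κ γs) (t i x.2) - ∫ a, projKer ν (κ γs) a ∂ν)) := by
  have := h.iid.isProbabilityMeasure
  refine stochBdd_sqrt_mul_mean h.iid h.tendsto_size (M := M + M)
    (f := fun a => projKer ν (κ γs) a - ∫ a, projKer ν (κ γs) a ∂ν)
    (h.measurable_proj.sub_const _) (fun a => (abs_sub _ _).trans
      (add_le_add (h.abs_proj_le a) (abs_integral_le_of_abs_le h.abs_proj_le))) ?_
  rw [integral_sub (integrable_of_abs_le h.measurable_proj h.abs_proj_le) (integrable_const _)]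
  simp

/-- The centered and scaled U-statistic is asymptotically equivalent to a sum of independent
variables. -/
lemma tendsto_sqrt_mul_uStat2_sub (h : EstimatedKernel μ ν t N κ γs γ M) :
    Tendsto (fun x : ℕ × Ω => √((N x.1 : ℕ) : ℝ) *
      (uStat2 (N x.1) (κ (γ x.1 x.2)) (fun i => t i x.2) - ∫ a, projKer ν (κ γs) a ∂ν) -
      2 * ((√((N x.1 : ℕ) : ℝ))⁻¹ * ∑ i ∈ Finset.range (N x.1),
        (projKer ν (κ γs) (t i x.2) - ∫ a, projKer ν (κ γs) a ∂ν))) (whp μ) (𝓝 0) := by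
  refine (h.uStat2_expansion _ (tendsto_inv_sqrt_natCast h.tendsto_size)).congr' ?_
  filter_upwards [eventually_le_of_tendsto h.tendsto_size 1] with x hx
  have hx' : (0 : ℝ) < N x.1 := by exact_mod_cast hx
  have h1 := Real.mul_self_sqrt hx'.le
  have h2 : √((N x.1 : ℕ) : ℝ) ≠ 0 := (Real.sqrt_pos.2 hx').ne'
  set r := √((N x.1 : ℕ) : ℝ)
  rw [← h1]
  field_simp

lemma stochBdd_sqrt_mul_uStat2_sub (h : EstimatedKernel μ ν t N κ γs γ M) :
    StochBdd μ (fun x => √((N x.1 : ℕ) : ℝ) *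
      (uStat2 (N x.1) (κ (γ x.1 x.2)) (fun i => t i x.2) - ∫ a, projKer ν (κ γs) a ∂ν)) := by
  refine ((StochBdd.of_tendsto h.tendsto_sqrt_mul_uStat2_sub).add
    (h.stochBdd_sqrt_mul_mean_proj.const_mul 2)).congr (Eventually.of_forall fun x => ?_)
  ring

lemma tendsto_uStat2 (h : EstimatedKernel μ ν t N κ γs γ M) :
    Tendsto (fun x : ℕ × Ω => uStat2 (N x.1) (κ (γ x.1 x.2)) (fun i => t i x.2)) (whp μ)
      (𝓝 (∫ a, projKer ν (κ γs) a ∂ν)) := by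
  have h1 := (h.stochBdd_sqrt_mul_uStat2_sub _ (tendsto_inv_sqrt_natCast h.tendsto_size)).add_const
    (∫ a, projKer ν (κ γs) a ∂ν)
  rw [zero_add] at h1
  refine h1.congr' ?_
  filter_upwards [eventually_le_of_tendsto h.tendsto_size 1] with x hx
  have hx' : (0 : ℝ) < N x.1 := by exact_mod_cast hx
  rw [inv_mul_cancel_left₀ (Real.sqrt_pos.2 hx').ne']
  ring

/-- For a kernel whose projection is constant, the U-statistic converges at rate `1 / N`. -/
lemma stochBdd_mul_uStat2_of_degenerate (h : EstimatedKernel μ ν t N κ γs γ M)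
    (h0 : ∀ᵐ a ∂ν, projKer ν (κ γs) a = 0) :
    StochBdd μ (fun x => N x.1 * uStat2 (N x.1) (κ (γ x.1 x.2)) (fun i => t i x.2)) := by
  refine h.uStat2_expansion.congr ?_
  have hθ : ∫ a, projKer ν (κ γs) a ∂ν = 0 := by
    rw [integral_congr_ae h0]; simp
  have hall : ∀ᵐ ω ∂μ, ∀ i, projKer ν (κ γs) (t i ω) = 0 := by
    rw [ae_all_iff]
    exact fun i => (h.iid.measurePreserving i).quasiMeasurePreserving.ae h0
  filter_upwards [eventually_whp_of_ae (p := fun x => ∀ i, projKer ν (κ γs) (t i x.2) = 0)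
    fun _ => hall] with x hx
  simp [hθ, hx]

/-- The row averages at the limiting parameter stand in between; the two squared deviations are
combined by (a + b)² ≤ 2a² + 2b². -/
lemma stochBdd_sum_sq (h : EstimatedKernel μ ν t N κ γs γ M) :
    StochBdd μ (fun x => ∑ i ∈ Finset.range (N x.1),
      (rowMean (N x.1) (κ (γ x.1 x.2)) (fun i => t i x.2) i - projKer ν (κ γs) (t i x.2)) ^ 2) := by
  obtain ⟨B, ρ, hκ, hB, hρ⟩ := h.expansion
  refine (((stochBdd_sum_sq_rowMean_sub_rowMean h.iid h.tendsto_size hκ hB hρ).add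
    (stochBdd_sum_sq_rowMean_sub h.iid h.tendsto_size h.measurable (h.bound γs))).const_mul 2).mono
    (Eventually.of_forall fun x => ?_)
  rw [abs_of_nonneg (Finset.sum_nonneg fun i _ => sq_nonneg _)]
  refine le_trans ?_ (le_abs_self _)
  rw [← Finset.sum_add_distrib, Finset.mul_sum]
  refine Finset.sum_le_sum fun i _ => ?_
  set a := rowMean (N x.1) (κ (γ x.1 x.2)) (fun i => t i x.2) i
  set b := rowMean (N x.1) (κ γs) (fun i => t i x.2) i
  nlinarith [sq_nonneg ((a - b) - (b - projKer ν (κ γs) (t i x.2)))]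

/-- With row average r and projection p, r² - p² = (r - p)² + 2p(r - p). The mean of (r - p)² is
O_P(1/N), and Cauchy–Schwarz with |p| ≤ M controls the mixed term. The law of large numbers applies
to p². -/
lemma tendsto_mean_sq_rowMean (h : EstimatedKernel μ ν t N κ γs γ M) :
    Tendsto (fun x => ((N x.1 : ℕ) : ℝ)⁻¹ * ∑ i ∈ Finset.range (N x.1),
      rowMean (N x.1) (κ (γ x.1 x.2)) (fun i => t i x.2) i ^ 2) (whp μ)
      (𝓝 (∫ a, projKer ν (κ γs) a ^ 2 ∂ν)) := by
  have h1 := tendsto_mean h.iid h.tendsto_size (f := fun a => projKer ν (κ γs) a ^ 2) (M := M ^ 2)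
    (h.measurable_proj.pow_const 2) (fun a => by
      rw [abs_pow]
      exact pow_le_pow_left₀ (abs_nonneg _) (h.abs_proj_le a) 2)
  have h2 := h.stochBdd_sum_sq _ (tendsto_inv_natCast h.tendsto_size)
  have h3 := h2.add ((h2.sqrt).const_mul (2 * M))
  simp only [Real.sqrt_zero, mul_zero, add_zero] at h3
  have h4 : Tendsto (fun x => ((N x.1 : ℕ) : ℝ)⁻¹ * ∑ i ∈ Finset.range (N x.1),
      rowMean (N x.1) (κ (γ x.1 x.2)) (fun i => t i x.2) i ^ 2 -
      ((N x.1 : ℕ) : ℝ)⁻¹ * ∑ i ∈ Finset.range (N x.1), projKer ν (κ γs) (t i x.2) ^ 2)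
      (whp μ) (𝓝 0) := by
    refine squeeze_zero_norm' ?_ h3
    filter_upwards [eventually_le_of_tendsto h.tendsto_size 1] with x hx
    have hx' : (0 : ℝ) < N x.1 := by exact_mod_cast hx
    set r := rowMean (N x.1) (κ (γ x.1 x.2)) (fun i => t i x.2)
    set p := fun i => projKer ν (κ γs) (t i x.2)
    have hc := sq_sum_le_card_mul_sum_sq (s := Finset.range (N x.1)) (f := fun i => |r i - p i|)
    simp only [sq_abs, Finset.card_range] at hc
    have hM : 0 ≤ M := (abs_nonneg _).trans (h.abs_proj_le (t 0 x.2))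
    have hc' : (N x.1 : ℝ)⁻¹ * ∑ i ∈ Finset.range (N x.1), |r i - p i| ≤
        √((N x.1 : ℝ)⁻¹ * ∑ i ∈ Finset.range (N x.1), (r i - p i) ^ 2) := by
      refine Real.le_sqrt_of_sq_le ?_
      rw [mul_pow]
      calc _ ≤ ((N x.1 : ℝ)⁻¹) ^ 2 * (N x.1 * ∑ i ∈ Finset.range (N x.1), (r i - p i) ^ 2) := by
            gcongr
        _ = _ := by field_simp
    rw [← mul_sub, ← Finset.sum_sub_distrib, Real.norm_eq_abs, abs_mul, abs_inv, Nat.abs_cast]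
    calc _ ≤ (N x.1 : ℝ)⁻¹ * ∑ i ∈ Finset.range (N x.1),
          ((r i - p i) ^ 2 + 2 * M * |r i - p i|) := by
          gcongr
          refine (Finset.abs_sum_le_sum_abs _ _).trans (Finset.sum_le_sum fun i _ => ?_)
          have e : r i ^ 2 - p i ^ 2 = (r i - p i) ^ 2 + 2 * p i * (r i - p i) := by ring
          rw [e]
          refine (abs_add_le _ _).trans ?_
          rw [abs_of_nonneg (sq_nonneg (r i - p i)), abs_mul, abs_mul, abs_two]
          gcongr
          exact h.abs_proj_le _
      _ = (N x.1 : ℝ)⁻¹ * ∑ i ∈ Finset.range (N x.1), (r i - p i) ^ 2 +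
          2 * M * ((N x.1 : ℝ)⁻¹ * ∑ i ∈ Finset.range (N x.1), |r i - p i|) := by
          rw [Finset.sum_add_distrib, ← Finset.mul_sum]
          ring
      _ ≤ _ := by gcongr
  have h5 := h4.add h1
  rw [zero_add] at h5
  exact h5.congr fun x => by ring

lemma tendsto_uStat3_sub (h : EstimatedKernel μ ν t N κ γs γ M) {c : ℝ} (hc : 0 ≤ c) :
    StochBdd μ (fun x => N x.1 * (uStat3 (N x.1) (prodKer c (κ (γ x.1 x.2))) (fun i => t i x.2) -
      c * (((N x.1 : ℕ) : ℝ)⁻¹ * ∑ i ∈ Finset.range (N x.1),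
        rowMean (N x.1) (κ (γ x.1 x.2)) (fun i => t i x.2) i ^ 2))) := by
  -- The factor 3 bounds N / (N - 2) for N ≥ 3.
  refine (StochBdd.const (3 * (2 * c * M ^ 2))).mono ?_
  filter_upwards [eventually_le_of_tendsto h.tendsto_size 3] with x hx
  have h3 : (3 : ℝ) ≤ N x.1 := by exact_mod_cast hx
  have hn2 : (0 : ℝ) < (N x.1 : ℝ) - 2 := by linarith
  rw [abs_mul, Nat.abs_cast]
  refine le_trans ?_ (le_abs_self _)
  calc _ ≤ (N x.1 : ℝ) * (2 * c * M ^ 2 * ((N x.1 : ℝ) - 2)⁻¹) := by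
        gcongr
        exact abs_uStat3_prodKer_sub_le hc (h.bound _) hx _
    _ = (N x.1 / ((N x.1 : ℝ) - 2)) * (2 * c * M ^ 2) := by ring
    _ ≤ 3 * (2 * c * M ^ 2) := by
        gcongr
        rw [div_le_iff₀ hn2]
        linarith

lemma tendsto_uStat3 (h : EstimatedKernel μ ν t N κ γs γ M) {c : ℝ} (hc : 0 ≤ c) :
    Tendsto (fun x : ℕ × Ω => uStat3 (N x.1) (prodKer c (κ (γ x.1 x.2))) (fun i => t i x.2))
      (whp μ) (𝓝 (c * ∫ a, projKer ν (κ γs) a ^ 2 ∂ν)) := by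
  have h1 := (h.tendsto_uStat3_sub hc _ (tendsto_inv_natCast h.tendsto_size)).add
    (h.tendsto_mean_sq_rowMean.const_mul c)
  rw [zero_add] at h1
  refine h1.congr' ?_
  filter_upwards [eventually_le_of_tendsto h.tendsto_size 1] with x hx
  have hx' : (0 : ℝ) < N x.1 := by exact_mod_cast hx
  rw [inv_mul_cancel_left₀ hx'.ne']
  ring

/-- If the projection vanishes, the row averages are equal to their own deviations from it, and
these have a stochastically bounded sum of squares. -/
lemma stochBdd_mul_uStat3_of_degenerate (h : EstimatedKernel μ ν t N κ γs γ M) {c : ℝ}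
    (hc : 0 ≤ c) (h0 : ∀ᵐ a ∂ν, projKer ν (κ γs) a = 0) :
    StochBdd μ (fun x => N x.1 *
      uStat3 (N x.1) (prodKer c (κ (γ x.1 x.2))) (fun i => t i x.2)) := by
  refine ((h.tendsto_uStat3_sub hc).add (h.stochBdd_sum_sq.const_mul c)).congr ?_
  have hall : ∀ᵐ ω ∂μ, ∀ i, projKer ν (κ γs) (t i ω) = 0 := by
    rw [ae_all_iff]
    exact fun i => (h.iid.measurePreserving i).quasiMeasurePreserving.ae h0
  filter_upwards [eventually_le_of_tendsto h.tendsto_size 1,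
    eventually_whp_of_ae (p := fun x => ∀ i, projKer ν (κ γs) (t i x.2) = 0)
    fun _ => hall] with x hx hz
  have hx' : (0 : ℝ) < N x.1 := by exact_mod_cast hx
  simp only [hz, sub_zero]
  field_simp
  ring

/-- Central limit theorem for the linear part of the U-statistic. -/
lemma tendstoInDistribution_mean_proj (h : EstimatedKernel μ ν t N κ γs γ M) {v : ℝ}
    (hv : v = ∫ a, projKer ν (κ γs) a ^ 2 ∂ν - (∫ a, projKer ν (κ γs) a ∂ν) ^ 2) (hv0 : 0 < v) :
    TendstoInDistribution (fun m ω => (√v)⁻¹ * ((√((N m : ℕ) : ℝ))⁻¹ *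
      ∑ i ∈ Finset.range (N m), (projKer ν (κ γs) (t i ω) - ∫ a, projKer ν (κ γs) a ∂ν)))
      atTop (id : ℝ → ℝ) (fun _ => μ) (gaussianReal 0 1) := by
  have := h.iid.isProbabilityMeasure
  set θ := ∫ a, projKer ν (κ γs) a ∂ν with hθ
  have hp := h.measurable_proj
  have hi := integrable_of_abs_le (ρ := ν) hp h.abs_proj_le
  have hi2 : Integrable (fun a => projKer ν (κ γs) a ^ 2) ν :=
    integrable_of_abs_le (M := M ^ 2) (hp.pow_const 2) fun a => by
      rw [abs_pow]
      exact pow_le_pow_left₀ (abs_nonneg _) (h.abs_proj_le a) 2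
  set f : T → ℝ := fun a => (√v)⁻¹ * (projKer ν (κ γs) a - θ) with hf
  have hfm : Measurable f := (hp.sub_const _).const_mul _
  have hf0 : ∫ a, f a ∂ν = 0 := by
    simp only [hf]
    rw [integral_const_mul, integral_sub hi (integrable_const _)]
    simp [hθ]
  have hf1 : ∫ a, f a ^ 2 ∂ν = 1 := by
    have e : ∀ a, f a ^ 2 = v⁻¹ * (projKer ν (κ γs) a ^ 2 - 2 * θ * projKer ν (κ γs) a + θ ^ 2) := by
      intro a
      simp only [hf, mul_pow, inv_pow, Real.sq_sqrt hv0.le]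
      ring
    simp only [e]
    have hi3 : Integrable (fun a => projKer ν (κ γs) a ^ 2 - 2 * θ * projKer ν (κ γs) a) ν :=
      hi2.sub (hi.const_mul _)
    rw [integral_const_mul, integral_add hi3 (integrable_const _),
      integral_sub hi2 (hi.const_mul _), integral_const_mul, ← hθ]
    simp only [integral_const, probReal_univ, one_smul]
    rw [show ∫ a, projKer ν (κ γs) a ^ 2 ∂ν - 2 * θ * θ + θ ^ 2 = v by rw [hv]; ring]
    exact inv_mul_cancel₀ hv0.ne'
  have hclt := tendstoInDistribution_inv_sqrt_mul_sum (P := μ) (P' := gaussianReal 0 1)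
    (X := fun i ω => f (t i ω)) (Y := id) ⟨aemeasurable_id, Measure.map_id⟩
    (by rw [integral_comp_of_measurePreserving (h.iid.measurePreserving 0) hfm, hf0])
    (by
      simp only [Pi.pow_apply]
      rw [integral_comp_of_measurePreserving (h.iid.measurePreserving 0) (hfm.pow_const 2), hf1])
    (h.iid.indep.comp (fun _ => f) fun _ => hfm)
    (fun i => ((⟨(h.iid.measurable i).aemeasurable, (h.iid.measurable 0).aemeasurable, by
      rw [h.iid.law, h.iid.law]⟩ : IdentDistrib (t i) (t 0) μ μ).comp hfm))
  have hcomp : TendstoInDistribution (fun m ω => (√((N m : ℕ) : ℝ))⁻¹ *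
      ∑ i ∈ Finset.range (N m), f (t i ω)) atTop (id : ℝ → ℝ) (fun _ => μ) (gaussianReal 0 1) :=
    ⟨fun m => hclt.forall_aemeasurable (N m), hclt.aemeasurable_limit,
      hclt.tendsto.comp h.tendsto_size⟩
  refine hcomp.congr (fun m => ae_of_all _ fun ω => ?_) (ae_of_all _ fun _ => rfl)
  simp only [hf, ← Finset.mul_sum]
  ring

end EstimatedKernel

end Consistency

/-! ### Bounds for increments and gradients of a bounded function by its Hessian. -/

section Calculus

variable {E : Type*} [NormedAddCommGroup E] [NormedSpace ℝ E]

/-- The mean value inequality is used twice, first for the gradient and then for the function minus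
its linear part. No continuity of the second derivative is needed; in return the factor 1/2 is lost.
-/
lemma abs_taylor_le_of_hessian {f : E → ℝ} {a : E} {δ H : ℝ}
    (hf : TwiceDifferentiableOn f (Metric.ball a δ))
    (hH : ∀ x ∈ Metric.ball a δ, ‖fderiv ℝ (fderiv ℝ f) x‖ ≤ H) {x : E}
    (hx : x ∈ Metric.ball a δ) :
    |f x - f a - fderiv ℝ f a (x - a)| ≤ H * ‖x - a‖ ^ 2 := by
  have hδ : 0 < δ := (dist_nonneg).trans_lt hx
  have ha : a ∈ Metric.ball a δ := Metric.mem_ball_self hδ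
  have hH0 : 0 ≤ H := (norm_nonneg (fderiv ℝ (fderiv ℝ f) a)).trans (hH a ha)
  have hd : ∀ y ∈ Metric.ball a δ, DifferentiableAt ℝ f y := fun y hy =>
    hf.1.differentiableAt (Metric.isOpen_ball.mem_nhds hy)
  have hd' : ∀ y ∈ Metric.ball a δ, DifferentiableAt ℝ (fderiv ℝ f) y := fun y hy =>
    hf.2.differentiableAt (Metric.isOpen_ball.mem_nhds hy)
  have hsub : Metric.closedBall a ‖x - a‖ ⊆ Metric.ball a δ :=
    Metric.closedBall_subset_ball (by rwa [← dist_eq_norm])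
  have h1 : ∀ y ∈ Metric.closedBall a ‖x - a‖, ‖fderiv ℝ f y - fderiv ℝ f a‖ ≤ H * ‖x - a‖ := by
    intro y hy
    have := (convex_ball a δ).norm_image_sub_le_of_norm_fderiv_le (𝕜 := ℝ) hd' hH ha (hsub hy)
    refine this.trans ?_
    gcongr
    rwa [← dist_eq_norm]
  have h2 := (convex_closedBall a ‖x - a‖).norm_image_sub_le_of_norm_fderiv_le' (𝕜 := ℝ)
    (fun y hy => hd y (hsub hy)) h1 (Metric.mem_closedBall_self (norm_nonneg _))
    (y := x) (by simp [dist_eq_norm])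
  rw [Real.norm_eq_abs] at h2
  refine h2.trans (le_of_eq ?_)
  ring

/-- A bounded function with bounded Hessian has a bounded gradient. -/
lemma norm_fderiv_le_of_hessian {f : E → ℝ} {a : E} {δ M H : ℝ} (hδ : 0 < δ)
    (hf : TwiceDifferentiableOn f (Metric.ball a δ)) (hM : ∀ x, |f x| ≤ M)
    (hH : ∀ x ∈ Metric.ball a δ, ‖fderiv ℝ (fderiv ℝ f) x‖ ≤ H) :
    ‖fderiv ℝ f a‖ ≤ (2 * M + δ ^ 2 / 4) * (2 / δ) * √(1 + H) := by
  have hH0 : 0 ≤ H := (norm_nonneg (fderiv ℝ (fderiv ℝ f) a)).trans (hH a (Metric.mem_ball_self hδ))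
  have hM0 : 0 ≤ M := (abs_nonneg _).trans (hM a)
  set r := √(1 + H) with hr
  have hr1 : 1 ≤ r := Real.one_le_sqrt.2 (by linarith)
  have hr2 : r ^ 2 = 1 + H := Real.sq_sqrt (by linarith)
  have hr0 : 0 < r := by linarith
  refine ContinuousLinearMap.opNorm_le_bound _ (by positivity) fun v => ?_
  rcases eq_or_ne v 0 with rfl | hv
  · simp
  have hv0 : 0 < ‖v‖ := norm_pos_iff.2 hv
  -- The step length is chosen so that ‖s • v‖ = δ / (2√(1 + H)). The point stays in the ball, the
  -- Taylor remainder is at most δ²/4, and division by s produces only the factor √(1 + H).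
  set s := δ / 2 / (r * ‖v‖) with hs
  have hs0 : 0 < s := by positivity
  have hnorm : ‖s • v‖ = δ / 2 / r := by
    rw [norm_smul, Real.norm_of_nonneg hs0.le, hs]
    field_simp
  have hlt : δ / 2 / r < δ := by
    rw [div_lt_iff₀ hr0]
    nlinarith
  have h1 := abs_taylor_le_of_hessian hf hH (x := a + s • v)
    (by rw [Metric.mem_ball, dist_eq_norm, add_sub_cancel_left, hnorm]; exact hlt)
  rw [add_sub_cancel_left, hnorm, map_smul, smul_eq_mul] at h1
  have h2 : H * (δ / 2 / r) ^ 2 ≤ δ ^ 2 / 4 := by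
    rw [div_pow, hr2, ← mul_div_assoc, div_le_iff₀ (by linarith)]
    nlinarith [sq_nonneg δ]
  have h3 := abs_le.1 (hM (a + s • v))
  have h4 := abs_le.1 (hM a)
  have h5 := abs_le.1 h1
  have h6 : s * |fderiv ℝ f a v| ≤ 2 * M + δ ^ 2 / 4 := by
    have h : s * |fderiv ℝ f a v| = |s * fderiv ℝ f a v| := by rw [abs_mul, abs_of_pos hs0]
    rw [h, abs_le]
    constructor <;> linarith
  have h7 : |fderiv ℝ f a v| ≤ (2 * M + δ ^ 2 / 4) / s := by
    rw [le_div_iff₀ hs0]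
    linarith
  rw [Real.norm_eq_abs]
  refine h7.trans (le_of_eq ?_)
  rw [hs]
  field_simp

/-- A Lipschitz bound of size √(1 + H) on the whole ball. A Taylor expansion with the gradient bound
would leave the term H ‖x - a‖², whose coefficient is not square integrable. It is absorbed when ‖x
- a‖ √(1 + H) ≤ 1; otherwise the trivial bound 2M for the increment suffices. -/
lemma abs_sub_le_of_hessian {f : E → ℝ} {a : E} {δ M H : ℝ} (hδ : 0 < δ)
    (hf : TwiceDifferentiableOn f (Metric.ball a δ)) (hM : ∀ x, |f x| ≤ M)
    (hH : ∀ x ∈ Metric.ball a δ, ‖fderiv ℝ (fderiv ℝ f) x‖ ≤ H) {x : E}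
    (hx : x ∈ Metric.ball a δ) :
    |f x - f a| ≤ ‖x - a‖ * (((2 * M + δ ^ 2 / 4) * (2 / δ) + 1 + 2 * M) * √(1 + H)) := by
  have hH0 : 0 ≤ H := (norm_nonneg (fderiv ℝ (fderiv ℝ f) a)).trans (hH a (Metric.mem_ball_self hδ))
  have hM0 : 0 ≤ M := (abs_nonneg _).trans (hM a)
  have hg := norm_fderiv_le_of_hessian hδ hf hM hH
  have ht := abs_taylor_le_of_hessian hf hH hx
  set C := (2 * M + δ ^ 2 / 4) * (2 / δ)
  have hC : 0 ≤ C := by positivity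
  set r := √(1 + H) with hr
  have hr2 : r ^ 2 = 1 + H := Real.sq_sqrt (by linarith)
  have hr0 : 0 ≤ r := Real.sqrt_nonneg _
  set u := ‖x - a‖
  have hu : 0 ≤ u := norm_nonneg _
  rcases le_total (r * u) 1 with hcase | hcase
  · have h1 : |fderiv ℝ f a (x - a)| ≤ C * r * u :=
      ((fderiv ℝ f a).le_opNorm _).trans (by gcongr)
    have h2 : H * u ^ 2 ≤ r * u := by
      calc H * u ^ 2 ≤ r ^ 2 * u ^ 2 := by gcongr; linarith
        _ = (r * u) * (r * u) := by ring
        _ ≤ 1 * (r * u) := by gcongr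
        _ = r * u := one_mul _
    have h3 : |f x - f a| ≤ C * r * u + r * u := by
      rw [abs_le] at ht h1 ⊢
      constructor <;> linarith
    have h4 : 0 ≤ 2 * M * r * u := by positivity
    linarith
  · have h1 : |f x - f a| ≤ 2 * M := by
      rw [two_mul]
      exact (abs_sub _ _).trans (add_le_add (hM _) (hM _))
    have h2 : 2 * M * 1 ≤ 2 * M * (r * u) := by gcongr
    have h4 : 0 ≤ (C + 1) * r * u := by positivity
    linarith

end Calculus

/-! ### From the moment conditions to expansions with integrable envelopes. -/

section Envelope

variable {Z : Type*} [MeasurableSpace Z]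

/-- The partial derivatives serve as linear coefficients. Since κ is bounded, they and the Lipschitz
constant are dominated by multiples of √(1 + |H|), hence lie in L² although H is only in L¹. Their
means vanish by `h0`. -/
lemma MomentConditions.exists_expansion {p : ℕ} {ρ : Measure Z} [IsProbabilityMeasure ρ]
    {κ : Z → EuclideanSpace ℝ (Fin p) → ℝ} {αs : EuclideanSpace ℝ (Fin p)} {δ M : ℝ} (hδ : 0 < δ)
    (h : MomentConditions ρ κ αs δ) (hd : ∀ z, TwiceDifferentiableOn (κ z) (Metric.ball αs δ))
    (hM : ∀ z α, |κ z α| ≤ M) (h0 : ∫ z, fderiv ℝ (κ z) αs ∂ρ = 0) :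
    ∃ (g : Fin p → Z → ℝ) (L H : Z → ℝ), (∀ l, Measurable (g l)) ∧ (∀ l, MemLp (g l) 2 ρ) ∧
      (∀ l, ∫ z, g l z ∂ρ = 0) ∧ Measurable L ∧ MemLp L 2 ρ ∧ Measurable H ∧ Integrable H ρ ∧
      ∀ᵐ z ∂ρ, ∀ α ∈ Metric.ball αs δ, |κ z α - κ z αs| ≤ ‖α - αs‖ * L z ∧
        |κ z α - κ z αs - ∑ l, (α - αs) l * g l z| ≤ ‖α - αs‖ ^ 2 * H z := by
  obtain ⟨H₀, hH₀, hae⟩ := h.hessian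
  -- The envelope and the derivatives are only almost everywhere strongly measurable, so measurable
  -- versions replace them here and for g.
  set H : Z → ℝ := hH₀.1.mk H₀ with hHdef
  have hHm : Measurable H := hH₀.1.stronglyMeasurable_mk.measurable
  have hHeq : H₀ =ᵐ[ρ] H := hH₀.1.ae_eq_mk
  have hH : Integrable H ρ := hH₀.congr hHeq
  set e : Fin p → EuclideanSpace ℝ (Fin p) := fun l => EuclideanSpace.basisFun (Fin p) ℝ l with he
  have hgi : ∀ l, Integrable (fun z => fderiv ℝ (κ z) αs (e l)) ρ := fun l =>
    h.gradient_integrable.apply_continuousLinearMap (e l)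
  set g : Fin p → Z → ℝ := fun l => (hgi l).1.mk _ with hg
  have hgeq : ∀ l, (fun z => fderiv ℝ (κ z) αs (e l)) =ᵐ[ρ] g l := fun l => (hgi l).1.ae_eq_mk
  have hsqrt : MemLp (fun z => √(1 + |H z|)) 2 ρ := by
    rw [memLp_two_iff_integrable_sq (by fun_prop)]
    simp_rw [fun z => Real.sq_sqrt (show 0 ≤ 1 + |H z| by positivity)]
    exact (integrable_const _).add hH.abs
  have hball : ∀ᵐ z ∂ρ, ∀ α ∈ Metric.ball αs δ, ‖fderiv ℝ (fderiv ℝ (κ z)) α‖ ≤ |H z| := by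
    filter_upwards [hae, hHeq] with z hz hz' α hα
    rw [← hz']
    exact (hz α hα).trans (le_abs_self _)
  refine ⟨g, fun z => ((2 * M + δ ^ 2 / 4) * (2 / δ) + 1 + 2 * M) * √(1 + |H z|),
    fun z => |H z|, fun l => (hgi l).1.stronglyMeasurable_mk.measurable, ?_, ?_, by fun_prop,
    hsqrt.const_mul _, hHm.abs, hH.abs, ?_⟩
  · intro l
    refine (hsqrt.const_mul ((2 * M + δ ^ 2 / 4) * (2 / δ))).mono
      (hgi l).1.stronglyMeasurable_mk.aestronglyMeasurable ?_
    filter_upwards [hball, hgeq l] with z hz hz'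
    rw [← hz']
    have h1 := norm_fderiv_le_of_hessian hδ (hd z) (hM z) hz
    refine ((fderiv ℝ (κ z) αs).le_opNorm (e l)).trans ?_
    have he1 : ‖e l‖ = 1 := (EuclideanSpace.basisFun (Fin p) ℝ).orthonormal.1 l
    rw [he1, mul_one]
    exact h1.trans (le_abs_self _)
  · intro l
    rw [← integral_congr_ae (hgeq l), ← ContinuousLinearMap.integral_apply h.gradient_integrable,
      h0]
    rfl
  · filter_upwards [hball, ae_all_iff.2 hgeq] with z hz hz' α hα
    refine ⟨abs_sub_le_of_hessian hδ (hd z) (hM z) hz hα, ?_⟩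
    have h1 := abs_taylor_le_of_hessian (hd z) hz hα
    have h2 : fderiv ℝ (κ z) αs (α - αs) = ∑ l, (α - αs) l * g l z := by
      conv_lhs => rw [← (EuclideanSpace.basisFun (Fin p) ℝ).sum_repr (α - αs)]
      rw [map_sum]
      refine Finset.sum_congr rfl fun l _ => ?_
      rw [map_smul, smul_eq_mul, ← hz' l]
      rfl
    rw [h2] at h1
    linarith

/-- Expansion of a kernel of two arguments that factors through a measure preserving map. -/
lemma MomentConditions.kernelExpansion {T : Type*} [MeasurableSpace T] {ν : Measure T}
    {p : ℕ} {ρ : Measure Z} [IsProbabilityMeasure ρ]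
    {κ : Z → EuclideanSpace ℝ (Fin p) → ℝ} {αs : EuclideanSpace ℝ (Fin p)} {δ M : ℝ} (hδ : 0 < δ)
    (h : MomentConditions ρ κ αs δ) (hd : ∀ z, TwiceDifferentiableOn (κ z) (Metric.ball αs δ))
    (hM : ∀ z α, |κ z α| ≤ M) (h0 : ∫ z, fderiv ℝ (κ z) αs ∂ρ = 0)
    {φ : T × T → Z} (hφ : MeasurePreserving φ (ν.prod ν) ρ) :
    KernelExpansion ν (fun α a b => κ (φ (a, b)) α) αs (Metric.ball αs δ)
      (fun α => ‖α - αs‖) := by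
  obtain ⟨g, L, H, hgm, hg, hg0, hLm, hL, hHm, hH, hae⟩ := h.exists_expansion hδ hd hM h0
  refine ⟨Fin p, inferInstance, fun l α => (α - αs) l, fun l z => g l (φ z), fun z => L (φ z),
    fun z => H (φ z), fun l α => ?_, fun l => (hgm l).comp hφ.measurable,
    fun l => (hg l).comp_measurePreserving hφ, fun l => ?_, hLm.comp hφ.measurable,
    hL.comp_measurePreserving hφ, hHm.comp hφ.measurable,
    (hφ.integrable_comp hH.1).2 hH, hφ.quasiMeasurePreserving.ae hae⟩
  · exact PiLp.norm_apply_le (α - αs) l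
  · rw [integral_comp_of_measurePreserving hφ (hgm l), hg0]

end Envelope

/-! ### Pairs from an i.i.d. sequence; sums of pairwise independent variables. -/

section Pairs

variable {Ω : Type*} [MeasurableSpace Ω] {T : Type*} [MeasurableSpace T]
  {μ : Measure Ω} [IsProbabilityMeasure μ] {ν : Measure T} {t : ℕ → Ω → T}

/-- Consecutive pairs of an i.i.d. sequence are i.i.d. -/
lemma IsIID.pairs (h : IsIID μ ν t) :
    IsIID μ (ν.prod ν) (fun i ω => pairs (fun j => t j ω) i) := by
  classical
  have hm : ∀ i, Measurable fun ω => MMDTest.pairs (fun j => t j ω) i := fun i =>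
    (h.measurable _).prodMk (h.measurable _)
  refine ⟨hm, fun i => (h.measurePreserving_pair (by omega)).map_eq, ?_⟩
  rw [iIndepFun_iff_measure_inter_preimage_eq_mul]
  intro S A hA
  induction S using Finset.induction_on with
  | empty => simp
  | insert a S ha ih =>
    have hA' : ∀ i ∈ S, MeasurableSet (A i) := fun i hi => hA i (Finset.mem_insert_of_mem hi)
    rw [Finset.prod_insert ha, ← ih hA', Finset.set_biInter_insert]
    -- The pairs with index in S involve only the positions in V, which are disjoint from the
    -- positions 2a and 2a + 1 of the new pair. Independence of the two blocks splits off one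
    -- factor.
    set V : Finset ℕ := S.biUnion fun i => {2 * i, 2 * i + 1} with hV
    have hdisj : Disjoint ({2 * a, 2 * a + 1} : Finset ℕ) V := by
      rw [Finset.disjoint_left]
      intro x hx hx'
      simp only [hV, Finset.mem_biUnion, Finset.mem_insert, Finset.mem_singleton] at hx hx'
      obtain ⟨i, hi, hx'⟩ := hx'
      have : i = a := by omega
      exact ha (this ▸ hi)
    have hind := h.indep.indepFun_finset {2 * a, 2 * a + 1} V hdisj h.measurable
    have hmemV : ∀ i ∈ S, 2 * i ∈ V ∧ 2 * i + 1 ∈ V := fun i hi => by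
      simp only [hV, Finset.mem_biUnion, Finset.mem_insert, Finset.mem_singleton]
      exact ⟨⟨i, hi, Or.inl rfl⟩, ⟨i, hi, Or.inr rfl⟩⟩
    set f : (({2 * a, 2 * a + 1} : Finset ℕ) → T) → T × T := fun v =>
      (v ⟨2 * a, by simp⟩, v ⟨2 * a + 1, by simp⟩) with hf
    have hfm : Measurable f := by fun_prop
    set W : Set (V → T) := ⋂ i : S, (fun v : V → T =>
      (v ⟨2 * i.1, (hmemV i.1 i.2).1⟩, v ⟨2 * i.1 + 1, (hmemV i.1 i.2).2⟩)) ⁻¹' A i.1 with hW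
    have hWm : MeasurableSet W := MeasurableSet.iInter fun i =>
      (show Measurable fun v : V → T =>
        (v ⟨2 * i.1, (hmemV i.1 i.2).1⟩, v ⟨2 * i.1 + 1, (hmemV i.1 i.2).2⟩) by fun_prop)
        (hA' i.1 i.2)
    have key := hind.measure_inter_preimage_eq_mul (f ⁻¹' A a) W
      (hfm (hA a (Finset.mem_insert_self _ _))) hWm
    have e1 : (fun ω (i : ({2 * a, 2 * a + 1} : Finset ℕ)) => t i ω) ⁻¹' (f ⁻¹' A a) =
        (fun ω => MMDTest.pairs (fun j => t j ω) a) ⁻¹' A a := rfl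
    have e2 : (fun ω (i : V) => t i ω) ⁻¹' W =
        ⋂ i ∈ S, (fun ω => MMDTest.pairs (fun j => t j ω) i) ⁻¹' A i := by
      ext ω
      simp only [hW, Set.mem_preimage, Set.mem_iInter, Subtype.forall]
      rfl
    rw [e1, e2] at key
    exact key

/-- If a sum of pairwise independent variables is constant, then so is each of them. -/
lemma ae_const_of_sum_ae_const {ι : Type*} {s : Finset ι} {Y : ι → Ω → ℝ}
    (hY : ∀ i ∈ s, MemLp (Y i) 2 μ)
    (hind : Set.Pairwise ↑s fun i j => IndepFun (Y i) (Y j) μ) {c : ℝ}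
    (hc : ∀ᵐ ω ∂μ, ∑ i ∈ s, Y i ω = c) : ∀ i ∈ s, ∀ᵐ ω ∂μ, Y i ω = ∫ ω, Y i ω ∂μ := by
  have h1 := IndepFun.variance_sum hY hind
  have h2 : Var[∑ i ∈ s, Y i; μ] = 0 := by
    have : (∑ i ∈ s, Y i) =ᵐ[μ] fun _ => c := by
      filter_upwards [hc] with ω hω
      rw [Finset.sum_apply, hω]
    rw [variance_congr this, variance_eq_integral aemeasurable_const]
    simp
  rw [h2] at h1
  intro i hi
  exact ae_eq_integral_of_variance_eq_zero (hY i hi)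
    ((Finset.sum_eq_zero_iff_of_nonneg fun j _ => variance_nonneg _ _).1 h1.symm i hi)

end Pairs

lemma isProbabilityMeasure_of_measurePreserving {A B : Type*} [MeasurableSpace A]
    [MeasurableSpace B] {ρ : Measure A} {ρ' : Measure B} [IsProbabilityMeasure ρ] {f : A → B}
    (hf : MeasurePreserving f ρ ρ') : IsProbabilityMeasure ρ' := by
  rw [← hf.map_eq]
  exact Measure.isProbabilityMeasure_map hf.measurable.aemeasurable

/-! ### Bounds, symmetry, measurability, mean and positivity of the kernels h and q. -/

section KernelFacts

variable {S : Type*} {k : S → S → ℝ} {C : ℝ}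

lemma abs_hKer_le (hC : ∀ x y, |k x y| ≤ C) (a b : S × S) : |hKer k a b| ≤ 4 * C := by
  have h1 := abs_le.1 (hC a.1 b.1)
  have h2 := abs_le.1 (hC a.1 b.2)
  have h3 := abs_le.1 (hC b.1 a.2)
  have h4 := abs_le.1 (hC a.2 b.2)
  rw [hKer, abs_le]
  constructor <;> linarith

lemma abs_qKer_le (hC : ∀ x y, |k x y| ≤ C) (a b : (S × S) × (S × S)) :
    |qKer k a b| ≤ 4 * C := by
  have h1 := abs_le.1 (hC a.1.1 b.1.1)
  have h2 := abs_le.1 (hC b.2.1 a.2.2)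
  have h3 := abs_le.1 (hC a.2.1 b.2.2)
  have h4 := abs_le.1 (hC a.1.2 b.1.2)
  rw [qKer, abs_le]
  constructor <;> linarith

lemma hKer_comm (hs : ∀ x y, k x y = k y x) (a b : S × S) : hKer k a b = hKer k b a := by
  rw [hKer, hKer, hs a.1 b.1, hs a.2 b.2]
  ring

lemma qKer_comm (hs : ∀ x y, k x y = k y x) (a b : (S × S) × (S × S)) :
    qKer k a b = qKer k b a := by
  rw [qKer, qKer, hs a.1.1 b.1.1, hs a.1.2 b.1.2]
  ring

lemma abs_hCmp_le (hC : ∀ x y, |k x y| ≤ C) (a b : S × S × S) : |hCmp k a b| ≤ 8 * C :=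
  (abs_sub _ _).trans ((add_le_add (abs_hKer_le hC _ _) (abs_hKer_le hC _ _)).trans (by linarith))

lemma abs_qCmp_le (hC : ∀ x y, |k x y| ≤ C) (a b : (S × S × S) × (S × S × S)) :
    |qCmp k a b| ≤ 8 * C :=
  (abs_sub _ _).trans ((add_le_add (abs_qKer_le hC _ _) (abs_qKer_le hC _ _)).trans (by linarith))

lemma hCmp_comm (hs : ∀ x y, k x y = k y x) (a b : S × S × S) : hCmp k a b = hCmp k b a := by
  rw [hCmp, hCmp, hKer_comm hs, hKer_comm hs (a.1, a.2.2)]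

lemma qCmp_comm (hs : ∀ x y, k x y = k y x) (a b : (S × S × S) × (S × S × S)) :
    qCmp k a b = qCmp k b a := by
  rw [qCmp, qCmp, qKer_comm hs, qKer_comm hs ((a.1.1, a.1.2.2), _)]

variable [MeasurableSpace S]

lemma measurable_hKer {A : Type*} [MeasurableSpace A]
    (hk : Measurable fun z : S × S => k z.1 z.2) {f g : A → S × S} (hf : Measurable f)
    (hg : Measurable g) : Measurable fun a => hKer k (f a) (g a) := by
  have h : ∀ {u v : A → S}, Measurable u → Measurable v → Measurable fun a => k (u a) (v a) :=
    fun hu hv => hk.comp (hu.prodMk hv)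
  exact (((h hf.fst hg.fst).sub (h hf.fst hg.snd)).sub (h hg.fst hf.snd)).add (h hf.snd hg.snd)

lemma measurable_qKer {A : Type*} [MeasurableSpace A]
    (hk : Measurable fun z : S × S => k z.1 z.2) {f g : A → (S × S) × (S × S)} (hf : Measurable f)
    (hg : Measurable g) : Measurable fun a => qKer k (f a) (g a) := by
  have h : ∀ {u v : A → S}, Measurable u → Measurable v → Measurable fun a => k (u a) (v a) :=
    fun hu hv => hk.comp (hu.prodMk hv)
  exact (((h hf.fst.fst hg.fst.fst).sub (h hg.snd.fst hf.snd.snd)).sub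
    (h hf.snd.fst hg.snd.snd)).add (h hf.fst.snd hg.fst.snd)

lemma measurable_hCmp {A : Type*} [MeasurableSpace A]
    (hk : Measurable fun z : S × S => k z.1 z.2) {f g : A → S × S × S} (hf : Measurable f)
    (hg : Measurable g) : Measurable fun a => hCmp k (f a) (g a) :=
  (measurable_hKer hk (hf.fst.prodMk hf.snd.fst) (hg.fst.prodMk hg.snd.fst)).sub
    (measurable_hKer hk (hf.fst.prodMk hf.snd.snd) (hg.fst.prodMk hg.snd.snd))

lemma measurable_qCmp {A : Type*} [MeasurableSpace A]
    (hk : Measurable fun z : S × S => k z.1 z.2) {f g : A → (S × S × S) × (S × S × S)}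
    (hf : Measurable f) (hg : Measurable g) : Measurable fun a => qCmp k (f a) (g a) :=
  (measurable_qKer hk
    ((hf.fst.fst.prodMk hf.fst.snd.fst).prodMk (hf.snd.fst.prodMk hf.snd.snd.fst))
    ((hg.fst.fst.prodMk hg.fst.snd.fst).prodMk (hg.snd.fst.prodMk hg.snd.snd.fst))).sub
  (measurable_qKer hk
    ((hf.fst.fst.prodMk hf.fst.snd.snd).prodMk (hf.snd.fst.prodMk hf.snd.snd.snd))
    ((hg.fst.fst.prodMk hg.fst.snd.snd).prodMk (hg.snd.fst.prodMk hg.snd.snd.snd)))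

lemma integral_kernel_of_indepFun {A : Type*} [MeasurableSpace A] {ρ : Measure A}
    [IsProbabilityMeasure ρ] (hk : Measurable fun z : S × S => k z.1 z.2)
    (hC : ∀ x y, |k x y| ≤ C) {f g : A → S} {P Q : Measure S}
    (hf : MeasurePreserving f ρ P) (hg : MeasurePreserving g ρ Q) (hfg : IndepFun f g ρ) :
    ∫ a, k (f a) (g a) ∂ρ = ∫ x, ∫ y, k x y ∂Q ∂P := by
  have : IsProbabilityMeasure P := isProbabilityMeasure_of_measurePreserving hf
  have : IsProbabilityMeasure Q := isProbabilityMeasure_of_measurePreserving hg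
  rw [integral_comp_of_measurePreserving (measurePreserving_prodMk hf hg hfg) hk,
    integral_prod _ (integrable_of_abs_le hk fun z => hC z.1 z.2)]

/-- By linearity only the two arguments within each kernel value need to be independent. The same
computation thus covers h, which reuses its four points, and q, which takes its terms from eight. -/
lemma integral_eq_mmdSq {A : Type*} [MeasurableSpace A] {ρ : Measure A}
    [IsProbabilityMeasure ρ] (hk : IsCharacteristicKernel k) {P Q : Measure S}
    {x₁ x₂ x₃ x₄ y₁ y₂ y₃ y₄ : A → S} (hx₁ : MeasurePreserving x₁ ρ P)
    (hx₂ : MeasurePreserving x₂ ρ P) (hx₃ : MeasurePreserving x₃ ρ P)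
    (hx₄ : MeasurePreserving x₄ ρ P) (hy₁ : MeasurePreserving y₁ ρ Q)
    (hy₂ : MeasurePreserving y₂ ρ Q) (hy₃ : MeasurePreserving y₃ ρ Q)
    (hy₄ : MeasurePreserving y₄ ρ Q) (h₁ : IndepFun x₁ x₂ ρ) (h₂ : IndepFun y₁ x₃ ρ)
    (h₃ : IndepFun y₂ x₄ ρ) (h₄ : IndepFun y₃ y₄ ρ) :
    ∫ a, (k (x₁ a) (x₂ a) - k (x₃ a) (y₁ a) - k (x₄ a) (y₂ a) + k (y₃ a) (y₄ a)) ∂ρ =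
      mmdSq k Q P := by
  obtain ⟨C, hC⟩ := hk.bounded
  have hi : ∀ {u v : A → S}, Measurable u → Measurable v →
      Integrable (fun a => k (u a) (v a)) ρ := fun hu hv =>
    integrable_of_abs_le (hk.measurable.comp (hu.prodMk hv)) fun a => hC _ _
  have i1 := hi hx₁.measurable hx₂.measurable
  have i2 := hi hx₃.measurable hy₁.measurable
  have i3 := hi hx₄.measurable hy₂.measurable
  have i4 := hi hy₃.measurable hy₄.measurable
  have i5 : Integrable (fun a => k (x₁ a) (x₂ a) - k (x₃ a) (y₁ a)) ρ := i1.sub i2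
  have i6 : Integrable (fun a => k (x₁ a) (x₂ a) - k (x₃ a) (y₁ a) - k (x₄ a) (y₂ a)) ρ :=
    i5.sub i3
  rw [integral_add i6 i4, integral_sub i5 i3, integral_sub i1 i2,
    integral_kernel_of_indepFun hk.measurable hC hx₁ hx₂ h₁,
    integral_kernel_of_indepFun hk.measurable hC hy₃ hy₄ h₄]
  simp_rw [fun a => hk.symm (x₃ a) (y₁ a), fun a => hk.symm (x₄ a) (y₂ a)]
  rw [integral_kernel_of_indepFun hk.measurable hC hy₁ hx₃ h₂,
    integral_kernel_of_indepFun hk.measurable hC hy₂ hx₄ h₃, mmdSq]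
  ring

/-- Positive definiteness for families of points that need not be distinct. -/
lemma IsCharacteristicKernel.sum_nonneg (hk : IsCharacteristicKernel k) {ι : Type*} (J : Finset ι)
    (w : ι → ℝ) (x : ι → S) : 0 ≤ ∑ i ∈ J, ∑ j ∈ J, w i * w j * k (x i) (x j) := by
  classical
  -- Points that occur repeatedly are given the sum of their weights.
  have h := hk.posDef (J.image x) (fun y => ∑ i ∈ J with x i = y, w i)
  refine h.trans_eq ?_
  have e : ∀ f : S → ℝ, ∑ y ∈ J.image x, (∑ i ∈ J with x i = y, w i) * f y =
      ∑ i ∈ J, w i * f (x i) := by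
    intro f
    rw [← Finset.sum_fiberwise_of_maps_to (t := J.image x) (g := x)
      (fun i hi => Finset.mem_image_of_mem x hi)]
    refine Finset.sum_congr rfl fun y _ => ?_
    rw [Finset.sum_mul]
    exact Finset.sum_congr rfl fun i hi => by rw [(Finset.mem_filter.1 hi).2]
  simp only [mul_assoc, ← Finset.mul_sum]
  rw [e]
  refine Finset.sum_congr rfl fun i _ => ?_
  rw [e]

/-- The kernel h at (x, y), (x', y') is the bilinear form of k at the signed measures δ_x - δ_y and
δ_x' - δ_y'. The double sum is its quadratic form at the sum of these measures, with weight 1 at the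
x and -1 at the y. -/
lemma sum_hKer_nonneg (hk : IsCharacteristicKernel k) (n : ℕ) (z : ℕ → S × S) :
    0 ≤ ∑ i ∈ Finset.range n, ∑ j ∈ Finset.range n, hKer k (z i) (z j) := by
  have h := hk.sum_nonneg (Finset.range n ×ˢ (Finset.univ : Finset Bool))
    (fun p => if p.2 then 1 else -1) (fun p => if p.2 then (z p.1).1 else (z p.1).2)
  refine h.trans_eq ?_
  simp only [Finset.sum_product, Fintype.sum_bool]
  refine Finset.sum_congr rfl fun i _ => ?_
  rw [← Finset.sum_add_distrib]
  refine Finset.sum_congr rfl fun j _ => ?_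
  simp only [if_true, Bool.false_eq_true, if_false, hKer]
  rw [hk.symm (z j).1 (z i).2]
  ring

end KernelFacts

/-- A kernel that is positive semidefinite along every sample has a nonnegative mean. -/
lemma integral_nonneg_of_sum_nonneg {Ω T : Type*} [MeasurableSpace Ω] [MeasurableSpace T]
    {μ : Measure Ω} [IsProbabilityMeasure μ] {ν : Measure T} {t : ℕ → Ω → T} (h : IsIID μ ν t)
    {η : T → T → ℝ} {M : ℝ} (hη : Measurable fun z : T × T => η z.1 z.2)
    (hM : ∀ a b, |η a b| ≤ M)
    (hpos : ∀ (n : ℕ) (s : ℕ → T),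
      0 ≤ ∑ i ∈ Finset.range n, ∑ j ∈ Finset.range n, η (s i) (s j)) :
    0 ≤ ∫ z, η z.1 z.2 ∂(ν.prod ν) := by
  set θ := ∫ z, η z.1 z.2 ∂(ν.prod ν)
  have hi : ∀ n, ∀ p ∈ (Finset.range n).offDiag,
      Integrable (fun ω => η (t p.1 ω) (t p.2 ω)) μ := fun n p _ =>
    integrable_of_abs_le (hη.comp ((h.measurable p.1).prodMk (h.measurable p.2))) fun ω => hM _ _
  -- Expectation of the nonnegative double sum: the off-diagonal part has mean n(n-1)θ and the
  -- diagonal is at most nM. A negative θ would violate this for large n.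
  have hn : ∀ n : ℕ, 0 ≤ n * (((n : ℝ) - 1) * θ + M) := by
    intro n
    have h1 : 0 ≤ ∫ ω, (∑ p ∈ (Finset.range n).offDiag, η (t p.1 ω) (t p.2 ω) + n * M) ∂μ := by
      refine integral_nonneg fun ω => ?_
      refine (hpos n fun i => t i ω).trans ?_
      rw [sum_offDiag_eq n fun i j => η (t i ω) (t j ω)]
      have : (n : ℝ) * M = ∑ _i ∈ Finset.range n, M := by simp
      rw [this, ← Finset.sum_add_distrib]
      refine Finset.sum_le_sum fun i hi => ?_
      rw [← Finset.sum_erase_add _ _ hi]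
      gcongr
      exact (le_abs_self _).trans (hM _ _)
    rw [integral_add (integrable_finsetSum _ (hi n)) (integrable_const _),
      integral_finsetSum _ (hi n), Finset.sum_congr rfl fun p hp =>
        integral_comp_of_measurePreserving (h.measurePreserving_pair
          (Finset.mem_offDiag.1 hp).2.2) hη, sum_offDiag_const] at h1
    simp only [integral_const, probReal_univ, one_smul] at h1
    linarith
  by_contra hneg
  push Not at hneg
  obtain ⟨n, hn'⟩ := exists_nat_gt (M / (-θ) + 1)
  have h2 : (n : ℝ) - 1 > M / (-θ) := by linarith
  have h3 : M < ((n : ℝ) - 1) * (-θ) := by rwa [gt_iff_lt, div_lt_iff₀ (by linarith)] at h2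
  have hM0 : 0 ≤ M := (abs_nonneg _).trans (hM (t 0 (Classical.choice μ.nonempty_of_neZero)) 
    (t 0 (Classical.choice μ.nonempty_of_neZero)))
  have h4 : (0 : ℝ) < n := by
    have : 0 ≤ M / (-θ) := div_nonneg hM0 (by linarith)
    linarith
  have h5 := hn n
  have h6 : n * (((n : ℝ) - 1) * θ + M) < 0 := mul_neg_of_pos_of_neg h4 (by linarith)
  linarith

/-! ### A single regular model: means, vanishing gradient and kernel expansions. -/

section Models

variable {S : Type*} [MeasurableSpace S] {𝒰 : Type*} [MeasurableSpace 𝒰] {k : S → S → ℝ}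

lemma TwiceDifferentiableOn.mono {E : Type*} [NormedAddCommGroup E] [NormedSpace ℝ E] {f : E → ℝ}
    {s s' : Set E} (hf : TwiceDifferentiableOn f s) (h : s' ⊆ s) : TwiceDifferentiableOn f s' :=
  ⟨hf.1.mono h, hf.2.mono h⟩

lemma twiceDifferentiableOn_const {E : Type*} [NormedAddCommGroup E] [NormedSpace ℝ E] (c : ℝ)
    (s : Set E) : TwiceDifferentiableOn (fun _ => c) s := by
  refine ⟨differentiableOn_const c, ?_⟩
  have : fderiv ℝ (fun _ : E => c) = fun _ => 0 := by ext; simp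
  rw [this]
  exact differentiableOn_const _

lemma TwiceDifferentiableOn.add {E : Type*} [NormedAddCommGroup E] [NormedSpace ℝ E] {f g : E → ℝ}
    {s : Set E} (hs : IsOpen s) (hf : TwiceDifferentiableOn f s) (hg : TwiceDifferentiableOn g s) :
    TwiceDifferentiableOn (fun x => f x + g x) s := by
  refine ⟨hf.1.add hg.1, (hf.2.add hg.2).congr fun x hx => ?_⟩
  exact fderiv_fun_add (hf.1.differentiableAt (hs.mem_nhds hx))
    (hg.1.differentiableAt (hs.mem_nhds hx))

lemma TwiceDifferentiableOn.sub {E : Type*} [NormedAddCommGroup E] [NormedSpace ℝ E] {f g : E → ℝ}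
    {s : Set E} (hs : IsOpen s) (hf : TwiceDifferentiableOn f s) (hg : TwiceDifferentiableOn g s) :
    TwiceDifferentiableOn (fun x => f x - g x) s := by
  refine ⟨hf.1.sub hg.1, (hf.2.sub hg.2).congr fun x hx => ?_⟩
  exact fderiv_fun_sub (hf.1.differentiableAt (hs.mem_nhds hx))
    (hg.1.differentiableAt (hs.mem_nhds hx))

lemma measurePreserving_vec_two {T Z : Type*} [MeasurableSpace T] [MeasurableSpace Z]
    {ν : Measure T} [IsProbabilityMeasure ν] {ζ : Measure Z} {pr : T → Z}
    (h : MeasurePreserving pr ν ζ) :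
    MeasurePreserving (fun z : T × T => ![pr z.1, pr z.2]) (ν.prod ν)
      (Measure.pi fun _ : Fin 2 => ζ) := by
  have : IsProbabilityMeasure ζ := isProbabilityMeasure_of_measurePreserving h
  have hm := h.measurable
  have hmeas : Measurable fun z : T × T => ![pr z.1, pr z.2] := by
    rw [measurable_pi_iff]
    intro i
    fin_cases i
    · exact hm.comp measurable_fst
    · exact hm.comp measurable_snd
  refine ⟨hmeas, (Measure.pi_eq fun s hs => ?_).symm⟩
  rw [Measure.map_apply hmeas (MeasurableSet.univ_pi hs)]
  have : (fun z : T × T => ![pr z.1, pr z.2]) ⁻¹' Set.univ.pi s =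
      (pr ⁻¹' s 0) ×ˢ (pr ⁻¹' s 1) := by
    ext z
    simp [Set.mem_pi, Fin.forall_fin_two]
  rw [this, Measure.prod_prod, h.measure_preimage (hs _).nullMeasurableSet,
    h.measure_preimage (hs _).nullMeasurableSet, Fin.prod_univ_two]

lemma measurePreserving_vec_four {T Z : Type*} [MeasurableSpace T] [MeasurableSpace Z]
    {ν : Measure T} [IsProbabilityMeasure ν] {ζ : Measure Z} {pr : T → Z}
    (h : MeasurePreserving pr ν ζ) :
    MeasurePreserving (fun z : (T × T) × (T × T) => ![pr z.1.1, pr z.1.2, pr z.2.1, pr z.2.2])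
      ((ν.prod ν).prod (ν.prod ν)) (Measure.pi fun _ : Fin 4 => ζ) := by
  have : IsProbabilityMeasure ζ := isProbabilityMeasure_of_measurePreserving h
  have hm := h.measurable
  have hmeas : Measurable
      fun z : (T × T) × (T × T) => ![pr z.1.1, pr z.1.2, pr z.2.1, pr z.2.2] := by
    rw [measurable_pi_iff]
    intro i
    fin_cases i
    · exact hm.comp measurable_fst.fst
    · exact hm.comp measurable_fst.snd
    · exact hm.comp measurable_snd.fst
    · exact hm.comp measurable_snd.snd
  refine ⟨hmeas, (Measure.pi_eq fun s hs => ?_).symm⟩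
  rw [Measure.map_apply hmeas (MeasurableSet.univ_pi hs)]
  have : (fun z : (T × T) × (T × T) => ![pr z.1.1, pr z.1.2, pr z.2.1, pr z.2.2]) ⁻¹'
      Set.univ.pi s = ((pr ⁻¹' s 0) ×ˢ (pr ⁻¹' s 1)) ×ˢ ((pr ⁻¹' s 2) ×ˢ (pr ⁻¹' s 3)) := by
    ext z
    simp [Set.mem_pi, Fin.forall_fin_succ, and_assoc]
  rw [this, Measure.prod_prod, Measure.prod_prod, Measure.prod_prod,
    h.measure_preimage (hs _).nullMeasurableSet, h.measure_preimage (hs _).nullMeasurableSet,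
    h.measure_preimage (hs _).nullMeasurableSet, h.measure_preimage (hs _).nullMeasurableSet,
    Fin.prod_univ_four, mul_assoc, mul_assoc, mul_assoc]

variable {P : Measure S} [IsProbabilityMeasure P] {PU : Measure 𝒰} [IsProbabilityMeasure PU]

namespace RegularModel

variable {p : ℕ} {F : 𝒰 → EuclideanSpace ℝ (Fin p) → S} {Θ : Set (EuclideanSpace ℝ (Fin p))}
  {αs : EuclideanSpace ℝ (Fin p)}

lemma measurable (hF : RegularModel k P F PU Θ αs) {α : EuclideanSpace ℝ (Fin p)} (hα : α ∈ Θ) :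
    Measurable fun u => F u α :=
  hF.measurable_gen.comp (measurable_id.prodMk (measurable_const (a := (⟨α, hα⟩ : Θ))))

lemma mem (hF : RegularModel k P F PU Θ αs) : αs ∈ Θ := interior_subset hF.mem_interior

lemma integral_hModel (hF : RegularModel k P F PU Θ αs) (hk : IsCharacteristicKernel k)
    {α : EuclideanSpace ℝ (Fin p)} (hα : α ∈ Θ) :
    ∫ z, hModel k F z α ∂(Measure.pi fun _ : Fin 2 => P.prod PU) =
      mmdSq k (modelLaw F PU α) P := by
  have hFα : MeasurePreserving (fun u => F u α) PU (modelLaw F PU α) := ⟨hF.measurable hα, rfl⟩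
  have hi : iIndepFun (fun (i : Fin 2) (z : Fin 2 → S × 𝒰) => z i)
      (Measure.pi fun _ : Fin 2 => P.prod PU) :=
    iIndepFun_pi (X := fun _ => id) fun _ => aemeasurable_id
  have he : ∀ i : Fin 2, MeasurePreserving (fun z : Fin 2 → S × 𝒰 => z i)
      (Measure.pi fun _ : Fin 2 => P.prod PU) (P.prod PU) := fun i =>
    measurePreserving_eval _ i
  have hx := fun i => measurePreserving_fst.comp (he i)
  have hy := fun i => (hFα.comp measurePreserving_snd).comp (he i)
  have mx : Measurable (fun z : S × 𝒰 => z.1) := measurable_fst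
  have my : Measurable (fun z : S × 𝒰 => F z.2 α) := (hF.measurable hα).comp measurable_snd
  exact integral_eq_mmdSq hk (hx 0) (hx 1) (hx 0) (hx 1) (hy 1) (hy 0) (hy 0) (hy 1)
    ((hi.indepFun (by decide : (0 : Fin 2) ≠ 1)).comp mx mx)
    ((hi.indepFun (by decide : (1 : Fin 2) ≠ 0)).comp my mx)
    ((hi.indepFun (by decide : (0 : Fin 2) ≠ 1)).comp my mx)
    ((hi.indepFun (by decide : (0 : Fin 2) ≠ 1)).comp my my)

lemma integral_qModel (hF : RegularModel k P F PU Θ αs) (hk : IsCharacteristicKernel k)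
    {α : EuclideanSpace ℝ (Fin p)} (hα : α ∈ Θ) :
    ∫ z, qModel k F z α ∂(Measure.pi fun _ : Fin 4 => P.prod PU) =
      mmdSq k (modelLaw F PU α) P := by
  have hFα : MeasurePreserving (fun u => F u α) PU (modelLaw F PU α) := ⟨hF.measurable hα, rfl⟩
  have hi : iIndepFun (fun (i : Fin 4) (z : Fin 4 → S × 𝒰) => z i)
      (Measure.pi fun _ : Fin 4 => P.prod PU) :=
    iIndepFun_pi (X := fun _ => id) fun _ => aemeasurable_id
  have he : ∀ i : Fin 4, MeasurePreserving (fun z : Fin 4 → S × 𝒰 => z i)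
      (Measure.pi fun _ : Fin 4 => P.prod PU) (P.prod PU) := fun i =>
    measurePreserving_eval _ i
  have hx := fun i => measurePreserving_fst.comp (he i)
  have hy := fun i => (hFα.comp measurePreserving_snd).comp (he i)
  have mx : Measurable (fun z : S × 𝒰 => z.1) := measurable_fst
  have my : Measurable (fun z : S × 𝒰 => F z.2 α) := (hF.measurable hα).comp measurable_snd
  exact integral_eq_mmdSq hk (hx 0) (hx 2) (hx 3) (hx 1) (hy 1) (hy 3) (hy 0) (hy 2)
    ((hi.indepFun (by decide : (0 : Fin 4) ≠ 2)).comp mx mx)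
    ((hi.indepFun (by decide : (1 : Fin 4) ≠ 3)).comp my mx)
    ((hi.indepFun (by decide : (3 : Fin 4) ≠ 1)).comp my mx)
    ((hi.indepFun (by decide : (0 : Fin 4) ≠ 2)).comp my my)

/-- Fermat's rule at an interior minimum, together with the exchange of gradient and expectation.
This centering of the linear term makes the estimation of the parameter asymptotically negligible.
-/
lemma gradient_eq_zero (hF : RegularModel k P F PU Θ αs)
    (hmin : IsMinOn (fun α => mmdSq k (modelLaw F PU α) P) Θ αs) {Z : Type*} [MeasurableSpace Z]
    {ρ : Measure Z} {κ : Z → EuclideanSpace ℝ (Fin p) → ℝ} {δ : ℝ}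
    (h : MomentConditions ρ κ αs δ)
    (hκ : ∀ α ∈ Θ, ∫ z, κ z α ∂ρ = mmdSq k (modelLaw F PU α) P) :
    ∫ z, fderiv ℝ (κ z) αs ∂ρ = 0 := by
  refine IsLocalMin.hasFDerivAt_eq_zero ?_ h.gradient_exchange
  filter_upwards [mem_interior_iff_mem_nhds.1 hF.mem_interior] with α hα
  rw [hκ α hα, hκ αs hF.mem]
  exact hmin hα

lemma twiceDifferentiableOn_hModel (hF : RegularModel k P F PU Θ αs) (z : Fin 2 → S × 𝒰) :
    TwiceDifferentiableOn (hModel k F z) (interior Θ) := by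
  have h := (((twiceDifferentiableOn_const (k (z 0).1 (z 1).1) _).sub isOpen_interior
    (hF.twice_diff₁ (z 0).1 (z 1).2)).sub isOpen_interior (hF.twice_diff₁ (z 1).1 (z 0).2)).add
    isOpen_interior (hF.twice_diff₂ (z 0).2 (z 1).2)
  exact h

lemma exists_kernelExpansion_hModel (hF : RegularModel k P F PU Θ αs)
    (hk : IsCharacteristicKernel k)
    (hmin : IsMinOn (fun α => mmdSq k (modelLaw F PU α) P) Θ αs) {T : Type*} [MeasurableSpace T]
    {ν : Measure T} [IsProbabilityMeasure ν] {pr : T → S × 𝒰}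
    (hpr : MeasurePreserving pr ν (P.prod PU)) :
    ∃ δ > 0, KernelExpansion ν (fun α a b => hModel k F ![pr a, pr b] α) αs (Metric.ball αs δ)
      (fun α => ‖α - αs‖) := by
  obtain ⟨δ, hδ, hsub, hh, -, -⟩ := hF.moments
  obtain ⟨C, hC⟩ := hk.bounded
  have hsub' : Metric.ball αs δ ⊆ interior Θ := interior_maximal hsub Metric.isOpen_ball
  have hM : ∀ z α, |hModel k F z α| ≤ 4 * C := fun z α =>
    abs_hKer_le hC (genPoint F α (z 0)) (genPoint F α (z 1))
  have h0 := hF.gradient_eq_zero hmin hh fun α hα => hF.integral_hModel hk hα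
  have hd := fun z => (hF.twiceDifferentiableOn_hModel z).mono hsub'
  have hφ := measurePreserving_vec_two hpr
  have h := hh.kernelExpansion hδ hd hM h0 hφ
  exact ⟨δ, hδ, h⟩

lemma twiceDifferentiableOn_qModel (hF : RegularModel k P F PU Θ αs) (z : Fin 4 → S × 𝒰) :
    TwiceDifferentiableOn (qModel k F z) (interior Θ) := by
  have h := (((twiceDifferentiableOn_const (k (z 0).1 (z 2).1) _).sub isOpen_interior
    (hF.twice_diff₁ (z 3).1 (z 1).2)).sub isOpen_interior (hF.twice_diff₁ (z 1).1 (z 3).2)).add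
    isOpen_interior (hF.twice_diff₂ (z 0).2 (z 2).2)
  exact h

lemma exists_kernelExpansion_qModel (hF : RegularModel k P F PU Θ αs)
    (hk : IsCharacteristicKernel k)
    (hmin : IsMinOn (fun α => mmdSq k (modelLaw F PU α) P) Θ αs) {T : Type*} [MeasurableSpace T]
    {ν : Measure T} [IsProbabilityMeasure ν] {pr : T → S × 𝒰}
    (hpr : MeasurePreserving pr ν (P.prod PU)) :
    ∃ δ > 0, KernelExpansion (ν.prod ν)
      (fun α a b => qModel k F ![pr a.1, pr a.2, pr b.1, pr b.2] α) αs (Metric.ball αs δ)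
      (fun α => ‖α - αs‖) := by
  obtain ⟨δ, hδ, hsub, -, hq, -⟩ := hF.moments
  obtain ⟨C, hC⟩ := hk.bounded
  have hsub' : Metric.ball αs δ ⊆ interior Θ := interior_maximal hsub Metric.isOpen_ball
  have hM : ∀ z α, |qModel k F z α| ≤ 4 * C := fun z α =>
    abs_qKer_le hC (genPoint F α (z 0), genPoint F α (z 1))
    (genPoint F α (z 2), genPoint F α (z 3))
  have h0 := hF.gradient_eq_zero hmin hq fun α hα => hF.integral_qModel hk hα
  have hd := fun z => (hF.twiceDifferentiableOn_qModel z).mono hsub'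
  have hφ := measurePreserving_vec_four hpr
  have h := hq.kernelExpansion hδ hd hM h0 hφ
  exact ⟨δ, hδ, h⟩

end RegularModel

end Models

/-! ### The comparison kernels of two models with a common sample. -/

section Comparison

variable {S 𝒰 𝒱 Ω : Type*} [MeasurableSpace S] [MeasurableSpace 𝒰] [MeasurableSpace 𝒱]
  [MeasurableSpace Ω]

/-- An observation together with the draws from the two models. -/
def cmpPoint {E₁ E₂ : Type*} (F : 𝒰 → E₁ → S) (G : 𝒱 → E₂ → S) (γ : E₁ × E₂) (a : S × 𝒰 × 𝒱) :
    S × S × S := (a.1, F a.2.1 γ.1, G a.2.2 γ.2)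

/-- The comparison kernel `h` in terms of the sample `(x, u, v)`. -/
def cmpKerH {E₁ E₂ : Type*} (k : S → S → ℝ) (F : 𝒰 → E₁ → S) (G : 𝒱 → E₂ → S) (γ : E₁ × E₂)
    (a b : S × 𝒰 × 𝒱) : ℝ := hCmp k (cmpPoint F G γ a) (cmpPoint F G γ b)

/-- The comparison kernel `q` in terms of pairs from the sample `(x, u, v)`. -/
def cmpKerQ {E₁ E₂ : Type*} (k : S → S → ℝ) (F : 𝒰 → E₁ → S) (G : 𝒱 → E₂ → S) (γ : E₁ × E₂)
    (a b : (S × 𝒰 × 𝒱) × (S × 𝒰 × 𝒱)) : ℝ :=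
  qCmp k (cmpPoint F G γ a.1, cmpPoint F G γ a.2) (cmpPoint F G γ b.1, cmpPoint F G γ b.2)

/-- The sample of triples. -/
def triple (X : ℕ → Ω → S) (U : ℕ → Ω → 𝒰) (V : ℕ → Ω → 𝒱) (i : ℕ) (ω : Ω) : S × 𝒰 × 𝒱 :=
  (X i ω, U i ω, V i ω)

/-- Two regular models with minimizing parameters, and a sample. -/
structure ComparisonData {p₁ p₂ : ℕ} (μ : Measure Ω) (P : Measure S) (PU : Measure 𝒰)
    (PV : Measure 𝒱) (k : S → S → ℝ)
    (Θ₁ : Set (EuclideanSpace ℝ (Fin p₁))) (Θ₂ : Set (EuclideanSpace ℝ (Fin p₂)))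
    (F : 𝒰 → EuclideanSpace ℝ (Fin p₁) → S) (G : 𝒱 → EuclideanSpace ℝ (Fin p₂) → S)
    (αs : EuclideanSpace ℝ (Fin p₁)) (βs : EuclideanSpace ℝ (Fin p₂))
    (X : ℕ → Ω → S) (U : ℕ → Ω → 𝒰) (V : ℕ → Ω → 𝒱) : Prop where
  kernel : IsCharacteristicKernel k
  model₁ : RegularModel k P F PU Θ₁ αs
  model₂ : RegularModel k P G PV Θ₂ βs
  isMinOn₁ : IsMinOn (fun α => mmdSq k (modelLaw F PU α) P) Θ₁ αs
  isMinOn₂ : IsMinOn (fun β => mmdSq k (modelLaw G PV β) P) Θ₂ βs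
  sample : IsSample μ P PU PV X U V

variable {p₁ p₂ : ℕ} {μ : Measure Ω} [IsProbabilityMeasure μ] {P : Measure S}
  [IsProbabilityMeasure P] {PU : Measure 𝒰} [IsProbabilityMeasure PU]
  {PV : Measure 𝒱} [IsProbabilityMeasure PV] {k : S → S → ℝ}
  {Θ₁ : Set (EuclideanSpace ℝ (Fin p₁))} {Θ₂ : Set (EuclideanSpace ℝ (Fin p₂))}
  {F : 𝒰 → EuclideanSpace ℝ (Fin p₁) → S} {G : 𝒱 → EuclideanSpace ℝ (Fin p₂) → S}
  {αs : EuclideanSpace ℝ (Fin p₁)} {βs : EuclideanSpace ℝ (Fin p₂)}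
  {X : ℕ → Ω → S} {U : ℕ → Ω → 𝒰} {V : ℕ → Ω → 𝒱}

/-- The rate √n implies consistency, so the estimator is eventually in the ball on which the
expansion holds. -/
lemma tendsto_whp_of_boundedInProb {p : ℕ} {γn : ℕ → Ω → EuclideanSpace ℝ (Fin p)}
    {γs : EuclideanSpace ℝ (Fin p)}
    (h : BoundedInProb μ (fun m ω => √((2 * m : ℕ) : ℝ) • (γn m ω - γs))) {δ : ℝ} (hδ : 0 < δ) :
    ∀ᶠ x in whp μ, γn x.1 x.2 ∈ Metric.ball γs δ := by
  have hN : Tendsto (fun m : ℕ => 2 * m) atTop atTop :=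
    tendsto_id.const_mul_atTop' (by norm_num)
  have h1 := h.stochBdd _ (tendsto_inv_sqrt_natCast hN)
  filter_upwards [h1.eventually_lt_const hδ, eventually_le_of_tendsto hN 1] with x hx hx1
  have hx' : (0 : ℝ) < ((2 * x.1 : ℕ) : ℝ) := by exact_mod_cast hx1
  rw [norm_smul, Real.norm_of_nonneg (Real.sqrt_nonneg _),
    inv_mul_cancel_left₀ (Real.sqrt_pos.2 hx').ne'] at hx
  rwa [Metric.mem_ball, dist_eq_norm]

lemma stochBdd_sqrt_mul_norm {p : ℕ} {γn : ℕ → Ω → EuclideanSpace ℝ (Fin p)}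
    {γs : EuclideanSpace ℝ (Fin p)}
    (h : BoundedInProb μ (fun m ω => √((2 * m : ℕ) : ℝ) • (γn m ω - γs))) :
    StochBdd μ (fun x => √((2 * x.1 : ℕ) : ℝ) * ‖γn x.1 x.2 - γs‖) := by
  refine h.stochBdd.congr (Eventually.of_forall fun x => ?_)
  rw [norm_smul, Real.norm_of_nonneg (Real.sqrt_nonneg _)]

namespace ComparisonData

lemma isIID (D : ComparisonData μ P PU PV k Θ₁ Θ₂ F G αs βs X U V) :
    IsIID μ (μ.map (triple X U V 0)) (triple X U V) where
  measurable i := (D.sample.measurable_X i).prodMk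
    ((D.sample.measurable_U i).prodMk (D.sample.measurable_V i))
  law i := (D.sample.ident i).map_eq
  indep := D.sample.iIndep

lemma measurePreserving_X (D : ComparisonData μ P PU PV k Θ₁ Θ₂ F G αs βs X U V) (i : ℕ) :
    MeasurePreserving (X i) μ P := ⟨D.sample.measurable_X i, D.sample.law_X i⟩

lemma measurePreserving_U (D : ComparisonData μ P PU PV k Θ₁ Θ₂ F G αs βs X U V) (i : ℕ) :
    MeasurePreserving (U i) μ PU := ⟨D.sample.measurable_U i, D.sample.law_U i⟩

lemma measurePreserving_V (D : ComparisonData μ P PU PV k Θ₁ Θ₂ F G αs βs X U V) (i : ℕ) :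
    MeasurePreserving (V i) μ PV := ⟨D.sample.measurable_V i, D.sample.law_V i⟩

lemma indepFun_XU (D : ComparisonData μ P PU PV k Θ₁ Θ₂ F G αs βs X U V) (i : ℕ) :
    IndepFun (X i) (U i) μ :=
  D.sample.indep_XU.comp (measurable_pi_apply i) (measurable_pi_apply i)

lemma indepFun_XV (D : ComparisonData μ P PU PV k Θ₁ Θ₂ F G αs βs X U V) (i : ℕ) :
    IndepFun (X i) (V i) μ :=
  D.sample.indep_XV.comp (measurable_pi_apply i) (measurable_pi_apply i)

lemma indepFun_UV (D : ComparisonData μ P PU PV k Θ₁ Θ₂ F G αs βs X U V) (i : ℕ) :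
    IndepFun (U i) (V i) μ :=
  D.sample.indep_UV.comp (measurable_pi_apply i) (measurable_pi_apply i)

lemma measurePreserving_of_comp {A : Type*} [MeasurableSpace A] {ρ : Measure A}
    (D : ComparisonData μ P PU PV k Θ₁ Θ₂ F G αs βs X U V) {f : S × 𝒰 × 𝒱 → A} (hf : Measurable f)
    (h : MeasurePreserving (fun ω => f (triple X U V 0 ω)) μ ρ) :
    MeasurePreserving f (μ.map (triple X U V 0)) ρ := by
  refine ⟨hf, ?_⟩
  rw [Measure.map_map hf (D.isIID.measurable 0)]
  exact h.map_eq

lemma measurePreserving_proj₁ (D : ComparisonData μ P PU PV k Θ₁ Θ₂ F G αs βs X U V) :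
    MeasurePreserving (fun a : S × 𝒰 × 𝒱 => (a.1, a.2.1)) (μ.map (triple X U V 0))
      (P.prod PU) :=
  D.measurePreserving_of_comp (by fun_prop)
    (measurePreserving_prodMk (D.measurePreserving_X 0) (D.measurePreserving_U 0)
      (D.indepFun_XU 0))

lemma measurePreserving_proj₂ (D : ComparisonData μ P PU PV k Θ₁ Θ₂ F G αs βs X U V) :
    MeasurePreserving (fun a : S × 𝒰 × 𝒱 => (a.1, a.2.2)) (μ.map (triple X U V 0))
      (P.prod PV) :=
  D.measurePreserving_of_comp (by fun_prop)
    (measurePreserving_prodMk (D.measurePreserving_X 0) (D.measurePreserving_V 0)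
      (D.indepFun_XV 0))

lemma measurable_cmpPoint (D : ComparisonData μ P PU PV k Θ₁ Θ₂ F G αs βs X U V) :
    Measurable (cmpPoint F G (αs, βs) : S × 𝒰 × 𝒱 → S × S × S) :=
  measurable_fst.prodMk (((D.model₁.measurable D.model₁.mem).comp measurable_snd.fst).prodMk
    ((D.model₂.measurable D.model₂.mem).comp measurable_snd.snd))

lemma measurable_cmpKerH (D : ComparisonData μ P PU PV k Θ₁ Θ₂ F G αs βs X U V) :
    Measurable fun z : (S × 𝒰 × 𝒱) × (S × 𝒰 × 𝒱) => cmpKerH k F G (αs, βs) z.1 z.2 :=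
  measurable_hCmp D.kernel.measurable (D.measurable_cmpPoint.comp measurable_fst)
    (D.measurable_cmpPoint.comp measurable_snd)

lemma measurable_cmpKerQ (D : ComparisonData μ P PU PV k Θ₁ Θ₂ F G αs βs X U V) :
    Measurable fun z : ((S × 𝒰 × 𝒱) × (S × 𝒰 × 𝒱)) × ((S × 𝒰 × 𝒱) × (S × 𝒰 × 𝒱)) =>
      cmpKerQ k F G (αs, βs) z.1 z.2 :=
  measurable_qCmp D.kernel.measurable
    ((D.measurable_cmpPoint.comp measurable_fst.fst).prodMk
      (D.measurable_cmpPoint.comp measurable_fst.snd))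
    ((D.measurable_cmpPoint.comp measurable_snd.fst).prodMk
      (D.measurable_cmpPoint.comp measurable_snd.snd))

variable {αn : ℕ → Ω → EuclideanSpace ℝ (Fin p₁)} {βn : ℕ → Ω → EuclideanSpace ℝ (Fin p₂)} {C : ℝ}

lemma exists_kernelExpansion_cmpKerH (D : ComparisonData μ P PU PV k Θ₁ Θ₂ F G αs βs X U V) :
    ∃ δ₁ > 0, ∃ δ₂ > 0, KernelExpansion (μ.map (triple X U V 0)) (cmpKerH k F G)
      (αs, βs) (Metric.ball αs δ₁ ×ˢ Metric.ball βs δ₂) (fun γ => ‖γ.1 - αs‖ + ‖γ.2 - βs‖) := by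
  have := D.isIID.isProbabilityMeasure
  obtain ⟨δ₁, hδ₁, h₁⟩ := D.model₁.exists_kernelExpansion_hModel D.kernel D.isMinOn₁
    D.measurePreserving_proj₁
  obtain ⟨δ₂, hδ₂, h₂⟩ := D.model₂.exists_kernelExpansion_hModel D.kernel D.isMinOn₂
    D.measurePreserving_proj₂
  have h := h₁.sub (fun _ => norm_nonneg _) (fun _ => norm_nonneg _) h₂
  exact ⟨δ₁, hδ₁, δ₂, hδ₂, h⟩

lemma estimatedKernelH (D : ComparisonData μ P PU PV k Θ₁ Θ₂ F G αs βs X U V)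
    (hαn : BoundedInProb μ (fun m ω => √((2 * m : ℕ) : ℝ) • (αn m ω - αs)))
    (hβn : BoundedInProb μ (fun m ω => √((2 * m : ℕ) : ℝ) • (βn m ω - βs)))
    (hC : ∀ x y, |k x y| ≤ C) :
    EstimatedKernel μ (μ.map (triple X U V 0)) (triple X U V) (fun m => 2 * m) (cmpKerH k F G)
      (αs, βs) (fun m ω => (αn m ω, βn m ω)) (8 * C) where
  iid := D.isIID
  tendsto_size := tendsto_id.const_mul_atTop' (by norm_num)
  measurable := D.measurable_cmpKerH
  symm a b := hCmp_comm D.kernel.symm (cmpPoint F G (αs, βs) a) (cmpPoint F G (αs, βs) b)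
  bound γ a b := abs_hCmp_le hC (cmpPoint F G γ a) (cmpPoint F G γ b)
  expansion := by
    have := D.isIID.isProbabilityMeasure
    obtain ⟨δ₁, hδ₁, δ₂, hδ₂, h⟩ := D.exists_kernelExpansion_cmpKerH
    refine ⟨_, _, h, ?_, ?_⟩
    · filter_upwards [tendsto_whp_of_boundedInProb hαn hδ₁,
        tendsto_whp_of_boundedInProb hβn hδ₂] with x hx hx'
      exact ⟨hx, hx'⟩
    · refine ((stochBdd_sqrt_mul_norm hαn).add (stochBdd_sqrt_mul_norm hβn)).congr
        (Eventually.of_forall fun x => ?_)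
      simp only [mul_add]

lemma exists_kernelExpansion_cmpKerQ (D : ComparisonData μ P PU PV k Θ₁ Θ₂ F G αs βs X U V) :
    ∃ δ₁ > 0, ∃ δ₂ > 0, KernelExpansion ((μ.map (triple X U V 0)).prod (μ.map (triple X U V 0))) (cmpKerQ k F G)
      (αs, βs) (Metric.ball αs δ₁ ×ˢ Metric.ball βs δ₂) (fun γ => ‖γ.1 - αs‖ + ‖γ.2 - βs‖) := by
  have := D.isIID.isProbabilityMeasure
  obtain ⟨δ₁, hδ₁, h₁⟩ := D.model₁.exists_kernelExpansion_qModel D.kernel D.isMinOn₁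
    D.measurePreserving_proj₁
  obtain ⟨δ₂, hδ₂, h₂⟩ := D.model₂.exists_kernelExpansion_qModel D.kernel D.isMinOn₂
    D.measurePreserving_proj₂
  have h := h₁.sub (fun _ => norm_nonneg _) (fun _ => norm_nonneg _) h₂
  exact ⟨δ₁, hδ₁, δ₂, hδ₂, h⟩

lemma estimatedKernelQ (D : ComparisonData μ P PU PV k Θ₁ Θ₂ F G αs βs X U V)
    (hαn : BoundedInProb μ (fun m ω => √((2 * m : ℕ) : ℝ) • (αn m ω - αs)))
    (hβn : BoundedInProb μ (fun m ω => √((2 * m : ℕ) : ℝ) • (βn m ω - βs)))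
    (hC : ∀ x y, |k x y| ≤ C) :
    EstimatedKernel μ ((μ.map (triple X U V 0)).prod (μ.map (triple X U V 0)))
      (fun i ω => pairs (fun j => triple X U V j ω) i) (fun m => m) (cmpKerQ k F G)
      (αs, βs) (fun m ω => (αn m ω, βn m ω)) (8 * C) where
  iid := D.isIID.pairs
  tendsto_size := tendsto_id
  measurable := D.measurable_cmpKerQ
  symm a b := qCmp_comm D.kernel.symm
    (cmpPoint F G (αs, βs) a.1, cmpPoint F G (αs, βs) a.2)
    (cmpPoint F G (αs, βs) b.1, cmpPoint F G (αs, βs) b.2)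
  bound γ a b := abs_qCmp_le hC (cmpPoint F G γ a.1, cmpPoint F G γ a.2)
    (cmpPoint F G γ b.1, cmpPoint F G γ b.2)
  expansion := by
    have := D.isIID.isProbabilityMeasure
    obtain ⟨δ₁, hδ₁, δ₂, hδ₂, h⟩ := D.exists_kernelExpansion_cmpKerQ
    refine ⟨_, _, h, ?_, ?_⟩
    · filter_upwards [tendsto_whp_of_boundedInProb hαn hδ₁,
        tendsto_whp_of_boundedInProb hβn hδ₂] with x hx hx'
      exact ⟨hx, hx'⟩
    -- The statistic Q is based on m pairs while the rate of the estimators refers to n = 2m; √m ≤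
    -- √(2m) suffices.
    · refine ((stochBdd_sqrt_mul_norm hαn).add (stochBdd_sqrt_mul_norm hβn)).mono
        (Eventually.of_forall fun x => ?_)
      rw [← mul_add, abs_mul, abs_mul, abs_of_nonneg (Real.sqrt_nonneg _),
        abs_of_nonneg (Real.sqrt_nonneg _)]
      refine mul_le_mul_of_nonneg_right (Real.sqrt_le_sqrt ?_) (abs_nonneg _)
      exact_mod_cast (by omega : x.1 ≤ 2 * x.1)

/-- Each model enters through its own marginal law, that of (X, U) or of (X, V), which is a product
by pairwise independence. Joint independence of the three components is not required. -/
lemma integral_projKer_cmpKerH (D : ComparisonData μ P PU PV k Θ₁ Θ₂ F G αs βs X U V) :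
    ∫ a, projKer (μ.map (triple X U V 0)) (cmpKerH k F G (αs, βs)) a ∂(μ.map (triple X U V 0)) =
      mmdSq k (modelLaw F PU αs) P - mmdSq k (modelLaw G PV βs) P := by
  have := D.isIID.isProbabilityMeasure
  obtain ⟨C, hC⟩ := D.kernel.bounded
  have hF := D.model₁.measurable D.model₁.mem
  have hG := D.model₂.measurable D.model₂.mem
  have mF : Measurable fun z : Fin 2 → S × 𝒰 => hModel k F z αs :=
    measurable_hKer D.kernel.measurable
      ((measurable_pi_apply 0).fst.prodMk (hF.comp (measurable_pi_apply 0).snd))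
      ((measurable_pi_apply 1).fst.prodMk (hF.comp (measurable_pi_apply 1).snd))
  have mG : Measurable fun z : Fin 2 → S × 𝒱 => hModel k G z βs :=
    measurable_hKer D.kernel.measurable
      ((measurable_pi_apply 0).fst.prodMk (hG.comp (measurable_pi_apply 0).snd))
      ((measurable_pi_apply 1).fst.prodMk (hG.comp (measurable_pi_apply 1).snd))
  have h₁ := integral_comp_of_measurePreserving
    (measurePreserving_vec_two D.measurePreserving_proj₁) mF
  have h₂ := integral_comp_of_measurePreserving
    (measurePreserving_vec_two D.measurePreserving_proj₂) mG
  rw [D.model₁.integral_hModel D.kernel D.model₁.mem] at h₁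
  rw [D.model₂.integral_hModel D.kernel D.model₂.mem] at h₂
  rw [← h₁, ← h₂, ← integral_sub]
  · exact (integral_prod _ (integrable_of_abs_le D.measurable_cmpKerH
      fun z => abs_hCmp_le hC _ _)).symm
  · exact integrable_of_abs_le (mF.comp
      (measurePreserving_vec_two D.measurePreserving_proj₁).measurable)
      fun z => abs_hKer_le hC _ _
  · exact integrable_of_abs_le (mG.comp
      (measurePreserving_vec_two D.measurePreserving_proj₂).measurable)
      fun z => abs_hKer_le hC _ _

lemma integral_projKer_cmpKerQ (D : ComparisonData μ P PU PV k Θ₁ Θ₂ F G αs βs X U V) :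
    ∫ a, projKer ((μ.map (triple X U V 0)).prod (μ.map (triple X U V 0)))
      (cmpKerQ k F G (αs, βs)) a ∂((μ.map (triple X U V 0)).prod (μ.map (triple X U V 0))) =
      mmdSq k (modelLaw F PU αs) P - mmdSq k (modelLaw G PV βs) P := by
  have := D.isIID.isProbabilityMeasure
  obtain ⟨C, hC⟩ := D.kernel.bounded
  have hF := D.model₁.measurable D.model₁.mem
  have hG := D.model₂.measurable D.model₂.mem
  have pF : ∀ i, Measurable fun z : Fin 4 → S × 𝒰 => genPoint F αs (z i) := fun i =>
    (measurable_pi_apply i).fst.prodMk (hF.comp (measurable_pi_apply i).snd)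
  have pG : ∀ i, Measurable fun z : Fin 4 → S × 𝒱 => genPoint G βs (z i) := fun i =>
    (measurable_pi_apply i).fst.prodMk (hG.comp (measurable_pi_apply i).snd)
  have mF : Measurable fun z : Fin 4 → S × 𝒰 => qModel k F z αs :=
    measurable_qKer D.kernel.measurable ((pF 0).prodMk (pF 1)) ((pF 2).prodMk (pF 3))
  have mG : Measurable fun z : Fin 4 → S × 𝒱 => qModel k G z βs :=
    measurable_qKer D.kernel.measurable ((pG 0).prodMk (pG 1)) ((pG 2).prodMk (pG 3))
  have h₁ := integral_comp_of_measurePreserving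
    (measurePreserving_vec_four D.measurePreserving_proj₁) mF
  have h₂ := integral_comp_of_measurePreserving
    (measurePreserving_vec_four D.measurePreserving_proj₂) mG
  rw [D.model₁.integral_qModel D.kernel D.model₁.mem] at h₁
  rw [D.model₂.integral_qModel D.kernel D.model₂.mem] at h₂
  rw [← h₁, ← h₂, ← integral_sub]
  · exact (integral_prod _ (integrable_of_abs_le D.measurable_cmpKerQ
      fun z => abs_qCmp_le hC _ _)).symm
  · exact integrable_of_abs_le (mF.comp
      (measurePreserving_vec_four D.measurePreserving_proj₁).measurable)
      fun z => abs_qKer_le hC _ _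
  · exact integrable_of_abs_le (mG.comp
      (measurePreserving_vec_four D.measurePreserving_proj₂).measurable)
      fun z => abs_qKer_le hC _ _

/-- This makes comparing `mmd`, a square root, equivalent to comparing `mmdSq`. It follows by
averaging the positive semidefinite kernel h over the sample. -/
lemma mmdSq_nonneg (D : ComparisonData μ P PU PV k Θ₁ Θ₂ F G αs βs X U V) :
    0 ≤ mmdSq k (modelLaw F PU αs) P ∧ 0 ≤ mmdSq k (modelLaw G PV βs) P := by
  have := D.isIID.isProbabilityMeasure
  obtain ⟨C, hC⟩ := D.kernel.bounded
  have hF := D.model₁.measurable D.model₁.mem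
  have hG := D.model₂.measurable D.model₂.mem
  have pF : Measurable fun a : S × 𝒰 × 𝒱 => (a.1, F a.2.1 αs) :=
    measurable_fst.prodMk (hF.comp measurable_snd.fst)
  have pG : Measurable fun a : S × 𝒰 × 𝒱 => (a.1, G a.2.2 βs) :=
    measurable_fst.prodMk (hG.comp measurable_snd.snd)
  have mF : Measurable fun z : Fin 2 → S × 𝒰 => hModel k F z αs :=
    measurable_hKer D.kernel.measurable
      ((measurable_pi_apply 0).fst.prodMk (hF.comp (measurable_pi_apply 0).snd))
      ((measurable_pi_apply 1).fst.prodMk (hF.comp (measurable_pi_apply 1).snd))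
  have mG : Measurable fun z : Fin 2 → S × 𝒱 => hModel k G z βs :=
    measurable_hKer D.kernel.measurable
      ((measurable_pi_apply 0).fst.prodMk (hG.comp (measurable_pi_apply 0).snd))
      ((measurable_pi_apply 1).fst.prodMk (hG.comp (measurable_pi_apply 1).snd))
  constructor
  · rw [← D.model₁.integral_hModel D.kernel D.model₁.mem, ← integral_comp_of_measurePreserving
      (measurePreserving_vec_two D.measurePreserving_proj₁) mF]
    exact integral_nonneg_of_sum_nonneg D.isIID
      (η := fun a b => hKer k (a.1, F a.2.1 αs) (b.1, F b.2.1 αs))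
      (measurable_hKer D.kernel.measurable (pF.comp measurable_fst) (pF.comp measurable_snd))
      (fun a b => abs_hKer_le hC _ _)
      (fun n s => sum_hKer_nonneg D.kernel n fun i => ((s i).1, F (s i).2.1 αs))
  · rw [← D.model₂.integral_hModel D.kernel D.model₂.mem, ← integral_comp_of_measurePreserving
      (measurePreserving_vec_two D.measurePreserving_proj₂) mG]
    exact integral_nonneg_of_sum_nonneg D.isIID
      (η := fun a b => hKer k (a.1, G a.2.2 βs) (b.1, G b.2.2 βs))
      (measurable_hKer D.kernel.measurable (pG.comp measurable_fst) (pG.comp measurable_snd))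
      (fun a b => abs_hKer_le hC _ _)
      (fun n s => sum_hKer_nonneg D.kernel n fun i => ((s i).1, G (s i).2.2 βs))

end ComparisonData

end Comparison

/-! ### Almost surely constant functions and sums. -/

section AEConst

variable {Ω : Type*} [MeasurableSpace Ω] {μ : Measure Ω} [IsProbabilityMeasure μ]

lemma aeConst_of_comp {T : Type*} [MeasurableSpace T] {ρ : Measure T} {u : Ω → T}
    (hu : MeasurePreserving u μ ρ) {f : T → ℝ} (hf : Measurable f)
    (h : AEConst μ fun ω => f (u ω)) : AEConst ρ f := by
  obtain ⟨c, hc⟩ := h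
  refine ⟨c, ?_⟩
  rw [← hu.map_eq, ae_map_iff hu.measurable.aemeasurable (measurableSet_eq_fun hf measurable_const)]
  exact hc

lemma AEConst.neg {T : Type*} [MeasurableSpace T] {ρ : Measure T} {f : T → ℝ}
    (h : AEConst ρ fun t => - f t) : AEConst ρ f := by
  obtain ⟨c, hc⟩ := h
  exact ⟨-c, hc.mono fun t ht => by linarith⟩

/-- The variances of independent summands add up, so zero variance of the sum forces zero variance
of each. -/
lemma aeConst_of_add {Y₁ Y₂ : Ω → ℝ} (h₁ : MemLp Y₁ 2 μ) (h₂ : MemLp Y₂ 2 μ)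
    (hi : IndepFun Y₁ Y₂ μ) (hc : AEConst μ fun ω => Y₁ ω + Y₂ ω) :
    AEConst μ Y₁ ∧ AEConst μ Y₂ := by
  obtain ⟨c, hc⟩ := hc
  have h := ae_const_of_sum_ae_const (s := Finset.univ) (Y := ![Y₁, Y₂]) (c := c) (μ := μ)
    (by intro i _; fin_cases i; exacts [h₁, h₂])
    (by
      intro i _ j _ hij
      fin_cases i <;> fin_cases j
      exacts [absurd rfl hij, hi, hi.symm, absurd rfl hij])
    (by simpa [Fin.sum_univ_two] using hc)
  exact ⟨⟨_, h 0 (Finset.mem_univ _)⟩, ⟨_, h 1 (Finset.mem_univ _)⟩⟩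

lemma aeConst_of_add_add {Y₁ Y₂ Y₃ : Ω → ℝ} (h₁ : MemLp Y₁ 2 μ) (h₂ : MemLp Y₂ 2 μ)
    (h₃ : MemLp Y₃ 2 μ) (h₁₂ : IndepFun Y₁ Y₂ μ) (h₁₃ : IndepFun Y₁ Y₃ μ) (h₂₃ : IndepFun Y₂ Y₃ μ)
    (hc : AEConst μ fun ω => Y₁ ω + Y₂ ω + Y₃ ω) :
    AEConst μ Y₁ ∧ AEConst μ Y₂ ∧ AEConst μ Y₃ := by
  obtain ⟨c, hc⟩ := hc
  have h := ae_const_of_sum_ae_const (s := Finset.univ) (Y := ![Y₁, Y₂, Y₃]) (c := c) (μ := μ)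
    (by intro i _; fin_cases i; exacts [h₁, h₂, h₃])
    (by
      intro i _ j _ hij
      fin_cases i <;> fin_cases j
      exacts [absurd rfl hij, h₁₂, h₁₃, h₁₂.symm, absurd rfl hij, h₂₃, h₁₃.symm, h₂₃.symm,
        absurd rfl hij])
    (by simpa [Fin.sum_univ_three] using hc)
  exact ⟨⟨_, h 0 (Finset.mem_univ _)⟩, ⟨_, h 1 (Finset.mem_univ _)⟩, ⟨_, h 2 (Finset.mem_univ _)⟩⟩

lemma integral_sq_sub_sq_integral_eq_variance {f : Ω → ℝ} (hf : MemLp f 2 μ) :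
    ∫ ω, f ω ^ 2 ∂μ - (∫ ω, f ω ∂μ) ^ 2 = Var[f; μ] := by
  rw [variance_eq_sub hf]
  rfl

/-- Meant for the six terms of the comparison kernel q. The right-hand side groups those that depend
on the first member of the fixed pair, then those that depend on the second. -/
lemma integral_alternating_sum {T : Type*} [MeasurableSpace T] {ρ : Measure T}
    {f₁ f₂ f₃ f₄ f₅ f₆ : T → ℝ} (h₁ : Integrable f₁ ρ) (h₂ : Integrable f₂ ρ)
    (h₃ : Integrable f₃ ρ) (h₄ : Integrable f₄ ρ) (h₅ : Integrable f₅ ρ) (h₆ : Integrable f₆ ρ) :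
    ∫ t, (f₁ t - f₂ t - f₃ t + f₄ t - (f₅ t - f₆ t)) ∂ρ =
      ((∫ t, f₁ t ∂ρ) + - ∫ t, f₂ t ∂ρ) +
      (- (∫ t, f₃ t ∂ρ) + (∫ t, f₄ t ∂ρ) + - ((∫ t, f₅ t ∂ρ) - ∫ t, f₆ t ∂ρ)) := by
  have h12 : Integrable (fun t => f₁ t - f₂ t) ρ := h₁.sub h₂
  have h13 : Integrable (fun t => f₁ t - f₂ t - f₃ t) ρ := h12.sub h₃
  have h14 : Integrable (fun t => f₁ t - f₂ t - f₃ t + f₄ t) ρ := h13.add h₄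
  have h56 : Integrable (fun t => f₅ t - f₆ t) ρ := h₅.sub h₆
  rw [integral_sub h14 h56, integral_add h13 h₄, integral_sub h12 h₃, integral_sub h₁ h₂,
    integral_sub h₅ h₆]
  ring

end AEConst

/-! ### Positivity of the asymptotic variance for the kernel q. -/

section Nondegeneracy

variable {S 𝒰 𝒱 Ω : Type*} [MeasurableSpace S] [MeasurableSpace 𝒰] [MeasurableSpace 𝒱]
  [MeasurableSpace Ω]
  {p₁ p₂ : ℕ} {μ : Measure Ω} [IsProbabilityMeasure μ] {P : Measure S}
  [IsProbabilityMeasure P] {PU : Measure 𝒰} [IsProbabilityMeasure PU]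
  {PV : Measure 𝒱} [IsProbabilityMeasure PV] {k : S → S → ℝ}
  {Θ₁ : Set (EuclideanSpace ℝ (Fin p₁))} {Θ₂ : Set (EuclideanSpace ℝ (Fin p₂))}
  {F : 𝒰 → EuclideanSpace ℝ (Fin p₁) → S} {G : 𝒱 → EuclideanSpace ℝ (Fin p₂) → S}
  {αs : EuclideanSpace ℝ (Fin p₁)} {βs : EuclideanSpace ℝ (Fin p₂)}
  {X : ℕ → Ω → S} {U : ℕ → Ω → 𝒰} {V : ℕ → Ω → 𝒱}

lemma measurable_integral_kernel (hk : Measurable fun z : S × S => k z.1 z.2)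
    {A B : Type*} [MeasurableSpace A] [MeasurableSpace B] {ρ : Measure B} [SFinite ρ] {f : A → S}
    {g : B → S} (hf : Measurable f) (hg : Measurable g) :
    Measurable fun a => ∫ b, k (f a) (g b) ∂ρ := by
  have h : StronglyMeasurable (Function.uncurry fun a b => k (f a) (g b)) :=
    (hk.comp ((hf.comp measurable_fst).prodMk (hg.comp measurable_snd))).stronglyMeasurable
  exact (h.integral_prod_right (ν := ρ)).measurable

lemma measurable_kernel_left (hk : Measurable fun z : S × S => k z.1 z.2) (s : S)
    {A : Type*} [MeasurableSpace A] {f : A → S} (hf : Measurable f) :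
    Measurable fun a => k s (f a) :=
  hk.comp (measurable_const.prodMk hf)

lemma memLp_comp_of_abs_le {A : Type*} [MeasurableSpace A] {g : A → ℝ} {u : Ω → A} {M : ℝ}
    (hg : Measurable g) (hu : Measurable u) (hM : ∀ a, |g a| ≤ M) :
    MemLp (fun ω => g (u ω)) 2 μ :=
  MemLp.of_bound (hg.comp hu).aestronglyMeasurable M (ae_of_all _ fun ω => hM (u ω))

namespace ComparisonData

/-- The projection of the comparison kernel `q` is a sum of functions of the two members of a
pair. -/
lemma projKer_cmpKerQ (D : ComparisonData μ P PU PV k Θ₁ Θ₂ F G αs βs X U V)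
    (a : (S × 𝒰 × 𝒱) × (S × 𝒰 × 𝒱)) :
    projKer ((μ.map (triple X U V 0)).prod (μ.map (triple X U V 0))) (cmpKerQ k F G (αs, βs)) a =
      (∫ u, k (F a.1.2.1 αs) (F u αs) ∂PU + - ∫ v, k (G a.1.2.2 βs) (G v βs) ∂PV) +
      (- ∫ x, k x (F a.2.2.1 αs) ∂P + ∫ x, k x (G a.2.2.2 βs) ∂P +
        - ((∫ u, k a.2.1 (F u αs) ∂PU) - ∫ v, k a.2.1 (G v βs) ∂PV)) := by
  have := D.isIID.isProbabilityMeasure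
  obtain ⟨C, hC⟩ := D.kernel.bounded
  set ν := μ.map (triple X U V 0)
  have hF := D.model₁.measurable D.model₁.mem
  have hG := D.model₂.measurable D.model₂.mem
  have mX : MeasurePreserving (fun a : S × 𝒰 × 𝒱 => a.1) ν P :=
    D.measurePreserving_of_comp (by fun_prop) (D.measurePreserving_X 0)
  have mU : MeasurePreserving (fun a : S × 𝒰 × 𝒱 => a.2.1) ν PU :=
    D.measurePreserving_of_comp (by fun_prop) (D.measurePreserving_U 0)
  have mV : MeasurePreserving (fun a : S × 𝒰 × 𝒱 => a.2.2) ν PV :=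
    D.measurePreserving_of_comp (by fun_prop) (D.measurePreserving_V 0)
  have m1 : MeasurePreserving Prod.fst (ν.prod ν) ν := measurePreserving_fst
  have m2 : MeasurePreserving Prod.snd (ν.prod ν) ν := measurePreserving_snd
  have hr : ∀ s : S, Measurable fun x => k x s := fun s =>
    D.kernel.measurable.comp (measurable_id.prodMk measurable_const)
  have e1 := integral_comp_of_measurePreserving (mU.comp m1) (measurable_kernel_left D.kernel.measurable (F a.1.2.1 αs) hF)
  have e2 := integral_comp_of_measurePreserving (mV.comp m1) (measurable_kernel_left D.kernel.measurable (G a.1.2.2 βs) hG)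
  have e3 := integral_comp_of_measurePreserving (mX.comp m2) (hr (F a.2.2.1 αs))
  have e4 := integral_comp_of_measurePreserving (mX.comp m2) (hr (G a.2.2.2 βs))
  have e5 := integral_comp_of_measurePreserving (mU.comp m2) (measurable_kernel_left D.kernel.measurable a.2.1 hF)
  have e6 := integral_comp_of_measurePreserving (mV.comp m2) (measurable_kernel_left D.kernel.measurable a.2.1 hG)
  rw [← e1, ← e2, ← e3, ← e4, ← e5, ← e6]
  have i1 : Integrable (fun b => k (F a.1.2.1 αs) (F (((fun a : S × 𝒰 × 𝒱 => a.2.1) ∘ Prod.fst) b)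
      αs)) (ν.prod ν) :=
    integrable_of_abs_le ((measurable_kernel_left D.kernel.measurable (F a.1.2.1 αs) hF).comp (mU.comp m1).measurable) fun _ => hC _ _
  have i2 : Integrable (fun b => k (G a.1.2.2 βs) (G (((fun a : S × 𝒰 × 𝒱 => a.2.2) ∘ Prod.fst) b)
      βs)) (ν.prod ν) :=
    integrable_of_abs_le ((measurable_kernel_left D.kernel.measurable (G a.1.2.2 βs) hG).comp (mV.comp m1).measurable) fun _ => hC _ _
  have i3 : Integrable (fun b => k (((fun a : S × 𝒰 × 𝒱 => a.1) ∘ Prod.snd) b) (F a.2.2.1 αs))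
      (ν.prod ν) :=
    integrable_of_abs_le ((hr (F a.2.2.1 αs)).comp (mX.comp m2).measurable) fun _ => hC _ _
  have i4 : Integrable (fun b => k (((fun a : S × 𝒰 × 𝒱 => a.1) ∘ Prod.snd) b) (G a.2.2.2 βs))
      (ν.prod ν) :=
    integrable_of_abs_le ((hr (G a.2.2.2 βs)).comp (mX.comp m2).measurable) fun _ => hC _ _
  have i5 : Integrable (fun b => k a.2.1 (F (((fun a : S × 𝒰 × 𝒱 => a.2.1) ∘ Prod.snd) b) αs))
      (ν.prod ν) :=
    integrable_of_abs_le ((measurable_kernel_left D.kernel.measurable a.2.1 hF).comp (mU.comp m2).measurable) fun _ => hC _ _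
  have i6 : Integrable (fun b => k a.2.1 (G (((fun a : S × 𝒰 × 𝒱 => a.2.2) ∘ Prod.snd) b) βs))
      (ν.prod ν) :=
    integrable_of_abs_le ((measurable_kernel_left D.kernel.measurable a.2.1 hG).comp (mV.comp m2).measurable) fun _ => hC _ _
  rw [← integral_alternating_sum i1 i2 i3 i4 i5 i6]
  refine integral_congr_ae (ae_of_all _ fun b => ?_)
  -- The term k(x₁, x₃) is common to both models and cancels, so the observation in the first member
  -- of the pair drops out.
  simp only [cmpKerQ, qCmp, qKer, cmpPoint, Function.comp_apply]
  ring

/-- The asymptotic variance of the statistic with kernel `q` is positive. -/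
lemma variance_cmpKerQ_pos (D : ComparisonData μ P PU PV k Θ₁ Θ₂ F G αs βs X U V)
    (hnd : ¬ AllConst k P F PU αs G PV βs) :
    0 < ∫ a, projKer ((μ.map (triple X U V 0)).prod (μ.map (triple X U V 0)))
        (cmpKerQ k F G (αs, βs)) a ^ 2 ∂((μ.map (triple X U V 0)).prod (μ.map (triple X U V 0))) -
      (∫ a, projKer ((μ.map (triple X U V 0)).prod (μ.map (triple X U V 0)))
        (cmpKerQ k F G (αs, βs)) a ∂((μ.map (triple X U V 0)).prod (μ.map (triple X U V 0)))) ^ 2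
      := by
  have := D.isIID.isProbabilityMeasure
  obtain ⟨C, hC⟩ := D.kernel.bounded
  set ν := μ.map (triple X U V 0) with hν
  have hF := D.model₁.measurable D.model₁.mem
  have hG := D.model₂.measurable D.model₂.mem
  have hpm : Measurable (projKer (ν.prod ν) (cmpKerQ k F G (αs, βs))) :=
    measurable_projKer D.measurable_cmpKerQ
  have hp : MemLp (projKer (ν.prod ν) (cmpKerQ k F G (αs, βs))) 2 (ν.prod ν) :=
    MemLp.of_bound hpm.aestronglyMeasurable (8 * C) (ae_of_all _ fun a =>
      abs_projKer_le (fun a b => abs_qCmp_le hC _ _) a)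
  rw [integral_sq_sub_sq_integral_eq_variance hp]
  -- By contraposition: zero variance makes the projection constant, and it is then evaluated at the
  -- first two sample triples in order to split it into independent terms.
  refine lt_of_le_of_ne (variance_nonneg _ _) fun hzero => hnd ?_
  have hconst := ae_eq_integral_of_variance_eq_zero hp hzero.symm
  have hconst' := (D.isIID.measurePreserving_pair (i := 0) (j := 1)
    (by norm_num)).quasiMeasurePreserving.ae hconst
  set f₁ : 𝒰 → ℝ := fun u' => ∫ u, k (F u' αs) (F u αs) ∂PU with hf₁
  set f₂ : 𝒱 → ℝ := fun v' => ∫ v, k (G v' βs) (G v βs) ∂PV with hf₂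
  set f₃ : 𝒰 → ℝ := fun u => ∫ x, k x (F u αs) ∂P with hf₃
  set f₄ : 𝒱 → ℝ := fun v => ∫ x, k x (G v βs) ∂P with hf₄
  set f₅ : S → ℝ := fun s => (∫ u, k s (F u αs) ∂PU) - ∫ v, k s (G v βs) ∂PV with hf₅
  have m₁ : Measurable f₁ := measurable_integral_kernel D.kernel.measurable hF hF
  have m₂ : Measurable f₂ := measurable_integral_kernel D.kernel.measurable hG hG
  have m₃ : Measurable f₃ := by
    simp only [hf₃, D.kernel.symm _ (F _ αs)]
    exact measurable_integral_kernel D.kernel.measurable hF measurable_id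
  have m₄ : Measurable f₄ := by
    simp only [hf₄, D.kernel.symm _ (G _ βs)]
    exact measurable_integral_kernel D.kernel.measurable hG measurable_id
  have m₅ : Measurable f₅ :=
    (measurable_integral_kernel D.kernel.measurable measurable_id hF).sub
      (measurable_integral_kernel D.kernel.measurable measurable_id hG)
  have b₁ : ∀ u, |f₁ u| ≤ C := fun u => abs_integral_le_of_abs_le fun _ => hC _ _
  have b₂ : ∀ u, |f₂ u| ≤ C := fun u => abs_integral_le_of_abs_le fun _ => hC _ _
  have b₃ : ∀ u, |f₃ u| ≤ C := fun u => abs_integral_le_of_abs_le fun _ => hC _ _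
  have b₄ : ∀ u, |f₄ u| ≤ C := fun u => abs_integral_le_of_abs_le fun _ => hC _ _
  have b₅ : ∀ s, |f₅ s| ≤ C + C := fun s => (abs_sub _ _).trans
    (add_le_add (abs_integral_le_of_abs_le fun _ => hC _ _)
      (abs_integral_le_of_abs_le fun _ => hC _ _))
  have hU := D.sample.measurable_U
  have hV := D.sample.measurable_V
  have hX := D.sample.measurable_X
  have l₁ := memLp_comp_of_abs_le (μ := μ) m₁ (hU 0) b₁
  have l₂ := (memLp_comp_of_abs_le (μ := μ) m₂ (hV 0) b₂).neg
  have l₃ := (memLp_comp_of_abs_le (μ := μ) m₃ (hU 1) b₃).neg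
  have l₄ := memLp_comp_of_abs_le (μ := μ) m₄ (hV 1) b₄
  have l₅ := (memLp_comp_of_abs_le (μ := μ) m₅ (hX 1) b₅).neg
  have hsum : AEConst μ fun ω => (f₁ (U 0 ω) + - f₂ (V 0 ω)) +
      (- f₃ (U 1 ω) + f₄ (V 1 ω) + - f₅ (X 1 ω)) := by
    refine ⟨∫ a, projKer (ν.prod ν) (cmpKerQ k F G (αs, βs)) a ∂(ν.prod ν),
      hconst'.mono fun ω hω => ?_⟩
    rw [D.projKer_cmpKerQ] at hω
    exact hω
  have hi01 : IndepFun (fun ω => f₁ (U 0 ω) + - f₂ (V 0 ω))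
      (fun ω => - f₃ (U 1 ω) + f₄ (V 1 ω) + - f₅ (X 1 ω)) μ :=
    (D.isIID.indep.indepFun (by norm_num : (0 : ℕ) ≠ 1)).comp
      (φ := fun a : S × 𝒰 × 𝒱 => f₁ a.2.1 + - f₂ a.2.2)
      (ψ := fun a : S × 𝒰 × 𝒱 => - f₃ a.2.1 + f₄ a.2.2 + - f₅ a.1)
      (by fun_prop) (by fun_prop)
  -- First the two members of the pair are separated, being independent triples; within a member the
  -- components X, U, V are pairwise independent, which is all that additivity of variances needs.
  obtain ⟨hA, hB⟩ := aeConst_of_add (l₁.add l₂) ((l₃.add l₄).add l₅) hi01 hsum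
  obtain ⟨c₁, c₂⟩ := aeConst_of_add l₁ l₂ ((D.indepFun_UV 0).comp m₁ m₂.neg) hA
  obtain ⟨c₃, c₄, c₅⟩ := aeConst_of_add_add l₃ l₄ l₅ ((D.indepFun_UV 1).comp m₃.neg m₄)
    ((D.indepFun_XU 1).symm.comp m₃.neg m₅.neg) ((D.indepFun_XV 1).symm.comp m₄ m₅.neg) hB
  exact ⟨aeConst_of_comp (D.measurePreserving_U 1) m₃ c₃.neg,
    aeConst_of_comp (D.measurePreserving_U 0) m₁ c₁,
    aeConst_of_comp (D.measurePreserving_V 1) m₄ c₄,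
    aeConst_of_comp (D.measurePreserving_V 0) m₂ c₂.neg,
    aeConst_of_comp (D.measurePreserving_X 1) m₅ c₅.neg⟩

end ComparisonData

end Nondegeneracy

/-! ### Deterministic limit calculus for the studentized quotient. -/

section Ratio

variable {Ω : Type*} [MeasurableSpace Ω] {μ : Measure Ω} {N : ℕ → ℕ} {D Q A B ε R W : ℕ × Ω → ℝ}

/-- Slutsky's lemma for quotients. -/
lemma tendsto_div_sub_of_stochBdd {a b Z : ℕ × Ω → ℝ} {c : ℝ} (hc : c ≠ 0)
    (ha : Tendsto (fun x => a x - c * Z x) (whp μ) (𝓝 0)) (hZ : StochBdd μ Z)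
    (hb : Tendsto b (whp μ) (𝓝 c)) : Tendsto (fun x => a x / b x - Z x) (whp μ) (𝓝 0) := by
  have hi := hb.inv₀ hc
  have h1 := hi.mul ha
  have h2 : Tendsto (fun x => c * (b x)⁻¹ - 1) (whp μ) (𝓝 0) := by
    have := (hi.const_mul c).sub_const 1
    rwa [mul_inv_cancel₀ hc, sub_self] at this
  -- The decomposition a/b - Z = b⁻¹(a - cZ) + (c b⁻¹ - 1)Z.
  have h3 := h1.add (hZ _ h2)
  rw [mul_zero, add_zero] at h3
  exact h3.congr fun x => by ring

/-- The studentized statistic when the unweighted estimator is not degenerate. -/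
lemma tendsto_statistic_sub_of_pos {r : ℕ × Ω → ℝ} {v w : ℝ} (hv : 0 < v)
    (hD : Tendsto (fun x => r x * D x - 2 * W x) (whp μ) (𝓝 0)) (hW : StochBdd μ W)
    (hQ : StochBdd μ (fun x => r x * Q x))
    (hA : Tendsto A (whp μ) (𝓝 (4 * v))) (hB : Tendsto B (whp μ) (𝓝 w))
    (hε : Tendsto ε (whp μ) (𝓝 0)) :
    Tendsto (fun x => r x * (D x + ε x * Q x) / (√(A x) + ε x * √(B x)) - (√v)⁻¹ * W x)
      (whp μ) (𝓝 0) := by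
  have hs : 0 < √v := Real.sqrt_pos.2 hv
  -- The denominator tends to √(4v) = 2√v, and the numerator is close to 2W = 2√v · ((√v)⁻¹ W).
  refine tendsto_div_sub_of_stochBdd (c := 2 * √v) (by positivity) ?_ (hW.const_mul _) ?_
  · have h := hD.add (hQ _ hε)
    rw [add_zero] at h
    refine h.congr fun x => ?_
    field_simp
    ring
  · have h := hA.sqrt.add (hε.mul hB.sqrt)
    rwa [zero_mul, add_zero, Real.sqrt_mul (by norm_num), show √(4 : ℝ) = 2 by
      rw [show (4 : ℝ) = 2 ^ 2 by norm_num, Real.sqrt_sq (by norm_num)]] at h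

/-- The studentized statistic when the unweighted estimator is degenerate. -/
lemma tendsto_statistic_sub_of_degenerate {n : ℕ × Ω → ℝ} {c v w : ℝ} (hc : 0 < c) (hv : 0 < v)
    (hw : w = c ^ 2 * v)
    (hn : ∀ᶠ x in whp μ, 0 < n x) (hD : StochBdd μ (fun x => n x * D x))
    (hA : StochBdd μ (fun x => n x * A x))
    (hQ : Tendsto (fun x => √(n x) * Q x - c * W x) (whp μ) (𝓝 0)) (hW : StochBdd μ W)
    (hB : Tendsto B (whp μ) (𝓝 w))
    (hε0 : ∀ᶠ x in whp μ, 0 < ε x) (hε : Tendsto (fun x => √(n x) * ε x) (whp μ) atTop) :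
    Tendsto (fun x => √(n x) * (D x + ε x * Q x) / (√(A x) + ε x * √(B x)) - (√v)⁻¹ * W x)
      (whp μ) (𝓝 0) := by
  have hs : 0 < √v := Real.sqrt_pos.2 hv
  have hε' := tendsto_inv_atTop_zero.comp hε
  -- Numerator and denominator are divided by ε. The degenerate parts become (√n ε)⁻¹ times the
  -- stochastically bounded n D and √(n A), and √n ε tends to infinity.
  have h := tendsto_div_sub_of_stochBdd (μ := μ) (c := c * √v) (Z := fun x => (√v)⁻¹ * W x)
    (a := fun x => (√(n x) * ε x)⁻¹ * (n x * D x) + √(n x) * Q x)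
    (b := fun x => (√(n x) * ε x)⁻¹ * √(n x * A x) + √(B x))
    (by positivity) ?_ (hW.const_mul _) ?_
  · refine h.congr' ?_
    filter_upwards [hn, hε0] with x hx hx'
    congr 1
    have h1 := Real.mul_self_sqrt hx.le
    have h2 : 0 < √(n x) := Real.sqrt_pos.2 hx
    rw [Real.sqrt_mul hx.le]
    set r := √(n x)
    rw [← h1]
    have e1 : (r * ε x)⁻¹ * (r * r * D x) + r * Q x = (ε x)⁻¹ * (r * (D x + ε x * Q x)) := by
      field_simp
    have e2 : (r * ε x)⁻¹ * (r * √(A x)) + √(B x) = (ε x)⁻¹ * (√(A x) + ε x * √(B x)) := by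
      field_simp
    rw [e1, e2, mul_div_mul_left _ _ (inv_ne_zero hx'.ne')]
  · have h := (hD _ hε').add hQ
    rw [add_zero] at h
    refine h.congr fun x => ?_
    have e : c * √v * ((√v)⁻¹ * W x) = c * W x := by field_simp
    rw [e, Function.comp_apply]
    ring
  · have h := (hA.sqrt _ hε').add hB.sqrt
    rwa [zero_add, hw, Real.sqrt_mul (sq_nonneg c), Real.sqrt_sq hc.le] at h

/-- The studentized statistic diverges when the estimator has a positive limit. -/
lemma tendsto_statistic_atTop {r : ℕ × Ω → ℝ} {θ θ' v w : ℝ} (hθ : 0 < θ) (hw : 0 < w)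
    (hr : Tendsto r (whp μ) atTop)
    (hD : Tendsto D (whp μ) (𝓝 θ)) (hQ : Tendsto Q (whp μ) (𝓝 θ'))
    (hA : Tendsto A (whp μ) (𝓝 v)) (hB : Tendsto B (whp μ) (𝓝 w))
    (hε0 : ∀ᶠ x in whp μ, 0 < ε x) (hε : Tendsto ε (whp μ) (𝓝 0)) :
    Tendsto (fun x => r x * (D x + ε x * Q x) / (√(A x) + ε x * √(B x))) (whp μ) atTop := by
  have hnum : Tendsto (fun x => D x + ε x * Q x) (whp μ) (𝓝 θ) := by
    simpa using hD.add (hε.mul hQ)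
  have hden : Tendsto (fun x => √(A x) + ε x * √(B x)) (whp μ) (𝓝 √v) := by
    simpa using hA.sqrt.add (hε.mul hB.sqrt)
  -- The limit √v of the denominator may be zero. It is bounded above by √v + 1, and positivity
  -- comes from the term ε √B alone.
  have hK : 0 < √v + 1 := by positivity
  refine tendsto_atTop_mono' _ ?_ (hr.atTop_mul_const (r := θ / 2 / (√v + 1)) (by positivity))
  filter_upwards [hnum.eventually_const_lt (half_lt_self hθ),
    hden.eventually_lt_const (lt_add_one _), hε0, hB.eventually_const_lt hw,
    hr.eventually_ge_atTop 0] with x h1 h2 h3 h4 h5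
  have h6 : 0 < √(A x) + ε x * √(B x) :=
    add_pos_of_nonneg_of_pos (Real.sqrt_nonneg _) (mul_pos h3 (Real.sqrt_pos.2 h4))
  have h7 : 0 ≤ D x + ε x * Q x := (half_pos hθ).le.trans h1.le
  rw [mul_div_assoc]
  gcongr

end Ratio

/-! ### Assembly: measurability of the statistic and the three cases. -/

section MainTheorem

variable {S 𝒰 𝒱 Ω : Type*} [MeasurableSpace S] [MeasurableSpace 𝒰] [MeasurableSpace 𝒱]
  [MeasurableSpace Ω]
  {p₁ p₂ : ℕ} {μ : Measure Ω} [IsProbabilityMeasure μ] {P : Measure S}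
  [IsProbabilityMeasure P] {PU : Measure 𝒰} [IsProbabilityMeasure PU]
  {PV : Measure 𝒱} [IsProbabilityMeasure PV] {k : S → S → ℝ}
  {Θ₁ : Set (EuclideanSpace ℝ (Fin p₁))} {Θ₂ : Set (EuclideanSpace ℝ (Fin p₂))}
  {F : 𝒰 → EuclideanSpace ℝ (Fin p₁) → S} {G : 𝒱 → EuclideanSpace ℝ (Fin p₂) → S}
  {αs : EuclideanSpace ℝ (Fin p₁)} {βs : EuclideanSpace ℝ (Fin p₂)}
  {X : ℕ → Ω → S} {U : ℕ → Ω → 𝒰} {V : ℕ → Ω → 𝒱}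
  {αn : ℕ → Ω → EuclideanSpace ℝ (Fin p₁)} {βn : ℕ → Ω → EuclideanSpace ℝ (Fin p₂)}

lemma mmdSqHat_sub_mmdSqHat (n : ℕ) (x y z : ℕ → S) :
    mmdSqHat k n x y - mmdSqHat k n x z = uStat2 n (hCmp k) (fun i => (x i, y i, z i)) :=
  (uStat2_sub n (fun a b : S × S × S => hKer k (a.1, a.2.1) (b.1, b.2.1))
    (fun a b => hKer k (a.1, a.2.2) (b.1, b.2.2)) fun i => (x i, y i, z i)).symm

lemma mmdSqHatQ_sub_mmdSqHatQ (m : ℕ) (x y z : ℕ → S) :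
    mmdSqHatQ k m x y - mmdSqHatQ k m x z =
      uStat2 m (qCmp k) (pairs fun i => (x i, y i, z i)) :=
  (uStat2_sub m (fun a b : (S × S × S) × (S × S × S) =>
    qKer k ((a.1.1, a.1.2.1), (a.2.1, a.2.2.1)) ((b.1.1, b.1.2.1), (b.2.1, b.2.2.1)))
    (fun a b => qKer k ((a.1.1, a.1.2.2), (a.2.1, a.2.2.2)) ((b.1.1, b.1.2.2), (b.2.1, b.2.2.2)))
    (pairs fun i => (x i, y i, z i))).symm

/-- The test statistic in terms of the comparison kernels. -/
lemma testStat_eq (m : ℕ) (ε : ℝ) (x y z : ℕ → S) :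
    testStat k m ε x y z = √((2 * m : ℕ) : ℝ) *
      (uStat2 (2 * m) (hCmp k) (fun i => (x i, y i, z i)) +
        ε * uStat2 m (qCmp k) (pairs fun i => (x i, y i, z i))) /
      (√(uStat3 (2 * m) (prodKer 4 (hCmp k)) (fun i => (x i, y i, z i)) -
          4 * uStat2 (2 * m) (hCmp k) (fun i => (x i, y i, z i)) ^ 2) +
        ε * √(uStat3 m (prodKer 8 (qCmp k)) (pairs fun i => (x i, y i, z i)) -
          8 * uStat2 (2 * m) (hCmp k) (fun i => (x i, y i, z i)) ^ 2)) := by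
  rw [testStat, sigmaSqHat, sigmaSqHatQ, mmdSqHat_sub_mmdSqHat, ← mmdSqHatQ_sub_mmdSqHatQ,
    ← mmdSqHat_sub_mmdSqHat, mmdSqHatEps, mmdSqHatEps]
  congr 2
  ring

lemma measurable_uStat2 {T : Type*} [MeasurableSpace T] {η : T → T → ℝ}
    (hη : Measurable fun z : T × T => η z.1 z.2) {s : ℕ → Ω → T} (hs : ∀ i, Measurable (s i))
    (n : ℕ) : Measurable fun ω => uStat2 n η (fun i => s i ω) := by
  refine (Finset.measurable_fun_sum _ fun i _ => Finset.measurable_fun_sum _ fun j _ => ?_).const_mul _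
  split_ifs
  · exact hη.comp ((hs i).prodMk (hs j))
  · exact measurable_const

lemma measurable_uStat3_prodKer {T : Type*} [MeasurableSpace T] {η : T → T → ℝ}
    (hη : Measurable fun z : T × T => η z.1 z.2) {s : ℕ → Ω → T} (hs : ∀ i, Measurable (s i))
    (c : ℝ) (n : ℕ) : Measurable fun ω => uStat3 n (prodKer c η) (fun i => s i ω) := by
  have h : ∀ i j, Measurable fun ω => η (s i ω) (s j ω) := fun i j =>
    hη.comp ((hs i).prodMk (hs j))
  refine (Finset.measurable_fun_sum _ fun i _ => Finset.measurable_fun_sum _ fun j _ =>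
    Finset.measurable_fun_sum _ fun l _ => ?_).const_mul _
  split_ifs
  · exact ((((h i j).mul (h i l)).add ((h j i).mul (h j l))).add
      ((h l j).mul (h l i))).const_mul _
  · exact measurable_const

lemma measurable_testStat (hk : Measurable fun z : S × S => k z.1 z.2) {ε : Ω → ℝ}
    (hε : Measurable ε) {x y z : ℕ → Ω → S} (hx : ∀ i, Measurable (x i))
    (hy : ∀ i, Measurable (y i)) (hz : ∀ i, Measurable (z i)) (m : ℕ) :
    Measurable fun ω => testStat k m (ε ω) (fun i => x i ω) (fun i => y i ω) (fun i => z i ω) := by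
  simp only [testStat_eq]
  have hs : ∀ i, Measurable fun ω => (x i ω, y i ω, z i ω) := fun i =>
    (hx i).prodMk ((hy i).prodMk (hz i))
  have hp : ∀ i, Measurable fun ω => pairs (fun j => (x j ω, y j ω, z j ω)) i := fun i =>
    (hs (2 * i)).prodMk (hs (2 * i + 1))
  have hh := measurable_hCmp hk measurable_fst (measurable_snd (α := S × S × S) (β := S × S × S))
  have hq := measurable_qCmp hk measurable_fst
    (measurable_snd (α := (S × S × S) × (S × S × S)) (β := (S × S × S) × (S × S × S)))
  have h1 := measurable_uStat2 hh hs (2 * m)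
  have h2 := measurable_uStat2 hq hp m
  have h3 := measurable_uStat3_prodKer hh hs 4 (2 * m)
  have h4 := measurable_uStat3_prodKer hq hp 8 m
  exact ((h1.add (hε.mul h2)).const_mul _).div ((h3.sub ((h1.pow_const 2).const_mul 4)).sqrt.add
    (hε.mul (h4.sub ((h1.pow_const 2).const_mul 8)).sqrt))

lemma RegularModel.measurable_comp {p : ℕ} {F : 𝒰 → EuclideanSpace ℝ (Fin p) → S}
    {Θ : Set (EuclideanSpace ℝ (Fin p))} {αs : EuclideanSpace ℝ (Fin p)}
    (h : RegularModel k P F PU Θ αs) {u : Ω → 𝒰} {α : Ω → EuclideanSpace ℝ (Fin p)}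
    (hu : Measurable u) (hα : Measurable α) (hmem : ∀ ω, α ω ∈ Θ) :
    Measurable fun ω => F (u ω) (α ω) :=
  h.measurable_gen.comp (hu.prodMk (hα.subtype_mk (h := hmem)))

lemma ae_eq_zero_of_integral_sq_eq_zero {T : Type*} [MeasurableSpace T] {ν : Measure T} {f : T → ℝ}
    (hf : Integrable (fun a => f a ^ 2) ν) (h : ∫ a, f a ^ 2 ∂ν = 0) : ∀ᵐ a ∂ν, f a = 0 := by
  rw [integral_eq_zero_iff_of_nonneg (fun a => sq_nonneg (f a)) hf] at h
  exact h.mono fun a ha => by simpa using ha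

lemma EstimatedKernel.tendsto_sqrt_mul_uStat2_of_integral_eq_zero {T Γ : Type*} [MeasurableSpace T]
    {ν : Measure T} {t : ℕ → Ω → T} {N : ℕ → ℕ} {κ : Γ → T → T → ℝ} {γs : Γ} {γ : ℕ → Ω → Γ} {M : ℝ}
    (h : EstimatedKernel μ ν t N κ γs γ M) (h0 : ∫ a, projKer ν (κ γs) a ∂ν = 0) :
    Tendsto (fun x : ℕ × Ω => √((N x.1 : ℕ) : ℝ) *
      uStat2 (N x.1) (κ (γ x.1 x.2)) (fun i => t i x.2) -
      2 * ((√((N x.1 : ℕ) : ℝ))⁻¹ * ∑ i ∈ Finset.range (N x.1),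
        (projKer ν (κ γs) (t i x.2) - ∫ a, projKer ν (κ γs) a ∂ν))) (whp μ) (𝓝 0) :=
  h.tendsto_sqrt_mul_uStat2_sub.congr fun x => by simp only [h0, sub_zero]

lemma EstimatedKernel.stochBdd_sqrt_mul_uStat2_of_integral_eq_zero {T Γ : Type*}
    [MeasurableSpace T] {ν : Measure T} {t : ℕ → Ω → T} {N : ℕ → ℕ} {κ : Γ → T → T → ℝ} {γs : Γ}
    {γ : ℕ → Ω → Γ} {M : ℝ}
    (h : EstimatedKernel μ ν t N κ γs γ M) (h0 : ∫ a, projKer ν (κ γs) a ∂ν = 0) :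
    StochBdd μ (fun x : ℕ × Ω => √((N x.1 : ℕ) : ℝ) *
      uStat2 (N x.1) (κ (γ x.1 x.2)) (fun i => t i x.2)) :=
  h.stochBdd_sqrt_mul_uStat2_sub.congr (Eventually.of_forall fun x => by simp only [h0, sub_zero])

namespace ComparisonData

/-- The quantities entering the test statistic, in terms of the sample of triples. -/
lemma testStat_eq_uStat (m : ℕ) (ε : ℝ) (γ : EuclideanSpace ℝ (Fin p₁) × EuclideanSpace ℝ (Fin p₂))
    (ω : Ω) :
    testStat k m ε (fun i => X i ω) (fun i => F (U i ω) γ.1) (fun i => G (V i ω) γ.2) =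
      √((2 * m : ℕ) : ℝ) * (uStat2 (2 * m) (cmpKerH k F G γ) (fun i => triple X U V i ω) +
        ε * uStat2 m (cmpKerQ k F G γ) (fun i => pairs (fun j => triple X U V j ω) i)) /
      (√(uStat3 (2 * m) (prodKer 4 (cmpKerH k F G γ)) (fun i => triple X U V i ω) -
          4 * uStat2 (2 * m) (cmpKerH k F G γ) (fun i => triple X U V i ω) ^ 2) +
        ε * √(uStat3 m (prodKer 8 (cmpKerQ k F G γ))
            (fun i => pairs (fun j => triple X U V j ω) i) -
          8 * uStat2 (2 * m) (cmpKerH k F G γ) (fun i => triple X U V i ω) ^ 2)) :=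
  testStat_eq m ε _ _ _

variable {ε : ℕ → Ω → ℝ} {T : ℕ → Ω → ℝ}

lemma tendsto_testStat (D : ComparisonData μ P PU PV k Θ₁ Θ₂ F G αs βs X U V)
    (hnd : ¬ AllConst k P F PU αs G PV βs)
    (hαn : BoundedInProb μ (fun m ω => √((2 * m : ℕ) : ℝ) • (αn m ω - αs)))
    (hβn : BoundedInProb μ (fun m ω => √((2 * m : ℕ) : ℝ) • (βn m ω - βs)))
    (hε_pos : ∀ m, ∀ᵐ ω ∂μ, 0 < ε m ω)
    (hε_zero : TendstoInMeasure μ ε atTop (fun _ => 0))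
    (hε_top : TendstoInProbAtTop μ (fun m ω => √((2 * m : ℕ) : ℝ) * ε m ω))
    (hT : ∀ m ω, T m ω = testStat k m (ε m ω) (fun i => X i ω)
      (fun i => F (U i ω) (αn m ω)) (fun i => G (V i ω) (βn m ω)))
    (hT_meas : ∀ m, Measurable (T m)) :
    (mmdSq k (modelLaw F PU αs) P = mmdSq k (modelLaw G PV βs) P →
      TendstoInDistribution T atTop (id : ℝ → ℝ) (fun _ => μ) (gaussianReal 0 1)) ∧
    (mmdSq k (modelLaw G PV βs) P < mmdSq k (modelLaw F PU αs) P → TendstoInProbAtTop μ T) ∧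
    (mmdSq k (modelLaw F PU αs) P < mmdSq k (modelLaw G PV βs) P → TendstoInProbAtBot μ T) := by
  have := D.isIID.isProbabilityMeasure
  obtain ⟨C, hC⟩ := D.kernel.bounded
  have EH := D.estimatedKernelH hαn hβn hC
  have EQ := D.estimatedKernelQ hαn hβn hC
  have hvQ := D.variance_cmpKerQ_pos hnd
  have hθH := D.integral_projKer_cmpKerH
  have hθQ := D.integral_projKer_cmpKerQ
  set ν := μ.map (triple X U V 0)
  set θ := mmdSq k (modelLaw F PU αs) P - mmdSq k (modelLaw G PV βs) P with hθ
  have hε0 : ∀ᶠ x in whp μ, 0 < ε x.1 x.2 := eventually_whp_of_ae hε_pos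
  have hεz := tendsto_whp_zero_iff.2 hε_zero
  have hεt := tendsto_whp_atTop_iff.2 hε_top
  have hN : Tendsto (fun m : ℕ => 2 * m) atTop atTop := EH.tendsto_size
  have hn : ∀ᶠ x in whp μ, (0 : ℝ) < ((2 * x.1 : ℕ) : ℝ) := by
    filter_upwards [eventually_le_of_tendsto (μ := μ) hN 1] with x hx
    exact_mod_cast hx
  have cD := EH.tendsto_uStat2
  have cQ := EQ.tendsto_uStat2
  have cA := (EH.tendsto_uStat3 (c := 4) (by norm_num)).sub ((cD.pow 2).const_mul 4)
  have cB := (EQ.tendsto_uStat3 (c := 8) (by norm_num)).sub ((cD.pow 2).const_mul 8)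
  have bW := EH.stochBdd_sqrt_mul_mean_proj
  have bWQ := EQ.stochBdd_sqrt_mul_mean_proj
  rw [hθH] at cD cA cB
  rw [hθQ] at cQ
  -- The subtracted 4 D² and 8 D² turn second moments of the projections into variances, because D
  -- tends to the common mean θ of both.
  rw [← mul_sub, ← hθH] at cA
  rw [← mul_sub, ← hθQ] at cB
  have hTx : ∀ x : ℕ × Ω, T x.1 x.2 = _ := fun x =>
    (hT x.1 x.2).trans (testStat_eq_uStat x.1 (ε x.1 x.2) (αn x.1 x.2, βn x.1 x.2) x.2)
  have hr : Tendsto (fun x : ℕ × Ω => √((2 * x.1 : ℕ) : ℝ)) (whp μ) atTop :=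
    Real.tendsto_sqrt_atTop.comp (tendsto_natCast_atTop_atTop.comp (hN.comp tendsto_fst_whp))
  have hr2 : ∀ x : ℕ × Ω, √((2 * x.1 : ℕ) : ℝ) = √2 * √((x.1 : ℕ) : ℝ) := fun x => by
    rw [Nat.cast_mul, Nat.cast_ofNat, Real.sqrt_mul (by norm_num)]
  refine ⟨fun hc => ?_, fun hc => ?_, fun hc => ?_⟩
  · have hθ0 : θ = 0 := sub_eq_zero.2 hc
    rw [hθ0] at cD hθH hθQ
    have dD := EH.tendsto_sqrt_mul_uStat2_of_integral_eq_zero hθH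
    have dQ := EQ.tendsto_sqrt_mul_uStat2_of_integral_eq_zero hθQ
    have bQ := (EQ.stochBdd_sqrt_mul_uStat2_of_integral_eq_zero hθQ).const_mul √2
    simp only [← mul_assoc, ← hr2] at bQ
    -- Two regimes: the linear part of D determines the limit if it is present, otherwise that of Q
    -- does.
    by_cases hv : 0 < ∫ a, projKer ν (cmpKerH k F G (αs, βs)) a ^ 2 ∂ν -
        (∫ a, projKer ν (cmpKerH k F G (αs, βs)) a ∂ν) ^ 2
    · refine tendstoInDistribution_of_tendstoInMeasure_sub _ _
        (EH.tendstoInDistribution_mean_proj rfl hv) ?_ fun m => (hT_meas m).aemeasurable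
      refine tendsto_whp_zero_iff.1 ?_
      refine (tendsto_statistic_sub_of_pos hv dD bW bQ cA cB hεz).congr fun x => ?_
      rw [Pi.sub_apply, Pi.sub_apply, hTx]
    -- Since the mean is zero, vanishing variance means that the projection is zero almost
    -- everywhere.
    · have hsq : ∫ a, projKer ν (cmpKerH k F G (αs, βs)) a ^ 2 ∂ν = 0 := by
        rw [hθH] at hv
        exact le_antisymm (by linarith) (integral_nonneg fun a => sq_nonneg _)
      have h0 := ae_eq_zero_of_integral_sq_eq_zero (integrable_of_abs_le (M := (8 * C) ^ 2)
        (EH.measurable_proj.pow_const 2) fun a => by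
          rw [abs_pow]
          exact pow_le_pow_left₀ (abs_nonneg _) (EH.abs_proj_le a) 2) hsq
      have bD := EH.stochBdd_mul_uStat2_of_degenerate h0
      have bA : StochBdd μ (fun x => ((2 * x.1 : ℕ) : ℝ) *
          (uStat3 (2 * x.1) (prodKer 4 (cmpKerH k F G (αn x.1 x.2, βn x.1 x.2)))
            (fun i => triple X U V i x.2) -
          4 * uStat2 (2 * x.1) (cmpKerH k F G (αn x.1 x.2, βn x.1 x.2))
            (fun i => triple X U V i x.2) ^ 2)) :=
        ((EH.stochBdd_mul_uStat3_of_degenerate (c := 4) (by norm_num) h0).sub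
          ((bD.mul (StochBdd.of_tendsto cD)).const_mul 4)).congr
          (Eventually.of_forall fun x => by ring)
      -- Scaling by √n = √2 √m instead of √m turns the factor 2 of the projection into 2√2, whose
      -- square 8 is the constant in σ̂_q².
      have dQ2 : Tendsto (fun x : ℕ × Ω => _ - 2 * √2 * _) (whp μ) (𝓝 0) :=
        (mul_zero √2 ▸ dQ.const_mul √2).congr fun x => by
          rw [mul_sub, ← mul_assoc, ← hr2, mul_left_comm, ← mul_assoc 2]
      refine tendstoInDistribution_of_tendstoInMeasure_sub _ _
        (EQ.tendstoInDistribution_mean_proj rfl hvQ) ?_ fun m => (hT_meas m).aemeasurable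
      refine tendsto_whp_zero_iff.1 ?_
      refine (tendsto_statistic_sub_of_degenerate (c := 2 * √2) (by positivity) hvQ
        (by rw [mul_pow, Real.sq_sqrt (by norm_num)]; norm_num) hn bD bA dQ2 bWQ cB hε0 hεt).congr
        fun x => ?_
      rw [Pi.sub_apply, Pi.sub_apply, hTx]
  · rw [← tendsto_whp_atTop_iff]
    simp only [hTx]
    exact tendsto_statistic_atTop (sub_pos.2 hc) (mul_pos (by norm_num) hvQ) hr cD cQ cA cB hε0 hεz
  · rw [← tendsto_whp_atBot_iff, ← tendsto_neg_atTop_iff]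
    -- The variance estimators do not change when D and Q change sign, so this is the previous case
    -- for -D and -Q.
    have h := tendsto_statistic_atTop (neg_pos.2 (sub_neg.2 hc)) (mul_pos (by norm_num) hvQ) hr
      cD.neg cQ.neg cA cB hε0 hεz
    refine h.congr fun x => ?_
    rw [hTx]
    ring

end ComparisonData

end MainTheorem

end MMDTest

end

theorem mainTheorem5
    {S 𝒰 𝒱 Ω : Type*}
    [TopologicalSpace S] [MeasurableSpace S] [BorelSpace S]
    [TopologicalSpace 𝒰] [MeasurableSpace 𝒰] [BorelSpace 𝒰]
    [TopologicalSpace 𝒱] [MeasurableSpace 𝒱] [BorelSpace 𝒱]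
    [MeasurableSpace Ω] (μ : Measure Ω) [IsProbabilityMeasure μ]
    (P : Measure S) [IsProbabilityMeasure P]
    (PU : Measure 𝒰) [IsProbabilityMeasure PU]
    (PV : Measure 𝒱) [IsProbabilityMeasure PV]
    (k : S → S → ℝ) (hk : MMDTest.IsCharacteristicKernel k)
    (p₁ p₂ : ℕ)
    (Θ₁ : Set (EuclideanSpace ℝ (Fin p₁))) (Θ₂ : Set (EuclideanSpace ℝ (Fin p₂)))
    (F : 𝒰 → EuclideanSpace ℝ (Fin p₁) → S) (G : 𝒱 → EuclideanSpace ℝ (Fin p₂) → S)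
    (αs : EuclideanSpace ℝ (Fin p₁)) (βs : EuclideanSpace ℝ (Fin p₂))
    -- regularity of the two models
    (hF : MMDTest.RegularModel k P F PU Θ₁ αs)
    (hG : MMDTest.RegularModel k P G PV Θ₂ βs)
    -- the parameters minimize the distance to the law of the data
    (hαs : IsMinOn (fun α => MMDTest.mmdSq k (MMDTest.modelLaw F PU α) P) Θ₁ αs)
    (hβs : IsMinOn (fun β => MMDTest.mmdSq k (MMDTest.modelLaw G PV β) P) Θ₂ βs)
    -- non-degeneracy
    (hnd : ¬ MMDTest.AllConst k P F PU αs G PV βs)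
    -- sampling scheme
    (X : ℕ → Ω → S) (U : ℕ → Ω → 𝒰) (V : ℕ → Ω → 𝒱)
    (hsample : MMDTest.IsSample μ P PU PV X U V)
    -- estimators and weights; index `m` stands for the sample size `n = 2 m`
    (αn : ℕ → Ω → EuclideanSpace ℝ (Fin p₁)) (βn : ℕ → Ω → EuclideanSpace ℝ (Fin p₂))
    (hαn_meas : ∀ m, Measurable (αn m)) (hβn_meas : ∀ m, Measurable (βn m))
    (hαn_mem : ∀ m ω, αn m ω ∈ Θ₁) (hβn_mem : ∀ m ω, βn m ω ∈ Θ₂)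
    (hαn : MMDTest.BoundedInProb μ (fun m ω => √((2 * m : ℕ) : ℝ) • (αn m ω - αs)))
    (hβn : MMDTest.BoundedInProb μ (fun m ω => √((2 * m : ℕ) : ℝ) • (βn m ω - βs)))
    (ε : ℕ → Ω → ℝ) (hε_meas : ∀ m, Measurable (ε m))
    (hε_pos : ∀ m, ∀ᵐ ω ∂μ, 0 < ε m ω)
    (hε_zero : TendstoInMeasure μ ε atTop (fun _ => 0))
    (hε_top : MMDTest.TendstoInProbAtTop μ (fun m ω => √((2 * m : ℕ) : ℝ) * ε m ω))
    -- the test statistic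
    (T : ℕ → Ω → ℝ)
    (hT : ∀ m ω, T m ω = MMDTest.testStat k m (ε m ω) (fun i => X i ω)
      (fun i => F (U i ω) (αn m ω)) (fun i => G (V i ω) (βn m ω))) :
    (MMDTest.mmd k (MMDTest.modelLaw F PU αs) P = MMDTest.mmd k (MMDTest.modelLaw G PV βs) P →
      TendstoInDistribution T atTop (id : ℝ → ℝ) (fun _ => μ) (gaussianReal 0 1)) ∧
    (MMDTest.mmd k (MMDTest.modelLaw F PU αs) P > MMDTest.mmd k (MMDTest.modelLaw G PV βs) P →
      MMDTest.TendstoInProbAtTop μ T) ∧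
    (MMDTest.mmd k (MMDTest.modelLaw F PU αs) P < MMDTest.mmd k (MMDTest.modelLaw G PV βs) P →
      MMDTest.TendstoInProbAtBot μ T) := by
  have D : MMDTest.ComparisonData μ P PU PV k Θ₁ Θ₂ F G αs βs X U V :=
    ⟨hk, hF, hG, hαs, hβs, hsample⟩
  have hT_meas : ∀ m, Measurable (T m) := fun m => by
    rw [show T m = _ from funext (hT m)]
    exact MMDTest.measurable_testStat hk.measurable (hε_meas m) hsample.measurable_X
      (fun i => hF.measurable_comp (hsample.measurable_U i) (hαn_meas m) (hαn_mem m))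
      (fun i => hG.measurable_comp (hsample.measurable_V i) (hβn_meas m) (hβn_mem m)) m
  obtain ⟨h₁, h₂, h₃⟩ := D.tendsto_testStat hnd hαn hβn hε_pos hε_zero hε_top hT hT_meas
  obtain ⟨hF0, hG0⟩ := D.mmdSq_nonneg
  exact ⟨fun h => h₁ ((Real.sqrt_inj hF0 hG0).1 h), fun h => h₂ ((Real.sqrt_lt_sqrt_iff hG0).1 h),
    fun h => h₃ ((Real.sqrt_lt_sqrt_iff hF0).1 h)⟩
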